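/- Let $\Lambda^{\pm}$ be the commutative $\mathbb C$-algebra with free generators $p_a$, $a\in\mathbb Z$, and let $\varphi_N:\Lambda^\pm\to\mathbb C[z_1^{\pm1},\dots,z_N^{\pm1}]$ be given by $p_a\mapsto z_1^a+\dots+z_N^a$. For partitions $\lambda,\mu$ with $r=l(\lambda)$ and $s=l(\mu)$ non-zero parts let $m_{\lambda,\mu}\in\Lambda^\pm$ be the unique element such that, for every $N\ge r+s$, $\varphi_N(m_{\lambda,\mu})$ is the sum of $z^a$ over the distinct permutations $a$ of $(\lambda_1,\dots,\lambda_r,0,\dots,0,-\mu_s,\dots,-\mu_1)\in\mathbb Z^N$. Write $(\tilde\lambda,\tilde\mu)\preccurlyeq(\lambda,\mu)$ if $|\tilde\lambda|-|\tilde\mu|=|\lambda|-|\mu|$ and, for all $n\ge1$, $\tilde\lambda_1+\dots+\tilde\lambda_n\le\lambda_1+\dots+\lambda_n$ and $\tilde\mu_1+\dots+\tilde\mu_n\le\mu_1+\dots+\mu_n$. From now on give $p_0$ a value in $\mathbb C$, so that $\Lambda^\pm$ becomes the polynomial algebra over $\mathbb C$ in the $p_a$, $a\neq0$. For $k\in\mathbb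 C$ put, with $\partial_a=a\,\partial/\partial p_a$, $$\mathcal L_{k,p_0}=\sum_{a,b\in\mathbb Z}p_{a+b}\partial_a\partial_b-k\Big[\sum_{a,b>0}p_ap_b\partial_{a+b}-\sum_{a,b<0}p_ap_b\partial_{a+b}\Big]-kp_0\Big[\sum_{a>0}p_a\partial_a-\sum_{a<0}p_a\partial_a\Big]+(1+k)\sum_{a\in\mathbb Z}a\,p_a\partial_a .$$ The Jack–Laurent symmetric function $P_{\lambda,\mu}(k,p_0)$ is the eigenfunction of $\mathcal L_{k,p_0}$ of the form $m_{\lambda,\mu}$ plus a linear combination of the $m_{\tilde\lambda,\tilde\mu}$ with $(\tilde\lambda,\tilde\mu)\preccurlyeq(\lambda,\mu)$, $(\tilde\lambda,\tilde\mu)\ne(\lambda,\mu)$, whenever there is exactly one such eigenfunction. Let $h_i$ be the complete symmetric functions in the $p_a$, $a>0$ (so $h_0=1$ and $n h_n=\sum_{j=1}^n p_jh_{n-j}$ for $n\ge 1$), let $h_i=0$ for $i<0$, and let $h_i^*$ be the image of $h_i$ under the involution $p_a\mapsto p_{-a}$. **Theorem.** Let $\lambda,\mu$ be partitions. For all but finitely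 many $p_0\in\mathbb C$, the function $P_{\lambda,\mu}(k,p_0)$ is defined for all $k\neq-1$ in a neighbourhood of $-1$ in $\mathbb C$, and, as $k\to-1$, it converges (coefficient by coefficient, as a polynomial in the $p_a$, $a\ne0$) to a limit $P_{\lambda,\mu}(-1)$ that does not depend on $p_0$, namely the $(r+s)\times(r+s)$ determinant $$P_{\lambda,\mu}(-1)=\begin{vmatrix} h^*_{\mu_s}&h^*_{\mu_s-1}&\cdots&h^*_{\mu_s-s-r+1}\\ \vdots&\vdots&\ddots&\vdots\\ h^*_{\mu_1+s-1}&h^*_{\mu_1+s-2}&\cdots&h^*_{\mu_1-r}\\ h_{\lambda_1-s}&h_{\lambda_1-s+1}&\cdots&h_{\lambda_1+r-1}\\ \vdots&\vdots&\ddots&\vdots\\ h_{\lambda_r-s-r+1}&h_{\lambda_r-s-r+2}&\cdots&h_{\lambda_r} \end{vmatrix}$$ whose entry in row $i\le s$ and column $j$ is $h^*_{\mu_{s+1-i}+i-j}$, and in row $s+i$ ($1\le i\le r$) and column $j$ is $h_{\lambda_i-i-s+j}$. -/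

import Mathlib

noncomputable section

namespace JackLaurent

open MvPolynomial Finset

/-! ## Laurent polynomials in finitely many variables -/

/-- The algebra `ℂ[z₁^{±1}, …, z_N^{±1}]`: finitely supported functions on exponent vectors. -/
abbrev LaurentPoly (N : ℕ) : Type := AddMonoidAlgebra ℂ (Fin N → ℤ)

/-- The Laurent monomial `z₁^{v₁} ⋯ z_N^{v_N}`. -/
def zMon {N : ℕ} (v : Fin N → ℤ) : LaurentPoly N := AddMonoidAlgebra.single v 1

/-- The Laurent monomial symmetric polynomial `m_χ`: the sum of `z^a` over all distinct
permutations `a` of `χ`. -/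
def monomialSymm {N : ℕ} (χ : Fin N → ℤ) : LaurentPoly N :=
  ∑ a ∈ (univ : Finset (Equiv.Perm (Fin N))).image (fun σ : Equiv.Perm (Fin N) => χ ∘ σ), zMon a

/-! ## The algebra of Laurent symmetric functions -/

/-- `Λ^±`: the commutative algebra with free generators `p_a`, `a ∈ ℤ` (including `p₀`). -/
abbrev Lam : Type := MvPolynomial ℤ ℂ

/-- `Λ⁺ ⊗ Λ⁻`: the subalgebra generated by the `p_a` with `a ≠ 0`, as a free algebra. It is also
the algebra obtained from `Λ^±` by giving `p₀` a numerical value. -/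
abbrev LamFib : Type := MvPolynomial {a : ℤ // a ≠ 0} ℂ

/-- The homomorphism `φ_N : Λ^± → ℂ[z₁^{±1}, …, z_N^{±1}]`, `p_a ↦ z₁^a + ⋯ + z_N^a`. -/
def phi (N : ℕ) : Lam →ₐ[ℂ] LaurentPoly N :=
  aeval (fun a : ℤ => ∑ i : Fin N, zMon (Pi.single i a))

/-- The element `p_a`, `a ∈ ℤ`, when `p₀` is given the value `p0 ∈ ℂ`. -/
def pw (p0 : ℂ) (a : ℤ) : LamFib := if h : a = 0 then C p0 else X ⟨a, h⟩

/-- The specialization of the generator `p₀` at the number `p0 ∈ ℂ`. -/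
def specialize (p0 : ℂ) : Lam →ₐ[ℂ] LamFib := aeval (pw p0)

/-- The involution `*`, `p_a^* = p_{-a}`. -/
def invol : LamFib →ₐ[ℂ] LamFib :=
  rename (fun a : {a : ℤ // a ≠ 0} => (⟨-a.1, neg_ne_zero.mpr a.2⟩ : {a : ℤ // a ≠ 0}))

/-! ## The Calogero-Moser-Sutherland operator -/

/-- `∂_a = a ∂/∂p_a` for `a ∈ ℤ` (so `∂₀ = 0`). -/
def del (a : ℤ) : LamFib →ₗ[ℂ] LamFib :=
  if h : a = 0 then 0 else (a : ℂ) • (pderiv (R := ℂ) (⟨a, h⟩ : {a : ℤ // a ≠ 0})).toLinearMap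

/-- Only finitely many `∂_a` act non-trivially on a given element. -/
theorem finite_del (f : LamFib) : {a : ℤ | del a f ≠ 0}.Finite := by
  refine (f.vars.image Subtype.val).finite_toSet.subset ?_
  intro a ha
  by_cases h : a = 0
  · simp [del, h] at ha
  · by_contra hn
    apply ha
    have : (⟨a, h⟩ : {a : ℤ // a ≠ 0}) ∉ f.vars := by
      intro hv
      exact hn (by simpa using ⟨h, hv⟩)
    simp [del, h, pderiv_eq_zero_of_notMem_vars this]

/-- Well-definedness of `∑_{a,b ∈ ℤ} p_{a+b} ∂_a ∂_b`. -/
theorem finite_term₁ (p0 : ℂ) (f : LamFib) :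
    (Function.support fun ab : ℤ × ℤ => pw p0 (ab.1 + ab.2) * del ab.1 (del ab.2 f)).Finite := by
  have h := finite_del f
  refine (h.biUnion (t := fun b => (fun a => (a, b)) '' {a : ℤ | del a (del b f) ≠ 0})
    (fun b _ => (finite_del (del b f)).image _)).subset ?_
  rintro ⟨a, b⟩ hab
  have h1 : del a (del b f) ≠ 0 := right_ne_zero_of_mul hab
  have h2 : del b f ≠ 0 := fun h0 => h1 (by simp [h0])
  simp only [Set.mem_iUnion]
  exact ⟨b, h2, a, h1, rfl⟩

/-- Well-definedness of `∑_{a,b > 0} p_a p_b ∂_{a+b}`. -/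
theorem finite_term₂ (p0 : ℂ) (f : LamFib) :
    (Function.support fun ab : ℤ × ℤ =>
      if 0 < ab.1 ∧ 0 < ab.2 then pw p0 ab.1 * pw p0 ab.2 * del (ab.1 + ab.2) f else 0).Finite := by
  have h := finite_del f
  refine (h.biUnion (t := fun c => (Set.Icc 0 c) ×ˢ (Set.Icc 0 c))
    (fun c _ => (Set.finite_Icc 0 c).prod (Set.finite_Icc 0 c))).subset ?_
  rintro ⟨a, b⟩ hab
  simp only [Function.mem_support, ne_eq, ite_eq_right_iff, not_forall] at hab
  obtain ⟨⟨ha, hb⟩, hab⟩ := hab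
  have h1 : del (a + b) f ≠ 0 := right_ne_zero_of_mul hab
  simp only [Set.mem_iUnion]
  refine ⟨a + b, h1, ?_, ?_⟩ <;> simp <;> omega

/-- Well-definedness of `∑_{a,b < 0} p_a p_b ∂_{a+b}`. -/
theorem finite_term₃ (p0 : ℂ) (f : LamFib) :
    (Function.support fun ab : ℤ × ℤ =>
      if ab.1 < 0 ∧ ab.2 < 0 then pw p0 ab.1 * pw p0 ab.2 * del (ab.1 + ab.2) f else 0).Finite := by
  have h := finite_del f
  refine (h.biUnion (t := fun c => (Set.Icc c 0) ×ˢ (Set.Icc c 0))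
    (fun c _ => (Set.finite_Icc c 0).prod (Set.finite_Icc c 0))).subset ?_
  rintro ⟨a, b⟩ hab
  simp only [Function.mem_support, ne_eq, ite_eq_right_iff, not_forall] at hab
  obtain ⟨⟨ha, hb⟩, hab⟩ := hab
  have h1 : del (a + b) f ≠ 0 := right_ne_zero_of_mul hab
  simp only [Set.mem_iUnion]
  refine ⟨a + b, h1, ?_, ?_⟩ <;> simp <;> omega

/-- Well-definedness of the sums `∑_a c_a p_a ∂_a`. -/
theorem finite_term₄ (p0 : ℂ) (c : ℤ → ℂ) (f : LamFib) :
    (Function.support fun a : ℤ => c a • (pw p0 a * del a f)).Finite := by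
  refine (finite_del f).subset ?_
  intro a ha h0
  exact ha (by simp [h0])

/-- A locally finite sum of linear operators. -/
def locSum {ι : Type} (T : ι → LamFib →ₗ[ℂ] LamFib)
    (hT : ∀ f, (Function.support fun i => T i f).Finite) : LamFib →ₗ[ℂ] LamFib where
  toFun f := ∑ᶠ i, T i f
  map_add' f g := by
    simp only [map_add]
    exact finsum_add_distrib (hT f) (hT g)
  map_smul' c f := by
    simp only [map_smul, RingHom.id_apply]
    exact (smul_finsum' c (hT f)).symm

/-- Multiplication by `g` composed with `D`. -/
def mulOp (g : LamFib) (D : LamFib →ₗ[ℂ] LamFib) : LamFib →ₗ[ℂ] LamFib :=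
  (LinearMap.mulLeft ℂ g).comp D

/-- The CMS operator in infinite dimension (Laurent version)
`∑_{a,b∈ℤ} p_{a+b}∂_a∂_b - k[∑_{a,b>0} p_a p_b ∂_{a+b} - ∑_{a,b<0} p_a p_b ∂_{a+b}]
  - k p₀ [∑_{a>0} p_a ∂_a - ∑_{a<0} p_a ∂_a] + (1+k) ∑_{a∈ℤ} a p_a ∂_a`
with the parameters `k` and `p₀` equal to the complex numbers `k` and `p0`. -/
def cms (k p0 : ℂ) : Module.End ℂ LamFib :=
  locSum (fun ab : ℤ × ℤ => mulOp (pw p0 (ab.1 + ab.2)) (del ab.1 ∘ₗ del ab.2))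
      (finite_term₁ p0)
    - k • (locSum (fun ab : ℤ × ℤ =>
            if 0 < ab.1 ∧ 0 < ab.2 then mulOp (pw p0 ab.1 * pw p0 ab.2) (del (ab.1 + ab.2)) else 0)
          (fun f => by
            convert finite_term₂ p0 f using 3 with ab
            split_ifs <;> rfl)
        - locSum (fun ab : ℤ × ℤ =>
            if ab.1 < 0 ∧ ab.2 < 0 then mulOp (pw p0 ab.1 * pw p0 ab.2) (del (ab.1 + ab.2)) else 0)
          (fun f => by
            convert finite_term₃ p0 f using 3 with ab
            split_ifs <;> rfl))
    - (k * p0) • (locSum (fun a : ℤ => (if 0 < a then (1 : ℂ) else 0) • mulOp (pw p0 a) (del a))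
          (finite_term₄ p0 (fun a => if 0 < a then (1 : ℂ) else 0))
        - locSum (fun a : ℤ => (if a < 0 then (1 : ℂ) else 0) • mulOp (pw p0 a) (del a))
          (finite_term₄ p0 (fun a => if a < 0 then (1 : ℂ) else 0)))
    + (1 + k) • locSum (fun a : ℤ => (a : ℂ) • mulOp (pw p0 a) (del a))
          (finite_term₄ p0 (fun a => (a : ℂ)))

/-! ## Pairs of partitions and the monomial functions

A partition is a Young diagram `ν`; its parts are `ν.rowLen 0 ≥ ν.rowLen 1 ≥ …`, its length is
`ν.colLen 0` and its size is `ν.card`. -/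

/-- The length `l(ν)` of a partition: the number of its non-zero parts. -/
def len (ν : YoungDiagram) : ℕ := ν.colLen 0

theorem rowLen_pos_iff (ν : YoungDiagram) (i : ℕ) : 0 < ν.rowLen i ↔ i < len ν := by
  rw [len, ← YoungDiagram.mem_iff_lt_rowLen, ← YoungDiagram.mem_iff_lt_colLen]

/-- `ν̃₁ + ⋯ + ν̃_n ≤ ν₁ + ⋯ + ν_n` for all `n`. -/
def PartialSumsLE (ν' ν : YoungDiagram) : Prop :=
  ∀ n : ℕ, ∑ i ∈ range n, ν'.rowLen i ≤ ∑ i ∈ range n, ν.rowLen i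

/-- The dominance order on pairs of partitions (only pairs of the same weight are compared). -/
def PairLE (x y : YoungDiagram × YoungDiagram) : Prop :=
  (x.1.card : ℤ) - x.2.card = (y.1.card : ℤ) - y.2.card ∧
    PartialSumsLE x.1 y.1 ∧ PartialSumsLE x.2 y.2

/-- `χ = (λ₁, …, λ_l, 0, …, 0, -μ_m, …, -μ₁) ∈ ℤ^N`, for `l(λ) + l(μ) ≤ N`. -/
def chi (lam mu : YoungDiagram) (N : ℕ) : Fin N → ℤ :=
  fun i => (lam.rowLen i : ℤ) - (mu.rowLen (N - 1 - i) : ℤ)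

/-- The universal expression in the `p_a` (with `p₀ = N`) of the sum of
`z_{i₁}^{c₁} ⋯ z_{i_n}^{c_n}` over all `n`-tuples of pairwise distinct indices. -/
def augMon : (n : ℕ) → (Fin n → ℤ) → Lam
  | 0, _ => 1
  | n + 1, c => X (c 0) * augMon n (Fin.tail c)
      - ∑ j : Fin n, augMon n (Function.update (Fin.tail c) j (c 0 + Fin.tail c j))

/-- The non-zero entries `λ₁, …, λ_l, -μ₁, …, -μ_m` of `χ`. -/
def nonzeroParts (lam mu : YoungDiagram) : Fin (len lam + len mu) → ℤ :=
  Fin.append (fun i : Fin (len lam) => (lam.rowLen i : ℤ))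
    (fun j : Fin (len mu) => -(mu.rowLen j : ℤ))

/-- The number of permutations that fix a sequence. -/
def stabCard {n : ℕ} (c : Fin n → ℤ) : ℕ := Nat.card {σ : Equiv.Perm (Fin n) // c ∘ σ = c}

/-- The monomial function `m_{λ,μ} ∈ Λ^±`: the unique element with `φ_N(m_{λ,μ}) = m_χ` for all
`N ≥ l(λ) + l(μ)`; this property is proved in `phi_mon` below. -/
def mon (lam mu : YoungDiagram) : Lam :=
  C ((stabCard (nonzeroParts lam mu) : ℂ)⁻¹) * augMon _ (nonzeroParts lam mu)

theorem zMon_zero {N : ℕ} : (zMon (0 : Fin N → ℤ)) = 1 := rfl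

theorem zMon_mul {N : ℕ} (v w : Fin N → ℤ) : zMon v * zMon w = zMon (v + w) := by
  simp [zMon, AddMonoidAlgebra.single_mul_single]

theorem phi_X (N : ℕ) (a : ℤ) : phi N (X a) = ∑ i : Fin N, zMon (Pi.single i a) := by
  simp [phi]

/-- The exponent vector of `z_{f 0}^{c₀} ⋯ z_{f (n-1)}^{c_{n-1}}`. -/
def place {n N : ℕ} (c : Fin n → ℤ) (f : Fin n → Fin N) : Fin N → ℤ :=
  ∑ j, Pi.single (f j) (c j)

theorem place_apply {n N : ℕ} (c : Fin n → ℤ) (f : Fin n ↪ Fin N) (j : Fin n) :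
    place c f (f j) = c j := by
  simp [place, Finset.sum_apply, Pi.single_apply]

theorem place_notMem {n N : ℕ} (c : Fin n → ℤ) (f : Fin n ↪ Fin N) (i : Fin N)
    (h : i ∉ Set.range f) : place c f i = 0 := by
  simp only [place, Finset.sum_apply]
  refine Finset.sum_eq_zero fun j _ => ?_
  rw [Pi.single_eq_of_ne]
  rintro rfl
  exact h ⟨j, rfl⟩

theorem phi_augMon (N n : ℕ) (c : Fin n → ℤ) :
    phi N (augMon n c) = ∑ f : Fin n ↪ Fin N, zMon (place c f) := by
  induction n with
  | zero =>
    simp [augMon, place, zMon_zero]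
  | succ n ih =>
    simp only [augMon, map_sub, map_mul, map_sum, phi_X, ih]
    rw [← (Equiv.embeddingFinSucc n (Fin N)).symm.sum_comp, Fintype.sum_sigma, sub_eq_iff_eq_add,
      Finset.sum_mul_sum, Finset.sum_comm (s := (univ : Finset (Fin n))), ← Finset.sum_add_distrib,
      Finset.sum_comm]
    refine Finset.sum_congr rfl fun f _ => ?_
    have key : ∀ i : Fin N, zMon (Pi.single i (c 0)) * zMon (place (Fin.tail c) f)
        = zMon (Pi.single i (c 0) + place (Fin.tail c) f) := fun i => zMon_mul _ _
    simp only [key]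
    rw [← Fintype.sum_subtype_add_sum_subtype (fun i : Fin N => i ∉ Set.range f)]
    congr 1
    · refine Finset.sum_congr rfl fun i _ => ?_
      congr 1
      simp [place, Fin.sum_univ_succ, Fin.tail]
    · have e : {i : Fin N // ¬ i ∉ Set.range f} ≃ Fin n :=
        ((Equiv.subtypeEquivRight (by simp)).trans (Equiv.ofInjective f f.injective).symm)
      symm
      refine Finset.sum_bij' (fun j _ => (⟨f j, by simp⟩ : {i : Fin N // ¬ i ∉ Set.range f}))
        (fun i _ => (not_not.mp i.2).choose) (by simp) (by simp) ?_ ?_ ?_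
      · intro j _
        apply f.injective
        exact (not_not.mp (⟨f j, by simp⟩ : {i : Fin N // ¬ i ∉ Set.range f}).2).choose_spec
      · intro i _
        exact Subtype.ext (not_not.mp i.2).choose_spec
      · intro j _
        congr 1
        have : Function.update (Fin.tail c) j (c 0 + Fin.tail c j)
            = Fin.tail c + Pi.single j (c 0) := by
          ext i
          by_cases h : i = j
          · subst h; simp [add_comm]
          · simp [h]
        rw [this]
        simp only [place, Pi.add_apply, Pi.single_add, Finset.sum_add_distrib]
        rw [add_comm]
        congr 1
        rw [Finset.sum_eq_single j]
        · simp
        · intro i _ h; simp [h]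
        · simp

theorem card_place_fiber {n N : ℕ} (c : Fin n → ℤ) (hc : ∀ j, c j ≠ 0) (f₀ : Fin n ↪ Fin N) :
    #{f : Fin n ↪ Fin N | place c f = place c f₀} = stabCard c := by
  classical
  rw [stabCard, Nat.card_eq_fintype_card, Fintype.card_subtype]
  symm
  refine Finset.card_bij (fun σ _ => σ.toEmbedding.trans f₀) ?_ ?_ ?_
  · intro σ hσ
    simp only [Finset.mem_filter, Finset.mem_univ, true_and] at hσ ⊢
    simp only [place]
    rw [← Equiv.sum_comp σ (fun j => (Pi.single (f₀ j) (c j) : Fin N → ℤ))]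
    refine Finset.sum_congr rfl fun j _ => ?_
    have := congrFun hσ j
    simp only [Function.comp_apply] at this
    rw [this]
    rfl
  · intro σ _ τ _ h
    ext j
    have := DFunLike.congr_fun h j
    exact congrArg Fin.val (f₀.injective this)
  · intro f hf
    simp only [Finset.mem_filter, Finset.mem_univ, true_and] at hf
    have hr : ∀ j, ∃ i, f₀ i = f j := by
      intro j
      by_contra hn
      have h1 := place_notMem c f₀ (f j) (by simpa using hn)
      rw [← hf, place_apply] at h1
      exact hc j h1
    choose g hg using hr
    have gi : Function.Injective g := by
      intro a b hab
      apply f.injective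
      rw [← hg, ← hg, hab]
    refine ⟨Equiv.ofBijective g (Finite.injective_iff_bijective.mp gi), ?_, ?_⟩
    · simp only [Finset.mem_filter, Finset.mem_univ, true_and]
      ext j
      simp only [Function.comp_apply, Equiv.ofBijective_apply]
      rw [← place_apply c f₀ (g j), hg, ← hf, place_apply]
    · ext j
      simp [hg]

theorem exists_place_eq_chi (lam mu : YoungDiagram) (N : ℕ) (hN : len lam + len mu ≤ N) :
    ∃ f₀ : Fin (len lam + len mu) ↪ Fin N,
      place (nonzeroParts lam mu) f₀ = chi lam mu N := by
  have z : ∀ (ν : YoungDiagram) (i : ℕ), len ν ≤ i → ν.rowLen i = 0 := fun ν i h => by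
    have := (rowLen_pos_iff ν i).not
    omega
  let g : Fin (len lam + len mu) → Fin N := fun i =>
    if h : (i : ℕ) < len lam then ⟨i, by omega⟩ else ⟨N - 1 - (i - len lam), by omega⟩
  have gi : Function.Injective g := by
    intro a b hab
    simp only [g] at hab
    ext
    split_ifs at hab <;> simp only [Fin.mk.injEq] at hab <;> omega
  refine ⟨⟨g, gi⟩, ?_⟩
  have hp : ∀ j, place (nonzeroParts lam mu) (⟨g, gi⟩ : _ ↪ Fin N) (g j)
      = nonzeroParts lam mu j := fun j => place_apply _ (⟨g, gi⟩ : _ ↪ Fin N) j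
  ext i
  by_cases h1 : (i : ℕ) < len lam
  · have e : i = g (Fin.castAdd _ ⟨i, h1⟩) := by
      simp [g, h1]
    rw [e, hp, ← e]
    rw [nonzeroParts, Fin.append_left]
    simp [chi, z mu (N - 1 - i) (by omega)]
  · by_cases h2 : N - 1 - (i : ℕ) < len mu
    · have e : i = g (Fin.natAdd _ ⟨N - 1 - i, h2⟩) := by
        ext
        simp [g]
        omega
      rw [e, hp, ← e]
      rw [nonzeroParts, Fin.append_right]
      simp [chi, z lam i (by omega)]
    · rw [place_notMem]
      · simp [chi, z lam i (by omega), z mu (N - 1 - i) (by omega)]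
      · rintro ⟨j, hj⟩
        have := congrArg Fin.val hj
        simp only [Function.Embedding.coeFn_mk, g] at this
        split_ifs at this <;> simp at this <;> omega

/-- `m_{λ,μ}` is a common lift of the monomial symmetric Laurent polynomials `m_χ`. -/
theorem phi_mon (lam mu : YoungDiagram) (N : ℕ) (hN : len lam + len mu ≤ N) :
    phi N (mon lam mu) = monomialSymm (chi lam mu N) := by
  classical
  obtain ⟨f₀, h₀⟩ := exists_place_eq_chi lam mu N hN
  have hc : ∀ j, nonzeroParts lam mu j ≠ 0 := by
    intro j
    refine Fin.addCases (fun i => ?_) (fun i => ?_) j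
    · have := (rowLen_pos_iff lam i).mpr i.2
      simp only [nonzeroParts, Fin.append_left]
      omega
    · have := (rowLen_pos_iff mu i).mpr i.2
      simp only [nonzeroParts, Fin.append_right]
      omega
  have hs : ((stabCard (nonzeroParts lam mu) : ℕ) : ℂ) ≠ 0 := by
    rw [← card_place_fiber _ hc f₀]
    exact_mod_cast (Finset.card_pos.mpr ⟨f₀, by simp⟩).ne'
  have himg : (univ : Finset (Fin (len lam + len mu) ↪ Fin N)).image
      (fun f : Fin (len lam + len mu) ↪ Fin N => place (nonzeroParts lam mu) f)
      = (univ : Finset (Equiv.Perm (Fin N))).image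
        (fun σ : Equiv.Perm (Fin N) => chi lam mu N ∘ σ) := by
    ext v
    simp only [Finset.mem_image, Finset.mem_univ, true_and]
    constructor
    · rintro ⟨f, rfl⟩
      let e : {i // i ∈ Set.range f} ≃ {i // i ∈ Set.range f₀} :=
        (Equiv.ofInjective f f.injective).symm.trans (Equiv.ofInjective f₀ f₀.injective)
      refine ⟨e.extendSubtype, ?_⟩
      ext i
      rw [← h₀]
      by_cases hi : i ∈ Set.range f
      · obtain ⟨j, rfl⟩ := hi
        simp only [Function.comp_apply]
        rw [Equiv.extendSubtype_apply_of_mem e _ ⟨j, rfl⟩]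
        have : (e ⟨f j, ⟨j, rfl⟩⟩ : Fin N) = f₀ j := by
          have h3 : (Equiv.ofInjective f f.injective).symm ⟨f j, ⟨j, rfl⟩⟩ = j := by
            rw [Equiv.symm_apply_eq]; rfl
          simp only [e, Equiv.trans_apply, h3]
          rfl
        rw [this, place_apply, place_apply]
      · rw [Function.comp_apply, place_notMem _ _ _ hi,
          place_notMem _ _ _ (Equiv.extendSubtype_not_mem e i hi)]
    · rintro ⟨σ, rfl⟩
      refine ⟨f₀.trans σ.symm.toEmbedding, ?_⟩
      ext i
      rw [Function.comp_apply, ← h₀]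
      by_cases hi : σ i ∈ Set.range f₀
      · obtain ⟨j, hj⟩ := hi
        have : i = (f₀.trans σ.symm.toEmbedding) j := by simp [hj]
        rw [← hj, place_apply]
        conv_lhs => rw [this]
        rw [place_apply]
      · rw [place_notMem _ _ _ hi, place_notMem]
        rintro ⟨j, hj⟩
        exact hi ⟨j, by simp [← hj]⟩
  rw [mon, map_mul, phi_augMon, Finset.sum_comp (fun v => zMon v)
    (fun f : Fin (len lam + len mu) ↪ Fin N => place (nonzeroParts lam mu) f), himg, monomialSymm]
  have hcard : ∀ v ∈ (univ : Finset (Equiv.Perm (Fin N))).image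
        (fun σ : Equiv.Perm (Fin N) => chi lam mu N ∘ σ),
      #{f : Fin (len lam + len mu) ↪ Fin N | place (nonzeroParts lam mu) f = v} • zMon v
        = (stabCard (nonzeroParts lam mu) : ℂ) • zMon v := by
    intro v hv
    rw [← himg] at hv
    simp only [Finset.mem_image, Finset.mem_univ, true_and] at hv
    obtain ⟨f, rfl⟩ := hv
    rw [card_place_fiber _ hc f, Nat.cast_smul_eq_nsmul]
  rw [Finset.sum_congr rfl hcard, ← Finset.smul_sum]
  rw [← MvPolynomial.algebraMap_eq, AlgHom.commutes, ← Algebra.smul_def, smul_smul,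
    inv_mul_cancel₀ hs, one_smul]

/-! ## Complete symmetric functions -/

/-- The complete symmetric function `h_n`, `n ≥ 0`, through Newton's formula
`n h_n = p₁ h_{n-1} + ⋯ + p_n h₀`. In `N` variables it is the sum of all monomials of degree `n`;
this is proved in `phi_complete` below. -/
def complete : ℕ → LamFib
  | 0 => 1
  | n + 1 => C ((n + 1 : ℂ)⁻¹) * ∑ r : Fin (n + 1),
      X ⟨(r : ℤ) + 1, by omega⟩ * complete (n - r)

/-- The image of `h_n` in `N` variables is the sum of all monomials of degree `n`. -/
theorem phi_complete (N n : ℕ) : phi N (rename Subtype.val (complete n)) =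
    ∑ v ∈ Finset.piAntidiag (univ : Finset (Fin N)) n, zMon (fun i => (v i : ℤ)) := by
  induction n using Nat.strong_induction_on with
  | _ n ih =>
    cases n with
    | zero => 
      simp [complete]
      rfl
    | succ n =>
      have hn : ((n : ℂ) + 1) ≠ 0 := by exact_mod_cast Nat.succ_ne_zero n
      rw [complete]
      simp only [map_mul, map_sum, rename_C, rename_X, phi_X]
      rw [← MvPolynomial.algebraMap_eq, AlgHom.commutes, ← Algebra.smul_def,
        inv_smul_eq_iff₀ hn]
      have hr : ∀ r : Fin (n + 1), phi N (rename Subtype.val (complete (n - r)))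
          = ∑ v ∈ Finset.piAntidiag (univ : Finset (Fin N)) (n - r),
            zMon (fun i => (v i : ℤ)) := fun r => ih _ (by omega)
      simp only [hr, Finset.sum_mul_sum, zMon_mul]
      have hl : ∀ v ∈ Finset.piAntidiag (univ : Finset (Fin N)) (n + 1),
          ((n : ℂ) + 1) • (zMon (fun i => (v i : ℤ)) : LaurentPoly N)
            = ∑ i : Fin N, ∑ r : Fin (n + 1),
              if (r : ℕ) < v i then zMon (fun i => (v i : ℤ)) else 0 := by
        intro v hv
        rw [Finset.mem_piAntidiag] at hv
        have h1 : ∀ i : Fin N, (∑ r : Fin (n + 1), if (r : ℕ) < v i then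
            (zMon (fun i => (v i : ℤ)) : LaurentPoly N) else 0)
              = v i • zMon (fun i => (v i : ℤ)) := by
          intro i
          have hle : v i ≤ n + 1 := by
            rw [← hv.1]
            exact Finset.single_le_sum (f := v) (fun _ _ => Nat.zero_le _) (Finset.mem_univ i)
          rw [Fin.sum_univ_eq_sum_range (fun r => if r < v i then
            (zMon (fun i => (v i : ℤ)) : LaurentPoly N) else 0) (n + 1), ← Finset.sum_filter,
            Finset.sum_const]
          congr 1
          have : (Finset.range (n + 1)).filter (fun r => r < v i) = Finset.range (v i) := by
            ext r; simp; omega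
          rw [this, Finset.card_range]
        simp only [h1]
        rw [← Finset.sum_smul, hv.1, ← Nat.cast_smul_eq_nsmul ℂ]
        push_cast
        rfl
      rw [Finset.smul_sum, Finset.sum_congr rfl hl, Finset.sum_comm,
        Finset.sum_comm (s := Finset.piAntidiag (univ : Finset (Fin N)) (n + 1))]
      refine Finset.sum_congr rfl fun i _ => ?_
      rw [Finset.sum_comm]
      refine Finset.sum_congr rfl fun r _ => ?_
      rw [← Finset.sum_filter]
      refine Finset.sum_bij' (fun u _ => u + Pi.single i ((r : ℕ) + 1))
        (fun v _ => v - Pi.single i ((r : ℕ) + 1)) ?_ ?_ ?_ ?_ ?_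
      · intro u hu
        simp only [Finset.mem_piAntidiag, Finset.mem_filter] at hu ⊢
        refine ⟨⟨?_, by simp⟩, by simp; omega⟩
        simp only [Pi.add_apply, Finset.sum_add_distrib, hu.1, Finset.sum_pi_single']
        simp
        omega
      · intro v hv
        simp only [Finset.mem_piAntidiag, Finset.mem_filter] at hv ⊢
        refine ⟨?_, by simp⟩
        have h2 : v - Pi.single i ((r : ℕ) + 1) + Pi.single i ((r : ℕ) + 1) = v := by
          ext j
          by_cases hj : j = i
          · subst hj; simp; omega
          · simp [hj]
        have h3 := hv.1.1
        rw [← h2] at h3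
        simp only [Pi.add_apply, Finset.sum_add_distrib, Finset.sum_pi_single'] at h3
        simp at h3
        simp only [Pi.sub_apply]
        omega
      · intro u _
        ext j; simp
      · intro v hv
        simp only [Finset.mem_filter] at hv
        ext j
        by_cases hj : j = i
        · subst hj; simp; omega
        · simp [hj]
      · intro u _
        congr 1
        ext j
        by_cases hj : j = i
        · subst hj; simp [add_comm]
        · simp [hj]

/-- `h_i` for `i ∈ ℤ`, with `h_i = 0` for `i < 0`. -/
def hInt (i : ℤ) : LamFib := if i < 0 then 0 else complete i.toNat

/-- `h_i^*`, the image of `h_i` under the involution `*`. -/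
def hIntStar (i : ℤ) : LamFib := invol (hInt i)

/-- The Jacobi-Trudy matrix. With rows and columns numbered from `1`, `r = l(λ)`, `s = l(μ)`: for
`1 ≤ i ≤ s` the `(i, j)` entry is `h^*_{μ_{s+1-i} + i - j}`, and for `1 ≤ i ≤ r` the `(s + i, j)`
entry is `h_{λ_i - i - s + j}`. -/
def jtMatrix (lam mu : YoungDiagram) :
    Matrix (Fin (len mu + len lam)) (Fin (len mu + len lam)) LamFib :=
  Matrix.of <| Fin.append
    (fun (i : Fin (len mu)) (j : Fin (len mu + len lam)) =>
      hIntStar ((mu.rowLen (len mu - 1 - i) : ℤ) + i - j))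
    (fun (i : Fin (len lam)) (j : Fin (len mu + len lam)) =>
      hInt ((lam.rowLen i : ℤ) - i - len mu + j))

/-- The Jacobi-Trudy determinant. It lies in `Λ⁺ ⊗ Λ⁻` and does not involve `p₀`. -/
def jacobiTrudy (lam mu : YoungDiagram) : LamFib := (jtMatrix lam mu).det

/-! ## Jack-Laurent symmetric functions -/

/-- The defining property of `P_{λ,μ}(k, p₀)`: it is an eigenfunction of the CMS operator, and it is
`m_{λ,μ}` plus a linear combination of the `m_{λ̃,μ̃}` for pairs `(λ̃, μ̃)` strictly below
`(λ, μ)` in the dominance order. -/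
def IsJackLaurent (k p0 : ℂ) (lam mu : YoungDiagram) (P : LamFib) : Prop :=
  P - specialize p0 (mon lam mu) ∈ Submodule.span ℂ
      {m : LamFib | ∃ x : YoungDiagram × YoungDiagram,
        PairLE x (lam, mu) ∧ x ≠ (lam, mu) ∧ m = specialize p0 (mon x.1 x.2)} ∧
    ∃ E : ℂ, (cms k p0).HasEigenvector E P

/-- The Jack-Laurent symmetric function `P_{λ,μ}(k, p₀)` (an arbitrary element when no element has
the defining property). -/
def jackLaurent (k p0 : ℂ) (lam mu : YoungDiagram) : LamFib :=
  Classical.epsilon (IsJackLaurent k p0 lam mu)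

end JackLaurent

end

/-!
# The limit `k → -1` of the Jack-Laurent symmetric functions

In the basis of the monomial functions `m_{λ,μ}` the CMS operator is triangular for the dominance
order, with diagonal entries `energy k p₀ (λ, μ)`. At `k = -1` these entries are, up to the shift
by `p₀ (|λ| + |μ|)`, twice the sums of the contents of `λ` and `μ`. Strictly below `(λ, μ)` either
the size drops, and the two entries agree for one value of `p₀` only, or both sizes stay the same,
and the content sum drops (`sumSq_sub_sumOdd_lt`). So for all but finitely many `p₀` the eigenvalue
of `(λ, μ)` is simple on the span of the pairs below it at `k = -1`, hence near `k = -1`, and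
`P_{λ,μ} = ∏_{y < (λ,μ)} (L - E_y) / (E_{λ,μ} - E_y) m_{λ,μ}` exists, is unique, and depends
continuously on `k`, also at `k = -1`. It remains to see that the Jacobi-Trudy determinant is an
eigenfunction at `k = -1` of the form `m_{λ,μ}` plus lower terms (`cms_jacobiTrudy`,
`jacobiTrudy_sub_mem`).

Triangularity and the two facts on the determinant are proved in `N` variables with `p₀ = N`, for
all large `N`. The passage to an arbitrary `p₀` rests on the fact that the `m_{λ,μ}` form a basis
of `Λ^±` over `ℂ[p₀]`: a coefficient in this basis is a polynomial in `p₀`, and it is known when its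
values at all large integers `N` are known (`specialize_mem_span`).

In `N` variables the CMS operator is `∑ D_i² - k ∑_{i<j} (z_i + z_j)/(z_i - z_j) (D_i - D_j)`
(`psi_cms`), and the coefficients of the quotient are partial sums along the rays of direction
`e_i - e_j` (`coeff_eq_of_quotient`), which gives triangularity. The Jacobi-Trudy determinant becomes
the quotient of alternants `a_{χ+δ} / a_δ` (`psi_jacobiTrudy_mul_alternant`): the Jacobi-Trudy
matrix times the matrix of the elementary symmetric polynomials in all variables but one is the
matrix of the alternant, up to signs, powers of the variables and a cyclic permutation of the rows.
Conjugation by `a_δ` turns the operator at `k = -1` into `∑ D_i²` up to lower order terms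
(`alternant_mul_cms`), for which every alternant is an eigenfunction.
-/

noncomputable section

namespace JackLaurent

open MvPolynomial Finset Filter

/-! ### Laurent polynomials -/

section Laurent

variable {N : ℕ}

theorem coeff_zMon (v a : Fin N → ℤ) : (zMon v).coeff a = if v = a then 1 else 0 := by
  classical
  rw [zMon, AddMonoidAlgebra.coeff_single, Finsupp.single_apply]

theorem coeff_zMon_mul (v a : Fin N → ℤ) (f : LaurentPoly N) :
    (zMon v * f).coeff a = f.coeff (a - v) := by
  rw [zMon, AddMonoidAlgebra.coeff_single_mul_eq_mul_coeff (m₂ := a - v), one_mul]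
  intro m _
  constructor <;> intro h
  · rw [← h]; abel
  · rw [h]; abel

theorem zMon_induction {p : LaurentPoly N → Prop} (f : LaurentPoly N)
    (zero : p 0) (add : ∀ f g, p f → p g → p (f + g))
    (smul : ∀ (c : ℂ) v, p (c • zMon v)) : p f := by
  induction f using AddMonoidAlgebra.induction_linear with
  | zero => exact zero
  | add f g hf hg => exact add f g hf hg
  | single m r =>
    have : (AddMonoidAlgebra.single m r : LaurentPoly N) = r • zMon m := by
      simp [zMon]
    rw [this]; exact smul r m

/-- The power `z_i^a` of a variable. -/
def zpow (i : Fin N) (a : ℤ) : LaurentPoly N := zMon (Pi.single i a)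

theorem zpow_zero (i : Fin N) : zpow i 0 = 1 := by simp [zpow, zMon_zero]

theorem zpow_mul (i : Fin N) (a b : ℤ) : zpow i a * zpow i b = zpow i (a + b) := by
  simp [zpow, zMon_mul, Pi.single_add]

theorem zpow_natCast (i : Fin N) (n : ℕ) : zpow i (n : ℤ) = zpow i 1 ^ n := by
  induction n with
  | zero => simp [zpow_zero]
  | succ n ih => rw [pow_succ, ← ih, zpow_mul]; simp

theorem zMon_eq_prod (v : Fin N → ℤ) : zMon v = ∏ i, zpow i (v i) := by
  have h : ∀ s : Finset (Fin N), ∏ i ∈ s, zpow i (v i) = zMon (∑ i ∈ s, Pi.single i (v i)) := by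
    classical
    intro s
    induction s using Finset.induction_on with
    | empty => simp [zMon_zero]
    | insert a s ha ih => rw [prod_insert ha, ih, sum_insert ha, zpow, zMon_mul]
  rw [h, Finset.univ_sum_single]

theorem laurent_ext {f g : LaurentPoly N} (h : ∀ a, f.coeff a = g.coeff a) : f = g :=
  AddMonoidAlgebra.coeff_injective (Finsupp.ext h)

/-- The Euler operator `D_i = z_i ∂/∂z_i` as a linear map. -/
def eulerLin (i : Fin N) : LaurentPoly N →ₗ[ℂ] LaurentPoly N where
  toFun f := AddMonoidAlgebra.ofCoeff (Finsupp.onFinset f.coeff.support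
    (fun a => (a i : ℂ) * f.coeff a) (fun a ha => by
      simpa using right_ne_zero_of_mul ha))
  map_add' f g := laurent_ext fun a => by simp [mul_add]
  map_smul' c f := laurent_ext fun a => by simp [mul_left_comm]

theorem coeff_eulerLin (i : Fin N) (f : LaurentPoly N) (a : Fin N → ℤ) :
    (eulerLin i f).coeff a = (a i : ℂ) * f.coeff a := rfl

theorem eulerLin_zMon (i : Fin N) (v : Fin N → ℤ) :
    eulerLin i (zMon v) = (v i : ℂ) • zMon v := by
  refine laurent_ext fun a => ?_
  rw [coeff_eulerLin, AddMonoidAlgebra.coeff_smul_apply, coeff_zMon, smul_eq_mul]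
  split_ifs with h
  · rw [h]
  · simp

/-- The Euler operator `D_i = z_i ∂/∂z_i` as a derivation. -/
def euler (i : Fin N) : Derivation ℂ (LaurentPoly N) (LaurentPoly N) :=
  Derivation.mk' (eulerLin i) fun f g => by
    induction f using zMon_induction with
    | zero => simp
    | add f₁ f₂ h₁ h₂ => simp only [add_mul, map_add, h₁, h₂, smul_eq_mul, mul_add]; ring
    | smul c v =>
      induction g using zMon_induction with
      | zero => simp
      | add g₁ g₂ h₁ h₂ =>
        simp only [mul_add, map_add, h₁, h₂, smul_eq_mul, add_mul]; ring
      | smul d w =>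
        simp only [smul_mul_smul_comm, map_smul, eulerLin_zMon, zMon_mul, smul_eq_mul,
          smul_smul]
        rw [add_comm w v, ← add_smul]
        congr 1
        simp
        ring

theorem coeff_euler (i : Fin N) (f : LaurentPoly N) (a : Fin N → ℤ) :
    (euler i f).coeff a = (a i : ℂ) * f.coeff a := rfl

theorem euler_zMon (i : Fin N) (v : Fin N → ℤ) :
    euler i (zMon v) = (v i : ℂ) • zMon v := eulerLin_zMon i v

theorem euler_zpow (i j : Fin N) (a : ℤ) :
    euler i (zpow j a) = if i = j then (a : ℂ) • zpow j a else 0 := by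
  rw [zpow, euler_zMon]
  split_ifs with h
  · simp [h]
  · simp [h]

/-- If `(z_i - z_j) q = (z_i + z_j) h` and the coefficients of `h` vanish at all points
`a + l (e_i - e_j)`, `l ≥ 1`, then `q` and `h` have the same coefficient at `a`: along this ray
the coefficients of `q` are `q_a = h_a + 2 ∑_{l ≥ 1} h_{a + l (e_i - e_j)}`. -/
theorem coeff_eq_of_quotient {i j : Fin N} (hij : i ≠ j) {q h : LaurentPoly N}
    (hq : (zpow i 1 - zpow j 1) * q = (zpow i 1 + zpow j 1) * h) (a : Fin N → ℤ)
    (ha : ∀ l : ℕ, 1 ≤ l → h.coeff (a + (l : ℤ) • (Pi.single i 1 - Pi.single j 1)) = 0) :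
    q.coeff a = h.coeff a := by
  set e : Fin N → ℤ := Pi.single i 1 - Pi.single j 1 with he
  have step : ∀ b : Fin N → ℤ, q.coeff b - q.coeff (b + e) = h.coeff b + h.coeff (b + e) := by
    intro b
    have := congrArg (fun f : LaurentPoly N => f.coeff (b + Pi.single i 1)) hq
    simp only [sub_mul, add_mul, zpow, AddMonoidAlgebra.coeff_sub, AddMonoidAlgebra.coeff_add,
      Finsupp.sub_apply, Finsupp.add_apply, coeff_zMon_mul] at this
    rw [add_sub_cancel_right, add_sub_assoc] at this
    exact this
  have e_ne : e ≠ 0 := by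
    intro h0
    have := congrFun h0 i
    simp [he, hij] at this
  have fin : ∃ L : ℕ, ∀ l : ℕ, L ≤ l → q.coeff (a + (l : ℤ) • e) = 0 := by
    have hinj : Function.Injective fun l : ℕ => a + (l : ℤ) • e := by
      intro l m hlm
      have := congrFun (add_left_cancel hlm) i
      simp only [he, Pi.smul_apply, Pi.sub_apply, Pi.single_eq_same, Pi.single_eq_of_ne hij,
        smul_eq_mul] at this
      omega
    have hfin : {l : ℕ | q.coeff (a + (l : ℤ) • e) ≠ 0}.Finite := by
      refine Set.Finite.preimage (f := fun l : ℕ => a + (l : ℤ) • e) hinj.injOn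
        (s := {b | q.coeff b ≠ 0}) ?_
      exact q.coeff.hasFiniteSupport
    obtain ⟨L, hL⟩ := hfin.bddAbove
    refine ⟨L + 1, fun l hl => ?_⟩
    by_contra hne
    have := hL hne
    omega
  obtain ⟨L, hL⟩ := fin
  have shift : ∀ l : ℕ, a + (l : ℤ) • e + e = a + ((l + 1 : ℕ) : ℤ) • e := by
    intro l; push_cast; rw [add_smul, one_smul, add_assoc]
  have down : ∀ m l : ℕ, 1 ≤ l → L ≤ l + m → q.coeff (a + (l : ℤ) • e) = 0 := by
    intro m
    induction m with
    | zero => intro l _ h; exact hL l (by omega)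
    | succ m ih =>
      intro l hl hm
      have := step (a + (l : ℤ) • e)
      rw [shift, ha l hl, ha (l + 1) (by omega), ih (l + 1) (by omega) (by omega)] at this
      simpa using this
  have h0 := step a
  have h1 := down L 1 le_rfl (by omega)
  have h2 := ha 1 le_rfl
  simp only [Nat.cast_one, one_smul] at h1 h2
  rw [h1, h2] at h0
  simpa using h0

end Laurent

/-! ### The monomial functions span `Λ^±` over `ℂ[p₀]` -/

theorem augMon_cons {n : ℕ} (a : ℤ) (c : Fin n → ℤ) :
    augMon (n + 1) (Fin.cons a c) = X a * augMon n c
      - ∑ j : Fin n, augMon n (Function.update c j (a + c j)) := by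
  simp [augMon, Fin.tail_cons]

theorem augMon_cons_cons {n : ℕ} (a b : ℤ) (c : Fin n → ℤ) :
    augMon (n + 2) (Fin.cons a (Fin.cons b c)) = X a * X b * augMon n c
      - X a * ∑ j : Fin n, augMon n (Function.update c j (b + c j))
      - X b * ∑ j : Fin n, augMon n (Function.update c j (a + c j))
      - augMon (n + 1) (Fin.cons (a + b) c)
      + ∑ j : Fin n, ∑ l : Fin n, augMon n (Function.update (Function.update c j (a + c j)) l
          (b + Function.update c j (a + c j) l)) := by
  rw [augMon_cons, augMon_cons, Fin.sum_univ_succ]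
  have h0 : (Function.update (Fin.cons b c : Fin (n + 1) → ℤ) 0
      (a + (Fin.cons b c : Fin (n + 1) → ℤ) 0)) = Fin.cons (a + b) c := by
    simp [Fin.update_cons_zero]
  have h1 : ∀ j : Fin n, augMon (n + 1) (Function.update (Fin.cons b c : Fin (n + 1) → ℤ) j.succ
      (a + (Fin.cons b c : Fin (n + 1) → ℤ) j.succ)) =
      X b * augMon n (Function.update c j (a + c j))
      - ∑ l : Fin n, augMon n (Function.update (Function.update c j (a + c j)) l
          (b + Function.update c j (a + c j) l)) := by
    intro j
    rw [← Fin.cons_update, augMon_cons, Fin.cons_succ]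
  rw [h0, Finset.sum_congr rfl fun j _ => h1 j, Finset.sum_sub_distrib, Finset.mul_sum]
  simp only [Finset.mul_sum, mul_sub]
  ring

theorem augMon_cons_cons_comm {n : ℕ} (a b : ℤ) (c : Fin n → ℤ) :
    augMon (n + 2) (Fin.cons a (Fin.cons b c)) = augMon (n + 2) (Fin.cons b (Fin.cons a c)) := by
  rw [augMon_cons_cons, augMon_cons_cons]
  have : ∑ j : Fin n, ∑ l : Fin n, augMon n (Function.update (Function.update c j (a + c j)) l
          (b + Function.update c j (a + c j) l))
      = ∑ j : Fin n, ∑ l : Fin n, augMon n (Function.update (Function.update c j (b + c j)) l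
          (a + Function.update c j (b + c j) l)) := by
    rw [Finset.sum_comm]
    refine Finset.sum_congr rfl fun j _ => Finset.sum_congr rfl fun l _ => ?_
    congr 1
    by_cases h : j = l
    · subst h; simp; ring_nf
    · rw [Function.update_of_ne h, Function.update_of_ne (Ne.symm h), Function.update_comm h]
  rw [this, add_comm a b]
  ring

/-- `augMon n c` depends only on the multiset of the entries of `c`. -/
theorem augMon_comp_perm {n : ℕ} (c : Fin n → ℤ) (σ : Equiv.Perm (Fin n)) :
    augMon n (c ∘ σ) = augMon n c := by
  induction n with
  | zero => rfl
  | succ n ih =>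
    -- The permutations that fix `0` act on the tail, where the induction hypothesis applies.
    have fix0 : ∀ (σ : Equiv.Perm (Fin (n + 1))), σ 0 = 0 → ∀ c : Fin (n + 1) → ℤ,
        augMon (n + 1) (c ∘ σ) = augMon (n + 1) c := by
      intro σ hσ c
      obtain ⟨⟨p, e⟩, rfl⟩ := Equiv.Perm.decomposeFin.symm.surjective σ
      rw [Equiv.Perm.decomposeFin_symm_apply_zero] at hσ
      subst hσ
      rw [← Fin.cons_self_tail c]
      have h1 : (Fin.cons (c 0) (Fin.tail c) : Fin (n + 1) → ℤ) ∘
          (Equiv.Perm.decomposeFin.symm (0, e)) = Fin.cons (c 0) (Fin.tail c ∘ e) := by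
        ext i
        refine Fin.cases ?_ (fun i => ?_) i
        · simp
        · simp [Fin.tail]
      rw [h1, augMon_cons, augMon_cons, ih]
      conv_rhs => rw [← Equiv.sum_comp e]
      congr 1
      refine Finset.sum_congr rfl fun j _ => ?_
      conv_rhs => rw [← ih _ e]
      congr 1
      ext i
      by_cases h : i = j
      · subst h; simp
      · simp [h]
    have swap0 : ∀ (p : Fin (n + 1)) (c : Fin (n + 1) → ℤ),
        augMon (n + 1) (c ∘ Equiv.swap 0 p) = augMon (n + 1) c := by
      intro p c
      cases n with
      | zero =>
        have : p = 0 := Fin.ext (by omega)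
        subst this
        simp
      | succ n =>
        have swap01 : ∀ c : Fin (n + 2) → ℤ,
            augMon (n + 2) (c ∘ Equiv.swap 0 1) = augMon (n + 2) c := by
          intro c
          have e1 : c = Fin.cons (c 0) (Fin.cons (c 1) (Fin.tail (Fin.tail c))) := by
            rw [← Fin.succ_zero_eq_one]
            change c = Fin.cons (c 0) (Fin.cons (Fin.tail c 0) (Fin.tail (Fin.tail c)))
            rw [Fin.cons_self_tail, Fin.cons_self_tail]
          have e2 : c ∘ Equiv.swap 0 1 =
              Fin.cons (c 1) (Fin.cons (c 0) (Fin.tail (Fin.tail c))) := by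
            ext i
            refine Fin.cases ?_ (fun i => Fin.cases ?_ (fun i => ?_) i) i
            · simp
            · simp
            · have h1 : i.succ.succ ≠ (1 : Fin (n + 2)) := by
                rw [← Fin.succ_zero_eq_one]
                exact fun h => Fin.succ_ne_zero _ (Fin.succ_injective _ h)
              simp [Equiv.swap_apply_of_ne_of_ne (Fin.succ_ne_zero _) h1, Fin.tail]
          rw [e2, augMon_cons_cons_comm, ← e1]
        by_cases h0 : p = 0
        · subst h0; simp
        by_cases h1 : p = 1
        · subst h1; exact swap01 c
        have h01 : (0 : Fin (n + 2)) ≠ 1 := by simp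
        have conj : Equiv.swap (0 : Fin (n + 2)) p
            = Equiv.swap 1 p * Equiv.swap 0 1 * Equiv.swap 1 p := by
          have := Equiv.swap_mul_swap_mul_swap (x := (1 : Fin (n + 2))) (y := 0) (z := p)
          grind [Equiv.Perm.mul_apply]
        have h2 : (Equiv.swap 1 p) 0 = 0 := Equiv.swap_apply_of_ne_of_ne h01 (Ne.symm h0)
        rw [conj, Equiv.Perm.coe_mul, Equiv.Perm.coe_mul, ← Function.comp_assoc,
          ← Function.comp_assoc, fix0 _ h2, swap01, fix0 _ h2]
    have hσ : σ = Equiv.swap 0 (σ 0) * (Equiv.swap 0 (σ 0) * σ) := by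
      rw [← mul_assoc]; simp
    rw [hσ, Equiv.Perm.coe_mul, ← Function.comp_assoc, fix0 _ (by simp), swap0]

theorem augMon_cons_zero {n : ℕ} (c : Fin n → ℤ) :
    augMon (n + 1) (Fin.cons 0 c) = (X 0 - C (n : ℂ)) * augMon n c := by
  rw [augMon_cons]
  simp [sub_mul]

/-- Every antitone sequence of natural numbers with finite support is a partition. -/
theorem exists_rowLen_eq (f : ℕ → ℕ) (hf : Antitone f) (n : ℕ) (hn : f n = 0) :
    ∃ ν : YoungDiagram, ∀ i, ν.rowLen i = f i := by
  refine ⟨⟨((range n) ×ˢ (range (f 0))).filter (fun c => c.2 < f c.1), ?_⟩, fun i => ?_⟩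
  · rintro ⟨i, j⟩ ⟨i', j'⟩ h hm
    have h1 : i' ≤ i := h.1
    have h2 : j' ≤ j := h.2
    simp only [coe_filter, mem_product, mem_range, Set.mem_ofPred_eq] at hm ⊢
    have := hf h1
    omega
  · refine eq_of_forall_lt_iff fun j => ?_
    rw [← YoungDiagram.mem_iff_lt_rowLen, ← YoungDiagram.mem_cells]
    simp only [mem_filter, mem_product, mem_range]
    refine ⟨fun h => h.2, fun h => ⟨⟨?_, ?_⟩, h⟩⟩
    · by_contra hi
      have := hf (not_lt.mp hi)
      omega
    · have := hf (Nat.zero_le i)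
      omega

theorem exists_chi_eq {N : ℕ} (κ : Fin N → ℤ) (hκ : Antitone κ) :
    ∃ lam mu : YoungDiagram, len lam + len mu ≤ N ∧ chi lam mu N = κ := by
  obtain ⟨lam, hl⟩ := exists_rowLen_eq (fun i => if h : i < N then (κ ⟨i, h⟩).toNat else 0)
    (by
      intro i j hij
      dsimp only
      split_ifs with h1 h2
      · exact Int.toNat_le_toNat (hκ (by simpa using hij))
      · omega
      · omega
      · exact le_rfl) N (by simp)
  obtain ⟨mu, hm⟩ := exists_rowLen_eq
    (fun i => if h : i < N then (-κ ⟨N - 1 - i, by omega⟩).toNat else 0)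
    (by
      intro i j hij
      dsimp only
      split_ifs with h1 h2
      · refine Int.toNat_le_toNat (neg_le_neg (hκ ?_))
        simp only [Fin.mk_le_mk]; omega
      · omega
      · omega
      · exact le_rfl) N (by simp)
  refine ⟨lam, mu, ?_, ?_⟩
  · by_contra hN
    have a1 : ∀ i, i < len lam → ∃ h : i < N, 0 < κ ⟨i, h⟩ := fun i hi => by
      have := (rowLen_pos_iff lam i).mpr hi
      rw [hl] at this
      split_ifs at this with h
      · exact ⟨h, by omega⟩
      · omega
    have a2 : ∀ i, i < len mu → ∃ h : i < N, κ ⟨N - 1 - i, by omega⟩ < 0 := fun i hi => by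
      have := (rowLen_pos_iff mu i).mpr hi
      rw [hm] at this
      split_ifs at this with h
      · exact ⟨h, by omega⟩
      · omega
    have b1 : len lam ≤ N := by
      by_contra hlt
      obtain ⟨h, -⟩ := a1 N (by omega)
      omega
    have b2 : len mu ≤ N := by
      by_contra hlt
      obtain ⟨h, -⟩ := a2 N (by omega)
      omega
    obtain ⟨c1, d1⟩ := a1 (len lam - 1) (by omega)
    obtain ⟨c2, d2⟩ := a2 (len mu - 1) (by omega)
    have : κ ⟨len lam - 1, c1⟩ ≤ κ ⟨N - 1 - (len mu - 1), by omega⟩ := hκ (by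
      simp only [Fin.mk_le_mk]; omega)
    omega
  · ext i
    rw [chi, hl, hm, dif_pos i.2, dif_pos (by omega)]
    have : (⟨N - 1 - (N - 1 - (i : ℕ)), by omega⟩ : Fin N) = i := by
      ext; simp; omega
    rw [this]
    simp only [Fin.eta]
    omega

theorem stabCard_ne_zero {n : ℕ} (c : Fin n → ℤ) : (stabCard c : ℂ) ≠ 0 := by
  have : Nonempty {σ : Equiv.Perm (Fin n) // c ∘ σ = c} := ⟨1, rfl⟩
  have := Nat.card_pos (α := {σ : Equiv.Perm (Fin n) // c ∘ σ = c})
  exact_mod_cast this.ne'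

/-- An augmented monomial without zero entries is a multiple of some `m_{λ,μ}`. -/
theorem augMon_eq_mon {n : ℕ} (c : Fin n → ℤ) (hc : ∀ i, c i ≠ 0) :
    ∃ (x : YoungDiagram × YoungDiagram) (b : ℂ), augMon n c = C b * mon x.1 x.2 := by
  have hs : Antitone (c ∘ (Tuple.sort c * Fin.revPerm : Equiv.Perm (Fin n))) := by
    intro i j hij
    exact Tuple.monotone_sort c (Fin.rev_le_rev.mpr hij)
  obtain ⟨lam, mu, hN, hchi⟩ := exists_chi_eq _ hs
  obtain ⟨f₀, hf⟩ := exists_place_eq_chi lam mu n hN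
  have heq : len lam + len mu = n := by
    refine le_antisymm hN ?_
    by_contra hlt
    have : ∃ i, i ∉ Set.range f₀ := by
      by_contra hall
      push Not at hall
      have := Fintype.card_le_of_surjective f₀ hall
      simp at this
      omega
    obtain ⟨i, hi⟩ := this
    have h0 := place_notMem (nonzeroParts lam mu) f₀ i hi
    rw [hf, hchi] at h0
    exact hc _ h0
  subst heq
  set τ : Equiv.Perm (Fin (len lam + len mu)) :=
    Equiv.ofBijective f₀ (Finite.injective_iff_bijective.mp f₀.injective) with hτ
  refine ⟨(lam, mu), stabCard (nonzeroParts lam mu), ?_⟩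
  have : nonzeroParts lam mu = c ∘ (Tuple.sort c * Fin.revPerm * τ : Equiv.Perm (Fin (len lam + len mu))) := by
    ext j
    rw [← place_apply (nonzeroParts lam mu) f₀ j, hf, hchi]
    rfl
  rw [mon, ← mul_assoc, ← C_mul, mul_inv_cancel₀ (stabCard_ne_zero _), C_1, one_mul]
  conv_rhs => rw [this]
  rw [augMon_comp_perm]

/-- The `ℂ[p₀]`-span of the monomial functions. -/
def monSpan : Submodule ℂ Lam :=
  Submodule.span ℂ {g | ∃ (n : ℕ) (x : YoungDiagram × YoungDiagram), g = X 0 ^ n * mon x.1 x.2}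

theorem X_zero_mul_mem_monSpan {g : Lam} (hg : g ∈ monSpan) : X 0 * g ∈ monSpan := by
  induction hg using Submodule.span_induction with
  | mem g h =>
    obtain ⟨n, x, rfl⟩ := h
    exact Submodule.subset_span ⟨n + 1, x, by ring⟩
  | zero => simp
  | add f g _ _ h1 h2 => rw [mul_add]; exact add_mem h1 h2
  | smul a g _ h => rw [mul_smul_comm]; exact Submodule.smul_mem _ _ h

theorem augMon_mem_monSpan {n : ℕ} (c : Fin n → ℤ) : augMon n c ∈ monSpan := by
  induction n with
  | zero =>
    obtain ⟨x, b, h⟩ := augMon_eq_mon c (fun i => i.elim0)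
    rw [h, ← smul_eq_C_mul]
    exact Submodule.smul_mem _ _ (Submodule.subset_span ⟨0, x, by simp⟩)
  | succ n ih =>
    by_cases hc : ∀ i, c i ≠ 0
    · obtain ⟨x, b, h⟩ := augMon_eq_mon c hc
      rw [h, ← smul_eq_C_mul]
      exact Submodule.smul_mem _ _ (Submodule.subset_span ⟨0, x, by simp⟩)
    · push Not at hc
      obtain ⟨i, hi⟩ := hc
      rw [← augMon_comp_perm c (Equiv.swap 0 i)]
      have : c ∘ Equiv.swap 0 i = Fin.cons 0 (Fin.tail (c ∘ Equiv.swap 0 i)) := by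
        conv_lhs => rw [← Fin.cons_self_tail (c ∘ Equiv.swap 0 i)]
        simp [hi]
      rw [this, augMon_cons_zero, sub_mul, ← smul_eq_C_mul]
      exact sub_mem (X_zero_mul_mem_monSpan (ih _)) (Submodule.smul_mem _ _ (ih _))

theorem mem_monSpan (g : Lam) : g ∈ monSpan := by
  set A : Submodule ℂ Lam := Submodule.span ℂ {g | ∃ (n : ℕ) (c : Fin n → ℤ), g = augMon n c}
  have hA : A ≤ monSpan := Submodule.span_le.mpr (by
    rintro _ ⟨n, c, rfl⟩
    exact augMon_mem_monSpan c)
  have hX : ∀ (a : ℤ) (g : Lam), g ∈ A → X a * g ∈ A := by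
    intro a g hg
    induction hg using Submodule.span_induction with
    | mem g h =>
      obtain ⟨n, c, rfl⟩ := h
      have := augMon_cons a c
      rw [eq_sub_iff_add_eq] at this
      rw [← this]
      exact add_mem (Submodule.subset_span ⟨_, _, rfl⟩)
        (Submodule.sum_mem _ fun j _ => Submodule.subset_span ⟨_, _, rfl⟩)
    | zero => simp
    | add f g _ _ h1 h2 => rw [mul_add]; exact add_mem h1 h2
    | smul a g _ h => rw [mul_smul_comm]; exact Submodule.smul_mem _ _ h
  refine hA ?_
  induction g using MvPolynomial.induction_on with
  | C a =>
    rw [← mul_one (C a), ← smul_eq_C_mul]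
    exact Submodule.smul_mem _ _ (Submodule.subset_span ⟨0, Fin.elim0, rfl⟩)
  | add f g hf hg => exact add_mem hf hg
  | mul_X f a hf => rw [mul_comm]; exact hX a f hf

/-! ### Dominance -/

theorem rowLen_eq_zero {ν : YoungDiagram} {i : ℕ} (h : len ν ≤ i) : ν.rowLen i = 0 := by
  have := (rowLen_pos_iff ν i).not
  omega

theorem card_eq_sum_rowLen (ν : YoungDiagram) {n : ℕ} (hn : len ν ≤ n) :
    ν.card = ∑ i ∈ range n, ν.rowLen i := by
  rw [YoungDiagram.card, Finset.card_eq_sum_card_fiberwise (f := Prod.fst) (t := range n)]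
  · refine Finset.sum_congr rfl fun i _ => ?_
    rw [YoungDiagram.rowLen_eq_card]
    rfl
  · rintro ⟨i, j⟩ hij
    simp only [coe_range, Set.mem_Iio]
    have h1 : j < ν.rowLen i := YoungDiagram.mem_iff_lt_rowLen.mp hij
    have := (rowLen_pos_iff ν i).mp (by omega)
    omega

theorem sum_range_rowLen_le_card (ν : YoungDiagram) (n : ℕ) :
    ∑ i ∈ range n, ν.rowLen i ≤ ν.card := by
  rw [card_eq_sum_rowLen ν (le_max_left (len ν) n)]
  exact Finset.sum_le_sum_of_subset (range_subset_range.mpr (le_max_right _ _))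

theorem rowLen_injective {ν ν' : YoungDiagram} (h : ∀ i, ν.rowLen i = ν'.rowLen i) : ν = ν' := by
  ext ⟨i, j⟩
  rw [YoungDiagram.mem_cells, YoungDiagram.mem_cells, YoungDiagram.mem_iff_lt_rowLen,
    YoungDiagram.mem_iff_lt_rowLen, h]

theorem PartialSumsLE.antisymm {ν ν' : YoungDiagram} (h : PartialSumsLE ν ν')
    (h' : PartialSumsLE ν' ν) : ν = ν' := by
  refine rowLen_injective fun i => ?_
  have h1 := le_antisymm (h i) (h' i)
  have h2 := le_antisymm (h (i + 1)) (h' (i + 1))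
  rw [sum_range_succ, sum_range_succ] at h2
  omega

theorem PartialSumsLE.card_le {ν ν' : YoungDiagram} (h : PartialSumsLE ν ν') :
    ν.card ≤ ν'.card := by
  rw [card_eq_sum_rowLen ν le_rfl]
  exact (h _).trans (sum_range_rowLen_le_card _ _)

theorem PairLE.trans {x y z : YoungDiagram × YoungDiagram} (h : PairLE x y) (h' : PairLE y z) :
    PairLE x z :=
  ⟨h.1.trans h'.1, fun n => (h.2.1 n).trans (h'.2.1 n), fun n => (h.2.2 n).trans (h'.2.2 n)⟩

theorem PairLE.antisymm {x y : YoungDiagram × YoungDiagram} (h : PairLE x y) (h' : PairLE y x) :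
    x = y :=
  Prod.ext (h.2.1.antisymm h'.2.1) (h.2.2.antisymm h'.2.2)

theorem finite_card_le (n : ℕ) : {ν : YoungDiagram | ν.card ≤ n}.Finite := by
  refine Set.Finite.of_finite_image (f := YoungDiagram.cells)
    (Set.Finite.subset (((range n) ×ˢ (range n)).powerset).finite_toSet ?_) ?_
  · rintro _ ⟨ν, hν, rfl⟩
    simp only [coe_powerset, Set.mem_preimage, Set.mem_powerset_iff, coe_subset]
    rintro ⟨i, j⟩ hij
    have hn : ν.card ≤ n := hν
    have h1 : (range (i + 1)) ×ˢ (range (j + 1)) ⊆ ν.cells := by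
      rintro ⟨i', j'⟩ h
      simp only [mem_product, mem_range] at h
      exact ν.isLowerSet (show (i', j') ≤ (i, j) from ⟨by dsimp only; omega, by dsimp only; omega⟩)
        hij
    have h2 := card_le_card h1
    rw [card_product, card_range, card_range] at h2
    have h3 : (i + 1) * (j + 1) ≤ n := h2.trans hn
    simp only [mem_product, mem_range]
    constructor <;> nlinarith
  · intro ν _ ν' _ h
    exact YoungDiagram.ext h

theorem finite_pairLE (x : YoungDiagram × YoungDiagram) : {y | PairLE y x}.Finite :=
  ((finite_card_le x.1.card).prod (finite_card_le x.2.card)).subset fun _ hy =>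
    ⟨hy.2.1.card_le, hy.2.2.card_le⟩

/-- The dominance order on `ℤ^N`, extended to sequences that need not be decreasing: equal sums,
and every partial sum `a₁ + ⋯ + a_n` is at most the partial sum of `χ`. -/
def Dom {N : ℕ} (a χ : Fin N → ℤ) : Prop :=
  ∑ i, a i = ∑ i, χ i ∧
    ∀ n : ℕ, ∑ i : Fin N, (if (i : ℕ) < n then a i else 0) ≤
      ∑ i : Fin N, if (i : ℕ) < n then χ i else 0

theorem Dom.refl {N : ℕ} (a : Fin N → ℤ) : Dom a a := ⟨rfl, fun _ => le_rfl⟩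

theorem dom_comp_perm {N : ℕ} {χ : Fin N → ℤ} (hχ : Antitone χ) (σ : Equiv.Perm (Fin N)) :
    Dom (χ ∘ σ) χ := by
  refine ⟨Equiv.sum_comp σ χ, fun n => ?_⟩
  have hm : Monovary χ (fun i : Fin N => if (i : ℕ) < n then (1 : ℤ) else 0) := by
    intro i j hij
    apply hχ
    rw [Fin.le_def]
    dsimp only at hij
    split_ifs at hij <;> omega
  simpa using hm.sum_comp_perm_mul_le_sum_mul (σ := σ)

theorem chi_antitone (lam mu : YoungDiagram) (N : ℕ) : Antitone (chi lam mu N) := by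
  intro i j hij
  have h1 := lam.rowLen_anti i j hij
  have h2 := mu.rowLen_anti (N - 1 - j) (N - 1 - i) (by
    have : (i : ℕ) ≤ j := hij
    omega)
  simp only [chi]
  omega

theorem sum_fin_ite {N n : ℕ} (hn : n ≤ N) (g : ℕ → ℤ) :
    ∑ i : Fin N, (if (i : ℕ) < n then g i else 0) = ∑ i ∈ range n, g i := by
  rw [Fin.sum_univ_eq_sum_range (fun i => if i < n then g i else 0), ← sum_filter]
  congr 1
  ext i
  simp only [mem_filter, mem_range]
  omega

theorem sum_chi {lam mu : YoungDiagram} {N : ℕ} (hN : len lam + len mu ≤ N) :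
    ∑ i, chi lam mu N i = (lam.card : ℤ) - mu.card := by
  simp only [chi, sum_sub_distrib]
  rw [Fin.sum_univ_eq_sum_range (fun i => (lam.rowLen i : ℤ)),
    Fin.sum_univ_eq_sum_range (fun i => (mu.rowLen (N - 1 - i) : ℤ)),
    Finset.sum_range_reflect (fun i => (mu.rowLen i : ℤ)),
    card_eq_sum_rowLen lam (n := N) (by omega), card_eq_sum_rowLen mu (n := N) (by omega)]
  push_cast
  rfl

theorem chi_of_lt {lam mu : YoungDiagram} {N : ℕ} {i : Fin N}
    (hi : (i : ℕ) < N - len mu) : chi lam mu N i = lam.rowLen i := by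
  rw [chi, rowLen_eq_zero (ν := mu) (by omega)]
  simp

theorem chi_of_ge {lam mu : YoungDiagram} {N : ℕ} {i : Fin N} (hi : len lam ≤ (i : ℕ)) :
    chi lam mu N i = -(mu.rowLen (N - 1 - i) : ℤ) := by
  rw [chi, rowLen_eq_zero (ν := lam) hi]
  simp

theorem partialSumsLE_of_forall_le_len {ν' ν : YoungDiagram}
    (h : ∀ n ≤ len ν', ∑ i ∈ range n, ν'.rowLen i ≤ ∑ i ∈ range n, ν.rowLen i) :
    PartialSumsLE ν' ν := by
  intro n
  rcases le_total n (len ν') with hn | hn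
  · exact h n hn
  · calc _ ≤ ν'.card := sum_range_rowLen_le_card _ _
      _ = _ := card_eq_sum_rowLen ν' le_rfl
      _ ≤ _ := h _ le_rfl
      _ ≤ _ := Finset.sum_le_sum_of_subset (range_subset_range.mpr hn)

theorem pairLE_of_dom_chi {y x : YoungDiagram × YoungDiagram} {N : ℕ}
    (hy : len y.1 + len y.2 ≤ N) (hx : len x.1 + len x.2 ≤ N)
    (h : Dom (chi y.1 y.2 N) (chi x.1 x.2 N)) : PairLE y x := by
  refine ⟨?_, ?_, ?_⟩
  · rw [← sum_chi hy, ← sum_chi hx, h.1]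
  · refine partialSumsLE_of_forall_le_len fun n hn => ?_
    have h1 := h.2 n
    have e1 : ∑ i : Fin N, (if (i : ℕ) < n then chi y.1 y.2 N i else 0)
        = ∑ i ∈ range n, (y.1.rowLen i : ℤ) := by
      rw [← sum_fin_ite (N := N) (by omega)]
      refine Finset.sum_congr rfl fun i _ => ?_
      split_ifs with hi
      · rw [chi_of_lt (by omega)]
      · rfl
    have e2 : ∑ i : Fin N, (if (i : ℕ) < n then chi x.1 x.2 N i else 0)
        ≤ ∑ i ∈ range n, (x.1.rowLen i : ℤ) := by
      rw [← sum_fin_ite (N := N) (by omega)]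
      refine Finset.sum_le_sum fun i _ => ?_
      split_ifs with hi
      · rw [chi]; omega
      · rfl
    rw [e1] at h1
    exact_mod_cast h1.trans e2
  · refine partialSumsLE_of_forall_le_len fun n hn => ?_
    -- The partial sums of `μ` are the opposites of the sums of the last entries of `χ`.
    have split : ∀ a : Fin N → ℤ, ∑ i, a i =
        ∑ i : Fin N, (if (i : ℕ) < N - n then a i else 0)
          + ∑ i : Fin N, (if (i : ℕ) < N - n then 0 else a i) := by
      intro a
      rw [← sum_add_distrib]
      refine Finset.sum_congr rfl fun i _ => ?_
      split_ifs <;> simp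
    have refl : ∀ μ : YoungDiagram, ∑ i : Fin N, (if (i : ℕ) < N - n then (0 : ℤ) else
        -(μ.rowLen (N - 1 - i) : ℤ)) = -∑ i ∈ range n, (μ.rowLen i : ℤ) := by
      intro μ
      rw [← sum_fin_ite (N := N) (by omega), ← sum_neg_distrib, ← Equiv.sum_comp Fin.revPerm]
      refine Finset.sum_congr rfl fun i _ => ?_
      simp only [Fin.revPerm_apply, Fin.val_rev]
      split_ifs with h1 h2 h2
      · omega
      · rfl
      · congr 3; omega
      · omega
    have h1 := h.2 (N - n)
    have h2 := h.1
    rw [split (chi y.1 y.2 N), split (chi x.1 x.2 N)] at h2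
    have e1 : ∑ i : Fin N, (if (i : ℕ) < N - n then 0 else chi y.1 y.2 N i)
        = -∑ i ∈ range n, (y.2.rowLen i : ℤ) := by
      rw [← refl]
      refine Finset.sum_congr rfl fun i _ => ?_
      split_ifs with hi
      · rfl
      · rw [chi_of_ge (by omega)]
    have e2 : -∑ i ∈ range n, (x.2.rowLen i : ℤ)
        ≤ ∑ i : Fin N, (if (i : ℕ) < N - n then 0 else chi x.1 x.2 N i) := by
      rw [← refl]
      refine Finset.sum_le_sum fun i _ => ?_
      split_ifs with hi
      · rfl
      · rw [chi]; omega
    rw [e1] at h2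
    have : ∑ i ∈ range n, (y.2.rowLen i : ℤ) ≤ ∑ i ∈ range n, (x.2.rowLen i : ℤ) := by
      linarith
    exact_mod_cast this

theorem coeff_monomialSymm {N : ℕ} (χ a : Fin N → ℤ) [Decidable (∃ σ : Equiv.Perm (Fin N), χ ∘ σ = a)] :
    (monomialSymm χ).coeff a = if ∃ σ : Equiv.Perm (Fin N), χ ∘ σ = a then 1 else 0 := by
  rw [monomialSymm, AddMonoidAlgebra.coeff_sum, Finsupp.finsetSum_apply]
  simp only [coeff_zMon]
  rw [Finset.sum_ite_eq']
  congr 1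
  simp

theorem dom_of_coeff_monomialSymm_ne_zero {N : ℕ} {χ a : Fin N → ℤ} (hχ : Antitone χ)
    (h : (monomialSymm χ).coeff a ≠ 0) : Dom a χ := by
  classical
  rw [coeff_monomialSymm] at h
  split_ifs at h with hσ
  · obtain ⟨σ, rfl⟩ := hσ
    exact dom_comp_perm hχ σ
  · exact absurd rfl h

open Classical in
theorem coeff_chi_phi_mon {x y : YoungDiagram × YoungDiagram} {N : ℕ}
    (hy : len y.1 + len y.2 ≤ N) (hx : len x.1 + len x.2 ≤ N) :
    (phi N (mon x.1 x.2)).coeff (chi y.1 y.2 N) = if x = y then 1 else 0 := by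
  rw [phi_mon _ _ N hx, coeff_monomialSymm]
  refine if_congr ⟨?_, ?_⟩ rfl rfl
  · rintro ⟨σ, hσ⟩
    have h1 : PairLE y x := by
      refine pairLE_of_dom_chi hy hx ?_
      rw [← hσ]
      exact dom_comp_perm (chi_antitone _ _ _) σ
    have h2 : PairLE x y := by
      refine pairLE_of_dom_chi hx hy ?_
      have : chi x.1 x.2 N = chi y.1 y.2 N ∘ σ.symm := by
        rw [← hσ]; ext i; simp
      rw [this]
      exact dom_comp_perm (chi_antitone _ _ _) σ.symm
    exact h2.antisymm h1
  · rintro rfl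
    exact ⟨1, rfl⟩

/-! ### From finitely many variables to all values of `p₀` -/

/-- The combination of monomial functions whose coefficients are given polynomials in `p₀`. -/
def monComb (F : (YoungDiagram × YoungDiagram) →₀ Polynomial ℂ) : Lam :=
  F.sum fun x p => Polynomial.aeval (X 0 : Lam) p * mon x.1 x.2

theorem exists_monComb_eq (g : Lam) : ∃ F, monComb F = g := by
  have hg := mem_monSpan g
  induction hg using Submodule.span_induction with
  | mem g h =>
    obtain ⟨n, x, rfl⟩ := h
    exact ⟨Finsupp.single x (Polynomial.X ^ n), by simp [monComb]⟩
  | zero => exact ⟨0, by simp [monComb]⟩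
  | add f g _ _ h1 h2 =>
    obtain ⟨F, rfl⟩ := h1
    obtain ⟨G, rfl⟩ := h2
    exact ⟨F + G, Finsupp.sum_add_index' (by simp) (by intros; simp [add_mul])⟩
  | smul a g _ h =>
    obtain ⟨F, rfl⟩ := h
    refine ⟨a • F, ?_⟩
    rw [monComb, Finsupp.sum_smul_index' (by simp), monComb, Finsupp.smul_sum]
    simp

theorem phi_X_zero (N : ℕ) : phi N (X 0) = algebraMap ℂ (LaurentPoly N) N := by
  rw [phi_X]
  simp [zMon_zero]

theorem phi_aeval_X_zero (N : ℕ) (p : Polynomial ℂ) :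
    phi N (Polynomial.aeval (X 0) p) = algebraMap ℂ (LaurentPoly N) (p.eval (N : ℂ)) := by
  rw [← Polynomial.aeval_algHom_apply, phi_X_zero, Polynomial.aeval_algebraMap_apply,
    Polynomial.coe_aeval_eq_eval]

theorem specialize_aeval_X_zero (t : ℂ) (p : Polynomial ℂ) :
    specialize t (Polynomial.aeval (X 0) p) = C (p.eval t) := by
  have h0 : specialize t (X 0) = algebraMap ℂ LamFib t := by
    simp [specialize, pw, MvPolynomial.algebraMap_eq]
  rw [← Polynomial.aeval_algHom_apply, h0, Polynomial.aeval_algebraMap_apply,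
    Polynomial.coe_aeval_eq_eval, MvPolynomial.algebraMap_eq]

theorem specialize_monComb (t : ℂ) (F : (YoungDiagram × YoungDiagram) →₀ Polynomial ℂ) :
    specialize t (monComb F) = F.sum fun x p => p.eval t • specialize t (mon x.1 x.2) := by
  rw [monComb, Finsupp.sum, map_sum, Finsupp.sum]
  simp only [map_mul, specialize_aeval_X_zero, smul_eq_C_mul]

theorem eventually_coeff_phi_monComb (F : (YoungDiagram × YoungDiagram) →₀ Polynomial ℂ)
    (y : YoungDiagram × YoungDiagram) :
    ∀ᶠ N in atTop, (phi N (monComb F)).coeff (chi y.1 y.2 N) = (F y).eval (N : ℂ) := by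
  classical
  have h : ∀ᶠ N in atTop, ∀ x ∈ F.support, len x.1 + len x.2 ≤ N :=
    (eventually_all_finset _).mpr fun x _ => eventually_ge_atTop _
  filter_upwards [h, eventually_ge_atTop (len y.1 + len y.2)] with N hx hy
  rw [monComb, Finsupp.sum, map_sum, AddMonoidAlgebra.coeff_sum, Finsupp.finsetSum_apply]
  have : ∀ x ∈ F.support, (phi N (Polynomial.aeval (X 0) (F x) * mon x.1 x.2)).coeff
      (chi y.1 y.2 N) = if x = y then (F x).eval (N : ℂ) else 0 := by
    intro x hxs
    rw [map_mul, phi_aeval_X_zero, ← Algebra.smul_def, AddMonoidAlgebra.coeff_smul_apply,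
      coeff_chi_phi_mon hy (hx x hxs)]
    split_ifs <;> simp
  rw [Finset.sum_congr rfl this, Finset.sum_ite_eq']
  split_ifs with h0
  · rfl
  · rw [Finsupp.notMem_support_iff.mp h0, Polynomial.eval_zero]

theorem polynomial_eq_of_eventually {p q : Polynomial ℂ}
    (h : ∀ᶠ N : ℕ in atTop, p.eval (N : ℂ) = q.eval (N : ℂ)) : p = q := by
  obtain ⟨n, hn⟩ := eventually_atTop.mp h
  refine Polynomial.eq_of_infinite_eval_eq p q ?_
  refine Set.Infinite.mono (s := (fun N : ℕ => (N : ℂ)) '' Set.Ici n) ?_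
    ((Set.Ici_infinite n).image Nat.cast_injective.injOn)
  rintro _ ⟨N, hN, rfl⟩
  exact hn N hN

/-- If for all large `N` the Laurent polynomials `φ_N(g)` contain only the dominant exponents that
belong to pairs of a set `A`, then for every value of `p₀` the element `g` is a combination of
the monomial functions of `A`. -/
theorem specialize_mem_span (g : Lam) (A : Set (YoungDiagram × YoungDiagram))
    (h : ∀ y ∉ A, ∀ᶠ N in atTop, (phi N g).coeff (chi y.1 y.2 N) = 0) (t : ℂ) :
    specialize t g ∈ Submodule.span ℂ ((fun x => specialize t (mon x.1 x.2)) '' A) := by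
  obtain ⟨F, rfl⟩ := exists_monComb_eq g
  rw [specialize_monComb]
  refine Submodule.sum_mem _ fun x hx => Submodule.smul_mem _ _ (Submodule.subset_span ⟨x, ?_, rfl⟩)
  by_contra hA
  refine Finsupp.mem_support_iff.mp hx (polynomial_eq_of_eventually ?_)
  filter_upwards [h x hA, eventually_coeff_phi_monComb F x] with N h1 h2
  rw [← h2, h1, Polynomial.eval_zero]

/-- An element that vanishes in `N` variables for all large `N` is zero. -/
theorem specialize_eq_zero (g : Lam) (h : ∀ᶠ N in atTop, phi N g = 0) (t : ℂ) :
    specialize t g = 0 := by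
  have := specialize_mem_span g ∅ (fun y _ => by
    filter_upwards [h] with N hN
    rw [hN]; rfl) t
  simpa using this

theorem specialize_rename (t : ℂ) (f : LamFib) : specialize t (rename Subtype.val f) = f := by
  rw [specialize, aeval_rename]
  have : (pw t ∘ Subtype.val : {a : ℤ // a ≠ 0} → LamFib) = X := by
    ext1 a
    simp [pw, a.2]
  rw [this, aeval_X_left_apply]

/-- The homomorphism `LamFib → ℂ[z₁^{±1}, …, z_N^{±1}]` that sends `p_a` to `z₁^a + ⋯ + z_N^a`. -/
def psi (N : ℕ) : LamFib →ₐ[ℂ] LaurentPoly N := (phi N).comp (rename Subtype.val)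

theorem psi_X (N : ℕ) (a : {a : ℤ // a ≠ 0}) : psi N (X a) = ∑ i, zpow i (a : ℤ) := by
  simp [psi, phi_X, zpow]

theorem psi_pw (N : ℕ) (a : ℤ) : psi N (pw N a) = ∑ i, zpow i a := by
  rw [pw]
  split_ifs with h
  · subst h
    simp only [zpow_zero, sum_const, card_univ, Fintype.card_fin, nsmul_eq_mul, mul_one]
    rw [← MvPolynomial.algebraMap_eq, AlgHom.commutes]
    simp
  · exact psi_X N ⟨a, h⟩

theorem psi_specialize (N : ℕ) (g : Lam) : psi N (specialize N g) = phi N g := by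
  have : (psi N).comp (specialize N) = phi N := by
    refine MvPolynomial.algHom_ext fun a => ?_
    rw [AlgHom.comp_apply, specialize, aeval_X, psi_pw, phi_X]
    rfl
  rw [← this]
  rfl

/-- The kernel of the specialization `p₀ ↦ t` is generated by `p₀ - t`. -/
theorem exists_eq_mul_of_specialize_eq_zero (t : ℂ) (g : Lam) (h : specialize t g = 0) :
    ∃ g', g = (X 0 - C t) * g' := by
  rw [← dvd_def, ← Ideal.mem_span_singleton, ← Ideal.Quotient.eq_zero_iff_mem]
  set I : Ideal Lam := Ideal.span {X 0 - C t}
  have key : ((Ideal.Quotient.mkₐ ℂ I).comp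
      ((rename Subtype.val).comp (specialize t))) = Ideal.Quotient.mkₐ ℂ I := by
    refine MvPolynomial.algHom_ext fun a => ?_
    simp only [AlgHom.comp_apply, specialize, aeval_X, pw]
    split_ifs with ha
    · subst ha
      rw [rename_C]
      refine (Ideal.Quotient.eq.mpr ?_).symm
      exact Ideal.mem_span_singleton_self _
    · rw [rename_X]
  have := DFunLike.congr_fun key g
  simp only [AlgHom.comp_apply, h, map_zero] at this
  exact this.symm

/-- For every value of `p₀` the monomial functions are linearly independent. -/
theorem specialize_mon_notMem_span (t : ℂ) (x : YoungDiagram × YoungDiagram)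
    (A : Set (YoungDiagram × YoungDiagram)) (hx : x ∉ A) :
    specialize t (mon x.1 x.2) ∉ Submodule.span ℂ ((fun x => specialize t (mon x.1 x.2)) '' A) := by
  classical
  intro hmem
  obtain ⟨a, ha, hsum⟩ := (Finsupp.mem_span_image_iff_linearCombination ℂ).mp hmem
  rw [Finsupp.linearCombination_apply, Finsupp.sum] at hsum
  have hxa : a x = 0 := by
    by_contra h0
    exact hx (ha (Finsupp.mem_support_iff.mpr h0))
  set F : (YoungDiagram × YoungDiagram) →₀ Polynomial ℂ :=
    Finsupp.single x 1 - a.mapRange Polynomial.C (by simp) with hF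
  have h0 : specialize t (monComb F) = 0 := by
    have hsub : monComb F = monComb (Finsupp.single x 1)
        - monComb (a.mapRange Polynomial.C (by simp)) :=
      Finsupp.sum_sub_index (by intros; simp [sub_mul])
    rw [hsub, map_sub, specialize_monComb, specialize_monComb, Finsupp.sum_single_index (by simp),
      Finsupp.sum_mapRange_index (by simp), Finsupp.sum]
    simp [hsum]
  obtain ⟨g', hg'⟩ := exists_eq_mul_of_specialize_eq_zero t _ h0
  obtain ⟨G, rfl⟩ := exists_monComb_eq g'
  have hFx : F x = 1 := by simp [hF, hxa]
  have : (1 : Polynomial ℂ) = (Polynomial.X - Polynomial.C t) * G x := by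
    refine polynomial_eq_of_eventually ?_
    filter_upwards [eventually_coeff_phi_monComb F x, eventually_coeff_phi_monComb G x] with N h1 h2
    rw [hFx, hg', map_mul, map_sub, phi_X_zero, ← MvPolynomial.algebraMap_eq, AlgHom.commutes,
      ← map_sub, ← Algebra.smul_def, AddMonoidAlgebra.coeff_smul_apply, h2] at h1
    rw [← h1]
    simp
  have := congrArg (Polynomial.eval t) this
  simp at this

/-! ### The CMS operator in finitely many variables -/

theorem del_of_ne {a : ℤ} (h : a ≠ 0) (f : LamFib) :
    del a f = (a : ℂ) • pderiv (⟨a, h⟩ : {a : ℤ // a ≠ 0}) f := by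
  simp [del, h]

theorem del_zero (f : LamFib) : del 0 f = 0 := by simp [del]

theorem del_C (a : ℤ) (c : ℂ) : del a (C c) = 0 := by
  by_cases h : a = 0
  · subst h; exact del_zero _
  · simp [del_of_ne h]

theorem del_mul (a : ℤ) (f g : LamFib) : del a (f * g) = f * del a g + g * del a f := by
  by_cases h : a = 0
  · subst h; simp [del_zero]
  · simp only [del_of_ne h, Derivation.leibniz, smul_eq_mul, smul_add, mul_smul_comm]

theorem del_X (a : ℤ) (b : {a : ℤ // a ≠ 0}) :
    del a (X b) = if a = b then C (a : ℂ) else 0 := by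
  by_cases h : a = 0
  · subst h; rw [del_zero, if_neg (Ne.symm b.2)]
  · rw [del_of_ne h, pderiv_X, smul_eq_C_mul]
    by_cases hb : a = b
    · rw [if_pos hb, Pi.single_apply, if_pos (Subtype.ext hb.symm), mul_one]
    · rw [if_neg hb, Pi.single_apply, if_neg (fun h' => hb (congrArg Subtype.val h').symm),
        mul_zero]

/-- The quadratic coefficient `∑ p_m p_{c-m}` over the `m` strictly between `0` and `c > 0`. -/
def quadPos (t : ℂ) (c : ℤ) : LamFib := ∑ m ∈ Ioo 0 c, pw t m * pw t (c - m)

/-- The quadratic coefficient `∑ p_m p_{c-m}` over the `m` strictly between `c < 0` and `0`. -/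
def quadNeg (t : ℂ) (c : ℤ) : LamFib := ∑ m ∈ Ioo c 0, pw t m * pw t (c - m)

/-- The coefficient of `∂_c` in the first order part of the CMS operator. -/
def firstOrder (k t : ℂ) (c : ℤ) : LamFib :=
  -k • (quadPos t c - quadNeg t c) - (k * t) • ((if 0 < c then (1 : ℂ) else 0) • pw t c
    - (if c < 0 then (1 : ℂ) else 0) • pw t c) + (1 + k) • ((c : ℂ) • pw t c)

theorem finsum_quadratic (t : ℂ) {f : LamFib} {A : Finset ℤ} (hA : ∀ a ∉ A, del a f = 0)
    (P : ℤ → ℤ → Prop) [∀ a b, Decidable (P a b)] (J : ℤ → Finset ℤ)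
    (hJ : ∀ a b, P a b ↔ a ∈ J (a + b)) :
    (∑ᶠ ab : ℤ × ℤ, if P ab.1 ab.2 then pw t ab.1 * pw t ab.2 * del (ab.1 + ab.2) f else 0)
      = ∑ c ∈ A, (∑ m ∈ J c, pw t m * pw t (c - m)) * del c f := by
  classical
  rw [finsum_eq_sum_of_support_subset (s := (A.sigma J).image
    fun z : (_ : ℤ) × ℤ => (z.2, z.1 - z.2))]
  · rw [sum_image, sum_sigma]
    · refine Finset.sum_congr rfl fun c _ => ?_
      rw [Finset.sum_mul]
      refine Finset.sum_congr rfl fun m hm => ?_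
      dsimp only
      rw [if_pos ((hJ _ _).mpr (by simpa using hm))]
      simp
    · rintro ⟨c, m⟩ _ ⟨c', m'⟩ _ h
      simp only [Prod.mk.injEq] at h
      obtain ⟨rfl, h⟩ := h
      have : c = c' := by omega
      subst this
      rfl
  · rintro ⟨a, b⟩ hab
    simp only [Function.mem_support, ne_eq, ite_eq_right_iff, not_forall] at hab
    obtain ⟨hP, hab⟩ := hab
    have h1 : a + b ∈ A := by
      by_contra hn
      exact hab (by rw [hA _ hn, mul_zero])
    simp only [coe_image, coe_sigma, Set.mem_image, Set.mem_sigma_iff, Sigma.exists, mem_coe]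
    exact ⟨a + b, a, ⟨h1, (hJ _ _).mp hP⟩, by simp⟩

/-- The CMS operator on `f` as a finite sum, for any finite set of indices that contains all
those with a nonzero contribution. -/
theorem cms_eq_sum (k t : ℂ) {f : LamFib} {A : Finset ℤ} (hA : ∀ a ∉ A, del a f = 0)
    (hA' : ∀ a ∉ A, ∀ b, del a (del b f) = 0) :
    cms k t f = ∑ a ∈ A, ∑ b ∈ A, pw t (a + b) * del a (del b f)
      + ∑ c ∈ A, firstOrder k t c * del c f := by
  have e1 : ∑ᶠ ab : ℤ × ℤ, pw t (ab.1 + ab.2) * del ab.1 (del ab.2 f)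
      = ∑ a ∈ A, ∑ b ∈ A, pw t (a + b) * del a (del b f) := by
    rw [finsum_eq_sum_of_support_subset (s := A ×ˢ A), sum_product]
    rintro ⟨a, b⟩ hab
    have h1 : del a (del b f) ≠ 0 := right_ne_zero_of_mul hab
    simp only [coe_product, Set.mem_prod, mem_coe]
    constructor
    · by_contra hn
      exact h1 (hA' a hn b)
    · by_contra hn
      exact h1 (by rw [hA b hn, map_zero])
  have e2 : ∑ᶠ ab : ℤ × ℤ, (if 0 < ab.1 ∧ 0 < ab.2 then
        pw t ab.1 * pw t ab.2 * del (ab.1 + ab.2) f else 0)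
      = ∑ c ∈ A, quadPos t c * del c f :=
    finsum_quadratic t hA (fun a b => 0 < a ∧ 0 < b) (fun c => Ioo 0 c)
      (by intro a b; simp [mem_Ioo])
  have e3 : ∑ᶠ ab : ℤ × ℤ, (if ab.1 < 0 ∧ ab.2 < 0 then
        pw t ab.1 * pw t ab.2 * del (ab.1 + ab.2) f else 0)
      = ∑ c ∈ A, quadNeg t c * del c f :=
    finsum_quadratic t hA (fun a b => a < 0 ∧ b < 0) (fun c => Ioo c 0)
      (by intro a b; simp [mem_Ioo, and_comm])
  have e4 : ∀ u : ℤ → ℂ, ∑ᶠ c : ℤ, u c • (pw t c * del c f) = ∑ c ∈ A, u c • (pw t c * del c f) := by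
    intro u
    refine finsum_eq_sum_of_support_subset _ ?_
    intro c hc
    by_contra hn
    exact hc (by dsimp only; rw [hA c hn, mul_zero, smul_zero])
  have e2' : ∑ᶠ ab : ℤ × ℤ, (if 0 < ab.1 ∧ 0 < ab.2 then
        mulOp (pw t ab.1 * pw t ab.2) (del (ab.1 + ab.2)) else 0) f
      = ∑ c ∈ A, quadPos t c * del c f := by
    rw [← e2]
    refine finsum_congr fun ab => ?_
    split_ifs <;> rfl
  have e3' : ∑ᶠ ab : ℤ × ℤ, (if ab.1 < 0 ∧ ab.2 < 0 then
        mulOp (pw t ab.1 * pw t ab.2) (del (ab.1 + ab.2)) else 0) f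
      = ∑ c ∈ A, quadNeg t c * del c f := by
    rw [← e3]
    refine finsum_congr fun ab => ?_
    split_ifs <;> rfl
  simp only [cms, locSum, LinearMap.add_apply, LinearMap.sub_apply, LinearMap.smul_apply,
    LinearMap.coe_mk, AddHom.coe_mk]
  rw [e2', e3']
  simp only [mulOp, LinearMap.comp_apply, LinearMap.mulLeft_apply]
  rw [e1, e4, e4, e4]
  simp only [firstOrder, add_mul, sub_mul, smul_mul_assoc, sum_add_distrib, sum_sub_distrib,
    ← Finset.smul_sum, neg_smul, neg_mul, sum_neg_distrib]
  abel

theorem exists_finset_del (f : LamFib) : ∃ A : Finset ℤ, (∀ a ∉ A, del a f = 0) ∧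
    ∀ a ∉ A, ∀ b, del a (del b f) = 0 := by
  classical
  refine ⟨(finite_del f).toFinset ∪
    (finite_del f).toFinset.biUnion fun b => (finite_del (del b f)).toFinset, ?_, ?_⟩
  · intro a ha
    simp only [mem_union, Set.Finite.mem_toFinset, Set.mem_ofPred_eq, not_or, not_not] at ha
    exact ha.1
  · intro a ha b
    simp only [mem_union, Set.Finite.mem_toFinset, Set.mem_ofPred_eq, not_or, mem_biUnion,
      not_exists, not_and, not_not] at ha
    by_cases hb : del b f = 0
    · rw [hb, map_zero]
    · exact ha.2 b hb

theorem specialize_X (t : ℂ) (a : ℤ) : specialize t (X a) = pw t a := by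
  simp [specialize]

theorem del_pw (t : ℂ) (a b : ℤ) : del a (pw t b) = if a = b then C (a : ℂ) else 0 := by
  rw [pw]
  split_ifs with h1 h2 h2
  · subst h1 h2; rw [del_zero]; simp
  · exact del_C _ _
  · rw [del_X, if_pos h2]
  · rw [del_X, if_neg h2]

theorem del_specialize (t : ℂ) (a : ℤ) (g : Lam) :
    del a (specialize t g) = specialize t ((a : ℂ) • pderiv a g) := by
  induction g using MvPolynomial.induction_on with
  | C c => rw [← MvPolynomial.algebraMap_eq, AlgHom.commutes, MvPolynomial.algebraMap_eq, del_C]; simp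
  | add f g hf hg => rw [map_add, map_add, hf, hg, ← map_add, ← smul_add, ← map_add]
  | mul_X f b hf =>
    rw [map_mul, del_mul, hf, specialize_X, del_pw, Derivation.leibniz, pderiv_X, smul_add, map_add,
      Pi.single_apply, smul_eq_mul, smul_eq_mul, map_smul, map_smul, map_smul, map_mul, map_mul,
      specialize_X]
    by_cases h : a = b
    · subst h; simp [smul_eq_C_mul]; ring
    · rw [if_neg h, if_neg (Ne.symm h)]; simp

theorem specialize_C (t c : ℂ) : specialize t (C c) = C c := by
  rw [← MvPolynomial.algebraMap_eq, AlgHom.commutes, MvPolynomial.algebraMap_eq]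

theorem exists_specialize_eq_firstOrder (k : ℂ) (c : ℤ) :
    ∃ u : Lam, ∀ t, specialize t u = firstOrder k t c := by
  refine ⟨C (-k) * (∑ m ∈ Ioo 0 c, X m * X (c - m) - ∑ m ∈ Ioo c 0, X m * X (c - m))
        - C k * X 0 * (C (if 0 < c then (1 : ℂ) else 0) * X c
          - C (if c < 0 then (1 : ℂ) else 0) * X c)
        + C (1 + k) * (C (c : ℂ) * X c), fun t => ?_⟩
  simp only [map_add, map_sub, map_mul, map_sum, specialize_C, specialize_X, firstOrder, quadPos,
    quadNeg, smul_eq_C_mul]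
  have h0 : pw t 0 = C t := dif_pos rfl
  rw [h0]

/-- The action of the CMS operator on a specialization depends polynomially on `p₀`. -/
theorem exists_specialize_eq_cms (k : ℂ) (g : Lam) :
    ∃ G : Lam, ∀ t, specialize t G = cms k t (specialize t g) := by
  classical
  set A : Finset ℤ := g.vars ∪ g.vars.biUnion fun b => (pderiv b g).vars
  have h1 : ∀ a ∉ A, pderiv a g = 0 := fun a ha =>
    pderiv_eq_zero_of_notMem_vars fun h => ha (mem_union_left _ h)
  have h2 : ∀ a ∉ A, ∀ b, pderiv a (pderiv b g) = 0 := by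
    intro a ha b
    by_cases hb : b ∈ g.vars
    · exact pderiv_eq_zero_of_notMem_vars fun h =>
        ha (mem_union_right _ (mem_biUnion.mpr ⟨b, hb, h⟩))
    · rw [pderiv_eq_zero_of_notMem_vars hb, map_zero]
  choose u hu using exists_specialize_eq_firstOrder k
  refine ⟨∑ a ∈ A, ∑ b ∈ A, X (a + b) * ((a : ℂ) • pderiv a ((b : ℂ) • pderiv b g))
      + ∑ c ∈ A, u c * ((c : ℂ) • pderiv c g), fun t => ?_⟩
  rw [cms_eq_sum k t (A := A)]
  · simp only [map_add, map_sum, map_mul, specialize_X, hu, del_specialize]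
  · intro a ha
    rw [del_specialize, h1 a ha, smul_zero, map_zero]
  · intro a ha b
    rw [del_specialize, del_specialize, (pderiv a).map_smul, h2 a ha b, smul_zero, smul_zero,
      map_zero]

theorem euler_psi {N : ℕ} (i : Fin N) {f : LamFib} {A : Finset ℤ} (hA : ∀ a ∉ A, del a f = 0) :
    euler i (psi N f) = ∑ a ∈ A, zpow i a * psi N (del a f) := by
  classical
  have h : ∀ᶠ B : Finset ℤ in atTop,
      euler i (psi N f) = ∑ a ∈ B, zpow i a * psi N (del a f) := by
    clear hA
    induction f using MvPolynomial.induction_on with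
    | C c =>
      refine Eventually.of_forall fun B => ?_
      simp only [del_C, map_zero, mul_zero, sum_const_zero]
      rw [← MvPolynomial.algebraMap_eq, AlgHom.commutes, Derivation.map_algebraMap]
    | add f g hf hg =>
      filter_upwards [hf, hg] with B h1 h2
      simp only [map_add, h1, h2, mul_add, sum_add_distrib]
    | mul_X f b hf =>
      filter_upwards [hf, eventually_ge_atTop {(b : ℤ)}] with B h1 h2
      have hb : (b : ℤ) ∈ B := h2 (mem_singleton_self _)
      simp only [del_mul, map_mul, map_add, Derivation.leibniz, h1, smul_eq_mul, mul_add,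
        sum_add_distrib, del_X]
      congr 1
      · rw [psi_X, map_sum]
        simp only [euler_zpow]
        rw [Finset.sum_ite_eq, if_pos (mem_univ _), Finset.sum_eq_single_of_mem (b : ℤ) hb,
          if_pos rfl, ← MvPolynomial.algebraMap_eq, AlgHom.commutes, Algebra.smul_def]
        · ring
        · intro a _ hab
          rw [if_neg hab, map_zero, mul_zero, mul_zero]
      · rw [Finset.mul_sum]
        refine Finset.sum_congr rfl fun a _ => ?_
        ring
  obtain ⟨B, h1, h2⟩ := (h.and (eventually_ge_atTop A)).exists
  rw [h1]
  symm
  refine Finset.sum_subset h2 fun a _ ha => ?_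
  rw [hA a ha, map_zero, mul_zero]

/-- The Laurent polynomial `(z_i + z_j) (z_i^a - z_j^a) / (z_i - z_j)`. -/
def pairQuot {N : ℕ} (a : ℤ) (i j : Fin N) : LaurentPoly N :=
  if 0 < a then zpow i a + zpow j a + 2 * ∑ m ∈ Ioo 0 a, zpow i m * zpow j (a - m)
  else if a < 0 then -(zpow i a + zpow j a + 2 * ∑ m ∈ Ioo a 0, zpow i m * zpow j (a - m))
  else 0

theorem sum_Ioo_telescope {R : Type*} [AddCommGroup R] (g : ℤ → R) {u v : ℤ} (h : u < v) :
    ∑ m ∈ Ioo u v, (g (m + 1) - g m) = g v - g (u + 1) := by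
  obtain ⟨n, rfl⟩ : ∃ n : ℕ, v = u + 1 + n := ⟨(v - (u + 1)).toNat, by omega⟩
  clear h
  induction n with
  | zero =>
    have : Ioo u (u + 1 + ((0 : ℕ) : ℤ)) = ∅ := by ext; simp
    rw [this]; simp
  | succ n ih =>
    have : Ioo u (u + 1 + ((n + 1 : ℕ) : ℤ)) = insert (u + 1 + (n : ℤ)) (Ioo u (u + 1 + (n : ℤ))) := by
      ext; simp; omega
    rw [this, sum_insert (by simp), ih]
    push_cast
    rw [← add_assoc (u + 1)]
    abel

theorem pairQuot_spec {N : ℕ} (a : ℤ) (i j : Fin N) :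
    (zpow i 1 - zpow j 1) * pairQuot a i j = (zpow i 1 + zpow j 1) * (zpow i a - zpow j a) := by
  have key : ∀ S : Finset ℤ, (zpow i 1 - zpow j 1) * ∑ m ∈ S, zpow i m * zpow j (a - m)
      = ∑ m ∈ S, (zpow i (m + 1) * zpow j (a + 1 - (m + 1)) - zpow i m * zpow j (a + 1 - m)) := by
    intro S
    rw [Finset.mul_sum]
    refine Finset.sum_congr rfl fun m _ => ?_
    rw [sub_mul, ← mul_assoc, zpow_mul, mul_left_comm, zpow_mul]
    congr 3 <;> ring
  have hij : ∀ a b : ℤ, zpow j a * zpow j b = zpow j (a + b) := zpow_mul j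
  have hii : ∀ a b : ℤ, zpow i a * zpow i b = zpow i (a + b) := zpow_mul i
  rcases lt_trichotomy a 0 with h | h | h
  · rw [pairQuot, if_neg (by omega), if_pos h]
    have := key (Ioo a 0)
    rw [sum_Ioo_telescope (fun m => zpow i m * zpow j (a + 1 - m)) h] at this
    simp only [zpow_zero, sub_self, sub_zero, one_mul, mul_one] at this
    have e1 : zpow i (a + 1) = zpow i 1 * zpow i a := by rw [hii, add_comm]
    have e2 : zpow j (a + 1) = zpow j 1 * zpow j a := by rw [hij, add_comm]
    rw [e1, e2] at this
    linear_combination -2 * this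
  · subst h
    rw [pairQuot, if_neg (by omega), if_neg (by omega), zpow_zero, zpow_zero]
    ring
  · rw [pairQuot, if_pos h]
    have := key (Ioo 0 a)
    rw [sum_Ioo_telescope (fun m => zpow i m * zpow j (a + 1 - m)) h] at this
    simp only [zero_add, add_sub_cancel_right, add_sub_cancel_left] at this
    linear_combination 2 * this

theorem sum_pairQuot (N : ℕ) (a : ℤ) :
    ∑ i : Fin N, ∑ j : Fin N, pairQuot a i j = 2 * psi N (quadPos N a - quadNeg N a
      + (N : ℂ) • ((if 0 < a then (1 : ℂ) else 0) • pw N a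
        - (if a < 0 then (1 : ℂ) else 0) • pw N a)) := by
  have key : ∀ S : Finset ℤ, ∑ i : Fin N, ∑ j : Fin N,
      (zpow i a + zpow j a + 2 * ∑ m ∈ S, zpow i m * zpow j (a - m))
      = 2 * (∑ m ∈ S, psi N (pw N m) * psi N (pw N (a - m)) + (N : ℂ) • psi N (pw N a)) := by
    intro S
    simp only [psi_pw, Finset.sum_mul_sum]
    simp only [sum_add_distrib, sum_const, card_univ, Fintype.card_fin, ← Finset.smul_sum,
      ← Nat.cast_smul_eq_nsmul ℂ]
    simp only [← Finset.mul_sum (a := (2 : LaurentPoly N))]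
    have : ∑ i : Fin N, ∑ j : Fin N, ∑ m ∈ S, (zpow i m * zpow j (a - m))
        = ∑ m ∈ S, ∑ i : Fin N, ∑ j : Fin N, zpow i m * zpow j (a - m) := by
      rw [Finset.sum_comm]
      conv_rhs => rw [Finset.sum_comm]
      rw [Finset.sum_comm]
      refine Finset.sum_congr rfl fun i _ => ?_
      rw [Finset.sum_comm]
    rw [this, two_mul, two_mul]
    abel
  rcases lt_trichotomy a 0 with h | h | h
  · have h' : ¬ 0 < a := by omega
    have hI : Ioo 0 a = ∅ := by ext; simp; omega
    simp only [pairQuot, h, h', if_false, if_true, sum_neg_distrib, key, quadPos, quadNeg, hI,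
      sum_empty, zero_smul, one_smul, zero_sub, map_add, map_neg, map_sum, map_mul, map_smul]
    rw [smul_neg]
    ring
  · subst h
    simp [pairQuot, quadPos, quadNeg]
  · have h' : ¬ a < 0 := by omega
    have hI : Ioo a 0 = ∅ := by ext; simp; omega
    simp only [pairQuot, h, h', if_false, if_true, key, quadPos, quadNeg, hI,
      sum_empty, zero_smul, one_smul, sub_zero, map_add, map_sum, map_mul, map_smul]

theorem pairQuot_self {N : ℕ} (a : ℤ) (i : Fin N) :
    pairQuot a i i = (2 * a : ℂ) • zpow i a := by
  have key : ∀ S : Finset ℤ, ∑ m ∈ S, zpow i m * zpow i (a - m) = (#S : ℂ) • zpow i a := by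
    intro S
    simp [zpow_mul, Nat.cast_smul_eq_nsmul]
  have h2 : (2 : LaurentPoly N) = algebraMap ℂ _ 2 := (map_ofNat _ 2).symm
  rcases lt_trichotomy a 0 with h | h | h
  · rw [pairQuot, if_neg (by omega), if_pos h, key, Int.card_Ioo, h2, ← Algebra.smul_def, smul_smul,
      ← two_smul ℂ (zpow i a), ← add_smul, ← neg_smul]
    congr 1
    have : (((0 - a - 1).toNat : ℕ) : ℂ) = ((0 - a - 1 : ℤ) : ℂ) := by
      rw [← Int.cast_natCast, Int.toNat_of_nonneg (by omega)]
    rw [this]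
    push_cast
    ring
  · subst h; simp [pairQuot]
  · rw [pairQuot, if_pos h, key, Int.card_Ioo, h2, ← Algebra.smul_def, smul_smul,
      ← two_smul ℂ (zpow i a), ← add_smul]
    congr 1
    have : (((a - 0 - 1).toNat : ℕ) : ℂ) = ((a - 0 - 1 : ℤ) : ℂ) := by
      rw [← Int.cast_natCast, Int.toNat_of_nonneg (by omega)]
    rw [this]
    push_cast
    ring

theorem pairQuot_comm {N : ℕ} (a : ℤ) {i j : Fin N} (hij : i ≠ j) :
    pairQuot a i j = pairQuot a j i := by
  have hne : zpow i 1 - zpow j 1 ≠ 0 := by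
    intro h
    have h1 := congrArg (fun f : LaurentPoly N => f.coeff (Pi.single i 1)) h
    have h2 : (Pi.single j 1 : Fin N → ℤ) ≠ Pi.single i 1 := by
      intro h3
      have := congrFun h3 i
      simp [hij] at this
    simp [zpow, coeff_zMon, h2] at h1
  refine mul_left_cancel₀ hne ?_
  rw [pairQuot_spec]
  have := pairQuot_spec a j i
  linear_combination this

theorem psi_firstOrder (N : ℕ) (k : ℂ) (a : ℤ) :
    psi N (firstOrder k N a) = (a : ℂ) • ∑ i : Fin N, zpow i a
      - k • ∑ i : Fin N, ∑ j ∈ Ioi i, pairQuot a i j := by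
  have h1 := sum_sum_Ioi_add_eq_sum_sum_off_diag (fun i j : Fin N => pairQuot a j i)
  have h2 : ∑ i : Fin N, ∑ j ∈ Ioi i, (pairQuot a i j + pairQuot a j i)
      = (2 : ℂ) • ∑ i : Fin N, ∑ j ∈ Ioi i, pairQuot a i j := by
    rw [Finset.smul_sum]
    refine Finset.sum_congr rfl fun i _ => ?_
    rw [Finset.smul_sum]
    refine Finset.sum_congr rfl fun j hj => ?_
    rw [pairQuot_comm a (ne_of_gt (mem_Ioi.mp hj)), two_smul]
  have h3 : ∑ i : Fin N, ∑ j : Fin N, pairQuot a i j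
      = ∑ i : Fin N, pairQuot a i i + ∑ i : Fin N, ∑ j ∈ ({i}ᶜ : Finset (Fin N)), pairQuot a i j := by
    rw [← sum_add_distrib]
    refine Finset.sum_congr rfl fun i _ => ?_
    rw [← Finset.sum_add_sum_compl {i}, sum_singleton]
  rw [h2] at h1
  rw [← h1, sum_pairQuot] at h3
  simp only [pairQuot_self, ← Finset.smul_sum] at h3
  have two : (2 : LaurentPoly N) = algebraMap ℂ _ 2 := (map_ofNat _ 2).symm
  rw [two, ← Algebra.smul_def, mul_smul, ← smul_add] at h3
  have h4 := smul_right_injective _ (two_ne_zero (α := ℂ)) h3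
  rw [← psi_pw] at h4 ⊢
  have h5 : ∑ i : Fin N, ∑ j ∈ Ioi i, pairQuot a i j = psi N (quadPos N a - quadNeg N a
      + (N : ℂ) • ((if 0 < a then (1 : ℂ) else 0) • pw N a
        - (if a < 0 then (1 : ℂ) else 0) • pw N a)) - (a : ℂ) • psi N (pw N a) := by
    rw [h4]; abel
  rw [h5, firstOrder]
  simp only [map_add, map_sub, map_smul]
  module

/-- In `N` variables the CMS operator with `p₀ = N` is
`∑ D_i² - k ∑_{i<j} (z_i + z_j)/(z_i - z_j) (D_i - D_j)`. -/
theorem psi_cms (N : ℕ) (k : ℂ) (f : LamFib) : ∃ Q : Fin N → Fin N → LaurentPoly N,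
    (∀ i j, (zpow i 1 - zpow j 1) * Q i j
      = (zpow i 1 + zpow j 1) * (euler i (psi N f) - euler j (psi N f))) ∧
    psi N (cms k N f) = ∑ i, euler i (euler i (psi N f)) - k • ∑ i, ∑ j ∈ Ioi i, Q i j := by
  obtain ⟨A, hA, hA'⟩ := exists_finset_del f
  refine ⟨fun i j => ∑ a ∈ A, pairQuot a i j * psi N (del a f), ?_, ?_⟩
  · intro i j
    rw [euler_psi i hA, euler_psi j hA, ← sum_sub_distrib, Finset.mul_sum, Finset.mul_sum]
    refine Finset.sum_congr rfl fun a _ => ?_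
    rw [← mul_assoc, pairQuot_spec]
    ring
  · have h1 : ∀ i : Fin N, euler i (euler i (psi N f))
        = ∑ a ∈ A, ∑ b ∈ A, zpow i (a + b) * psi N (del b (del a f))
          + ∑ a ∈ A, ((a : ℂ) • zpow i a) * psi N (del a f) := by
      intro i
      rw [euler_psi i hA, map_sum, ← sum_add_distrib]
      refine Finset.sum_congr rfl fun a _ => ?_
      rw [Derivation.leibniz, euler_psi i (A := A) (f := del a f) (fun b hb => hA' b hb a),
        euler_zpow, if_pos rfl, smul_eq_mul, smul_eq_mul, Finset.mul_sum, mul_comm (psi N (del a f))]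
      congr 1
      refine Finset.sum_congr rfl fun b _ => ?_
      rw [← mul_assoc, zpow_mul]
    rw [cms_eq_sum k N hA hA']
    simp only [h1, map_add, map_sum, map_mul, psi_pw, psi_firstOrder]
    simp only [sub_mul, sum_add_distrib, sum_sub_distrib]
    rw [add_sub_assoc]
    congr 1
    · rw [Finset.sum_comm]
      conv_rhs => rw [Finset.sum_comm]
      simp only [Finset.sum_mul]
      refine Finset.sum_congr rfl fun b _ => ?_
      conv_rhs => rw [Finset.sum_comm]
      simp only [add_comm]
    · congr 1
      · conv_rhs => rw [Finset.sum_comm]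
        refine Finset.sum_congr rfl fun b _ => ?_
        rw [← Finset.sum_mul, Finset.smul_sum]
      · rw [Finset.smul_sum]
        simp only [smul_mul_assoc]
        rw [← Finset.smul_sum, ← Finset.smul_sum]
        congr 1
        simp only [Finset.sum_mul]
        rw [Finset.sum_comm]
        refine Finset.sum_congr rfl fun i _ => ?_
        rw [Finset.sum_comm]

/-! ### Triangularity and eigenvalues -/

theorem coeff_psi_cms {N : ℕ} (k : ℂ) (f : LamFib) (κ : Fin N → ℤ)
    (h : ∀ i j : Fin N, i < j → ∀ l : ℕ, 1 ≤ l →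
      (psi N f).coeff (κ + (l : ℤ) • (Pi.single i 1 - Pi.single j 1)) = 0) :
    (psi N (cms k N f)).coeff κ = (∑ i, (κ i : ℂ) ^ 2
      - k * ∑ i, ∑ j ∈ Ioi i, ((κ i : ℂ) - κ j)) * (psi N f).coeff κ := by
  obtain ⟨Q, hQ, hcms⟩ := psi_cms N k f
  have hc : ∀ i j : Fin N, i < j → (Q i j).coeff κ = ((κ i : ℂ) - κ j) * (psi N f).coeff κ := by
    intro i j hij
    rw [coeff_eq_of_quotient hij.ne (hQ i j) κ]
    · simp only [AddMonoidAlgebra.coeff_sub, Finsupp.sub_apply, coeff_euler]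
      ring
    · intro l hl
      simp only [AddMonoidAlgebra.coeff_sub, Finsupp.sub_apply, coeff_euler, h i j hij l hl]
      ring
  rw [hcms]
  simp only [AddMonoidAlgebra.coeff_sub, Finsupp.sub_apply, AddMonoidAlgebra.coeff_smul_apply,
    AddMonoidAlgebra.coeff_sum, Finsupp.finsetSum_apply, coeff_euler]
  rw [Finset.sum_congr rfl fun i _ => Finset.sum_congr rfl fun j hj => hc i j (mem_Ioi.mp hj)]
  simp only [← Finset.sum_mul, smul_eq_mul, ← mul_assoc]
  rw [← sub_mul]
  simp only [sq]

/-- `∑ ν_i²`. -/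
def sumSq (ν : YoungDiagram) : ℤ := ∑ i ∈ range (len ν), (ν.rowLen i : ℤ) ^ 2

/-- `∑ (2 i - 1) ν_i`, with the rows numbered from `1`. -/
def sumOdd (ν : YoungDiagram) : ℤ := ∑ i ∈ range (len ν), (2 * (i : ℤ) + 1) * ν.rowLen i

theorem sumSq_eq (ν : YoungDiagram) {n : ℕ} (hn : len ν ≤ n) :
    sumSq ν = ∑ i ∈ range n, (ν.rowLen i : ℤ) ^ 2 := by
  refine Finset.sum_subset (range_subset_range.mpr hn) fun i _ hi => ?_
  rw [rowLen_eq_zero (by simpa using hi)]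
  simp

theorem sumOdd_eq (ν : YoungDiagram) {n : ℕ} (hn : len ν ≤ n) :
    sumOdd ν = ∑ i ∈ range n, (2 * (i : ℤ) + 1) * ν.rowLen i := by
  refine Finset.sum_subset (range_subset_range.mpr hn) fun i _ hi => ?_
  rw [rowLen_eq_zero (by simpa using hi)]
  simp

/-- The eigenvalue of the CMS operator on `P_{λ,μ}`. -/
def energy (k t : ℂ) (x : YoungDiagram × YoungDiagram) : ℂ :=
  (sumSq x.1 + sumSq x.2 : ℤ) + k * (sumOdd x.1 + sumOdd x.2 : ℤ) - k * t * (x.1.card + x.2.card : ℕ)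

theorem sum_Ioi_sub {N : ℕ} (κ : Fin N → ℤ) :
    ∑ i, ∑ j ∈ Ioi i, (κ i - κ j) = ∑ i : Fin N, ((N : ℤ) - 1 - 2 * i) * κ i := by
  have h1 : ∑ i : Fin N, ∑ j ∈ Ioi i, κ j = ∑ i : Fin N, (i : ℤ) * κ i := by
    rw [Finset.sum_comm' (t' := univ) (s' := fun j => Iio j) (by simp)]
    refine Finset.sum_congr rfl fun i _ => ?_
    simp
  have h2 : ∑ i : Fin N, ∑ _j ∈ Ioi i, κ i = ∑ i : Fin N, ((N : ℤ) - 1 - i) * κ i := by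
    refine Finset.sum_congr rfl fun i _ => ?_
    rw [sum_const, Fin.card_Ioi, nsmul_eq_mul]
    congr 1
    omega
  simp only [sum_sub_distrib]
  rw [h1, h2, ← sum_sub_distrib]
  refine Finset.sum_congr rfl fun i _ => ?_
  ring

theorem energy_natCast (k : ℂ) {x : YoungDiagram × YoungDiagram} {N : ℕ}
    (hx : len x.1 + len x.2 ≤ N) :
    ∑ i, (chi x.1 x.2 N i : ℂ) ^ 2
      - k * ∑ i, ∑ j ∈ Ioi i, ((chi x.1 x.2 N i : ℂ) - chi x.1 x.2 N j) = energy k N x := by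
  have refl : ∀ g : ℕ → ℤ, ∑ i : Fin N, g i = ∑ i ∈ range N, g i := fun g =>
    Fin.sum_univ_eq_sum_range g N
  have h1 : ∑ i, (chi x.1 x.2 N i) ^ 2 = sumSq x.1 + sumSq x.2 := by
    have : ∀ i : Fin N, (chi x.1 x.2 N i) ^ 2
        = (x.1.rowLen i : ℤ) ^ 2 + (x.2.rowLen (N - 1 - i) : ℤ) ^ 2 := by
      intro i
      rw [chi]
      by_cases hi : (i : ℕ) < len x.1
      · rw [rowLen_eq_zero (ν := x.2) (by omega)]; simp
      · rw [rowLen_eq_zero (ν := x.1) (by omega)]; simp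
    simp only [this, sum_add_distrib]
    rw [refl (fun i => (x.1.rowLen i : ℤ) ^ 2), refl (fun i => (x.2.rowLen (N - 1 - i) : ℤ) ^ 2),
      Finset.sum_range_reflect (fun i => (x.2.rowLen i : ℤ) ^ 2), sumSq_eq x.1 (n := N) (by omega),
      sumSq_eq x.2 (n := N) (by omega)]
  have h2 : ∑ i, ∑ j ∈ Ioi i, (chi x.1 x.2 N i - chi x.1 x.2 N j)
      = (N : ℤ) * (x.1.card + x.2.card : ℕ) - (sumOdd x.1 + sumOdd x.2) := by
    rw [sum_Ioi_sub]
    have : ∀ i : Fin N, ((N : ℤ) - 1 - 2 * i) * chi x.1 x.2 N i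
        = ((N : ℤ) * (x.1.rowLen i) - (2 * (i : ℤ) + 1) * x.1.rowLen i)
          + ((N : ℤ) * (x.2.rowLen (N - 1 - i))
            - (2 * ((N - 1 - i : ℕ) : ℤ) + 1) * x.2.rowLen (N - 1 - i)) := by
      intro i
      have : ((N - 1 - i : ℕ) : ℤ) = (N : ℤ) - 1 - i := by omega
      rw [chi, this]
      ring
    simp only [this, sum_add_distrib]
    rw [refl (fun i => (N : ℤ) * (x.1.rowLen i) - (2 * (i : ℤ) + 1) * x.1.rowLen i),
      refl (fun i => (N : ℤ) * (x.2.rowLen (N - 1 - i))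
            - (2 * ((N - 1 - i : ℕ) : ℤ) + 1) * x.2.rowLen (N - 1 - i)),
      Finset.sum_range_reflect
        (fun i => (N : ℤ) * (x.2.rowLen i) - (2 * (i : ℤ) + 1) * x.2.rowLen i),
      sum_sub_distrib, sum_sub_distrib, ← Finset.mul_sum, ← Finset.mul_sum,
      ← sumOdd_eq x.1 (n := N) (by omega), ← sumOdd_eq x.2 (n := N) (by omega),
      card_eq_sum_rowLen x.1 (n := N) (by omega), card_eq_sum_rowLen x.2 (n := N) (by omega)]
    push_cast
    ring
  have h1' := congrArg (Int.cast (R := ℂ)) h1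
  have h2' := congrArg (Int.cast (R := ℂ)) h2
  push_cast at h1' h2'
  rw [h1', h2', energy]
  push_cast
  ring

theorem not_dom_add_single_sub {N : ℕ} (κ : Fin N → ℤ) {i j : Fin N} (hij : i < j) {l : ℕ}
    (hl : 1 ≤ l) : ¬ Dom (κ + (l : ℤ) • (Pi.single i 1 - Pi.single j 1)) κ := by
  intro h
  have h1 := h.2 (i + 1)
  have h2 : ∑ m : Fin N, (if (m : ℕ) < i + 1 then
      (κ + (l : ℤ) • (Pi.single i 1 - Pi.single j 1) : Fin N → ℤ) m else 0)
      = ∑ m : Fin N, (if (m : ℕ) < i + 1 then κ m else 0) + l := by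
    have : ∀ m : Fin N, (if (m : ℕ) < i + 1 then
        (κ + (l : ℤ) • (Pi.single i 1 - Pi.single j 1) : Fin N → ℤ) m else 0)
        = (if (m : ℕ) < i + 1 then κ m else 0) + if m = i then (l : ℤ) else 0 := by
      intro m
      by_cases hm : m = i
      · subst hm
        simp [Pi.single_eq_of_ne hij.ne]
      · by_cases hm' : (m : ℕ) < i + 1
        · have : m ≠ j := by
            rintro rfl
            have : (i : ℕ) < m := hij
            omega
          simp [hm, hm', Pi.single_eq_of_ne this]
        · simp [hm, hm']
    simp only [this, sum_add_distrib]
    simp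
  omega

theorem dom_of_dom_add_single_sub {N : ℕ} {κ χ : Fin N → ℤ} {i j : Fin N} (hij : i < j) {l : ℕ}
    (h : Dom (κ + (l : ℤ) • (Pi.single i 1 - Pi.single j 1)) χ) : Dom κ χ := by
  refine ⟨?_, fun n => le_trans ?_ (h.2 n)⟩
  · rw [← h.1]
    simp [sum_add_distrib, ← Finset.mul_sum]
  · have hsplit : ∀ m : Fin N, (if (m : ℕ) < n then
        (κ + (l : ℤ) • (Pi.single i 1 - Pi.single j 1) : Fin N → ℤ) m else 0)
        = (if (m : ℕ) < n then κ m else 0) + ((if m = i then (if (i : ℕ) < n then (l : ℤ) else 0) else 0)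
          - (if m = j then (if (j : ℕ) < n then (l : ℤ) else 0) else 0)) := by
      intro m
      by_cases hm : m = i
      · subst hm
        by_cases hn : (m : ℕ) < n <;> simp [hn, hij.ne]
      · by_cases hm' : m = j
        · subst hm'
          by_cases hn : (m : ℕ) < n <;> simp [hn, hij.ne']
        · simp [hm, hm']
    simp only [hsplit, sum_add_distrib, sum_sub_distrib, Finset.sum_ite_eq', mem_univ, if_true]
    have : (i : ℕ) < j := hij
    split_ifs <;> omega

/-- The pairs strictly below `x` in the dominance order. -/
def below (x : YoungDiagram × YoungDiagram) : Set (YoungDiagram × YoungDiagram) :=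
  {y | PairLE y x ∧ y ≠ x}

theorem finite_below (x : YoungDiagram × YoungDiagram) : (below x).Finite :=
  (finite_pairLE x).subset fun _ hy => hy.1

/-- The eigenvalue as a polynomial in `p₀`. -/
def energyPoly (k : ℂ) (x : YoungDiagram × YoungDiagram) : Polynomial ℂ :=
  Polynomial.C ((sumSq x.1 + sumSq x.2 : ℤ) + k * (sumOdd x.1 + sumOdd x.2 : ℤ))
    - Polynomial.C (k * (x.1.card + x.2.card : ℕ)) * Polynomial.X

theorem eval_energyPoly (k t : ℂ) (x : YoungDiagram × YoungDiagram) :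
    (energyPoly k x).eval t = energy k t x := by
  simp only [energyPoly, energy, Polynomial.eval_sub, Polynomial.eval_C, Polynomial.eval_mul,
    Polynomial.eval_X]
  ring

/-- The CMS operator is triangular on the monomial functions, for every value of `p₀`. -/
theorem cms_specialize_mon (k t : ℂ) (x : YoungDiagram × YoungDiagram) :
    cms k t (specialize t (mon x.1 x.2)) - energy k t x • specialize t (mon x.1 x.2) ∈
      Submodule.span ℂ ((fun y => specialize t (mon y.1 y.2)) '' below x) := by
  classical
  obtain ⟨G, hG⟩ := exists_specialize_eq_cms k (mon x.1 x.2)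
  have := specialize_mem_span (G - Polynomial.aeval (X 0 : Lam) (energyPoly k x) * mon x.1 x.2) (below x) ?_ t
  · rwa [map_sub, hG, map_mul, specialize_aeval_X_zero, eval_energyPoly, ← smul_eq_C_mul] at this
  intro y hy
  filter_upwards [eventually_ge_atTop (len x.1 + len x.2),
    eventually_ge_atTop (len y.1 + len y.2)] with N hx hyN
  rw [map_sub, map_mul, phi_aeval_X_zero, eval_energyPoly, ← psi_specialize, hG, ← Algebra.smul_def,
    AddMonoidAlgebra.coeff_sub, Finsupp.sub_apply, AddMonoidAlgebra.coeff_smul_apply,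
    coeff_psi_cms, psi_specialize, coeff_chi_phi_mon hyN hx]
  · split_ifs with hxy
    · subst hxy
      rw [energy_natCast k hx]
      simp
    · simp
  · intro i j hij l hl
    rw [psi_specialize, phi_mon _ _ _ hx]
    by_contra hne
    have hd := dom_of_coeff_monomialSymm_ne_zero (chi_antitone _ _ _) hne
    refine hy ⟨pairLE_of_dom_chi hyN hx (dom_of_dom_add_single_sub hij hd), ?_⟩
    rintro rfl
    exact not_dom_add_single_sub _ hij hl hd

/-- Along the dominance order of partitions of the same size the content sum is strictly
monotone; here in the form `∑ ν_i² - ∑ (2 i - 1) ν_i`, by summation by parts. -/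
theorem sumSq_sub_sumOdd_lt {ν' ν : YoungDiagram} (h : PartialSumsLE ν' ν)
    (hcard : ν'.card = ν.card) (hne : ν' ≠ ν) :
    sumSq ν' - sumOdd ν' < sumSq ν - sumOdd ν := by
  set S : ℕ → ℤ := fun n => ∑ i ∈ range n, ((ν.rowLen i : ℤ) - ν'.rowLen i) with hS
  set w : ℕ → ℤ := fun i => (ν.rowLen i : ℤ) + ν'.rowLen i - 2 * i - 1 with hw
  set M := max (len ν) (len ν') with hM
  have S_nonneg : ∀ n, 0 ≤ S n := by
    intro n
    have := h n
    simp only [hS, sum_sub_distrib]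
    have : ∑ i ∈ range n, (ν'.rowLen i : ℤ) ≤ ∑ i ∈ range n, (ν.rowLen i : ℤ) := by exact_mod_cast this
    omega
  have S_M : ∀ n, M ≤ n → S n = 0 := by
    intro n hn
    simp only [hS, sum_sub_distrib]
    have h1 := card_eq_sum_rowLen ν (n := n) (by omega)
    have h2 := card_eq_sum_rowLen ν' (n := n) (by omega)
    have h3 : ∑ i ∈ range n, (ν'.rowLen i : ℤ) = ∑ i ∈ range n, (ν.rowLen i : ℤ) := by
      exact_mod_cast (h2.symm.trans hcard).trans h1
    omega
  have w_step : ∀ i, 2 ≤ w i - w (i + 1) := by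
    intro i
    have h1 := ν.rowLen_anti i (i + 1) (by omega)
    have h2 := ν'.rowLen_anti i (i + 1) (by omega)
    simp only [hw]
    push_cast
    omega
  have parts : ∀ n, ∑ i ∈ range n, ((ν.rowLen i : ℤ) - ν'.rowLen i) * w i
      = S n * w n + ∑ i ∈ range n, S (i + 1) * (w i - w (i + 1)) := by
    intro n
    induction n with
    | zero => simp [hS]
    | succ n ih =>
      have : S (n + 1) = S n + ((ν.rowLen n : ℤ) - ν'.rowLen n) := sum_range_succ _ _
      rw [sum_range_succ, ih, sum_range_succ, this]
      ring
  have hdiff : (sumSq ν - sumOdd ν) - (sumSq ν' - sumOdd ν')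
      = ∑ i ∈ range M, S (i + 1) * (w i - w (i + 1)) := by
    have := parts M
    rw [S_M M le_rfl, zero_mul, zero_add] at this
    rw [← this, sumSq_eq ν (n := M) (by omega), sumSq_eq ν' (n := M) (by omega),
      sumOdd_eq ν (n := M) (by omega), sumOdd_eq ν' (n := M) (by omega), ← sum_sub_distrib,
      ← sum_sub_distrib, ← sum_sub_distrib]
    refine Finset.sum_congr rfl fun i _ => ?_
    simp only [hw]
    ring
  obtain ⟨n, hn⟩ : ∃ n, 0 < S (n + 1) := by
    by_contra hall
    push Not at hall
    have S0 : ∀ n, S n = 0 := by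
      intro n
      cases n with
      | zero => simp [hS]
      | succ n => exact le_antisymm (hall n) (S_nonneg _)
    refine hne (rowLen_injective fun i => ?_)
    have : S (i + 1) = S i + ((ν.rowLen i : ℤ) - ν'.rowLen i) := sum_range_succ _ _
    rw [S0, S0] at this
    omega
  have hnM : n < M := by
    by_contra hge
    rw [S_M (n + 1) (by omega)] at hn
    omega
  have : 0 < ∑ i ∈ range M, S (i + 1) * (w i - w (i + 1)) := by
    refine Finset.sum_pos' (fun i _ => mul_nonneg (S_nonneg _) ?_) ⟨n, mem_range.mpr hnM, ?_⟩
    · have := w_step i; omega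
    · have := w_step n
      exact mul_pos hn (by omega)
  omega

theorem finite_energy_eq {x y : YoungDiagram × YoungDiagram} (h : y ∈ below x) :
    {t : ℂ | energy (-1) t y = energy (-1) t x}.Finite := by
  obtain ⟨⟨hw, h1, h2⟩, hne⟩ := h
  by_cases hsize : y.1.card + y.2.card = x.1.card + x.2.card
  · have c1 : y.1.card = x.1.card := by omega
    have c2 : y.2.card = x.2.card := by omega
    have le : ∀ {ν' ν : YoungDiagram}, PartialSumsLE ν' ν → ν'.card = ν.card →
        sumSq ν' - sumOdd ν' ≤ sumSq ν - sumOdd ν := by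
      intro ν' ν h hc
      by_cases hν : ν' = ν
      · rw [hν]
      · exact (sumSq_sub_sumOdd_lt h hc hν).le
    have lt : (sumSq y.1 + sumSq y.2) - (sumOdd y.1 + sumOdd y.2)
        < (sumSq x.1 + sumSq x.2) - (sumOdd x.1 + sumOdd x.2) := by
      have l1 := le h1 c1
      have l2 := le h2 c2
      by_cases hν : y.1 = x.1
      · have hμ : y.2 ≠ x.2 := fun h => hne (Prod.ext hν h)
        have := sumSq_sub_sumOdd_lt h2 c2 hμ
        omega
      · have := sumSq_sub_sumOdd_lt h1 c1 hν
        omega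
    convert Set.finite_empty
    ext t
    simp only [Set.mem_ofPred_eq, Set.mem_empty_iff_false, iff_false]
    intro heq
    simp only [energy, hsize] at heq
    have : (((sumSq y.1 + sumSq y.2) - (sumOdd y.1 + sumOdd y.2) : ℤ) : ℂ)
        = (((sumSq x.1 + sumSq x.2) - (sumOdd x.1 + sumOdd x.2) : ℤ) : ℂ) := by
      push_cast at heq ⊢
      linear_combination heq
    exact lt.ne (by exact_mod_cast this)
  · refine Set.Subsingleton.finite fun t ht s hs => ?_
    simp only [Set.mem_ofPred_eq, energy] at ht hs
    have hd : ((x.1.card + x.2.card : ℕ) : ℂ) - ((y.1.card + y.2.card : ℕ) : ℂ) ≠ 0 := by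
      rw [sub_ne_zero]
      exact_mod_cast Ne.symm hsize
    refine mul_right_cancel₀ hd ?_
    linear_combination hs - ht

/-! ### The Jacobi-Trudy determinant in finitely many variables -/

/-- The automorphism `z_i ↦ z_i⁻¹`. -/
def invVars (N : ℕ) : LaurentPoly N →ₐ[ℂ] LaurentPoly N :=
  AddMonoidAlgebra.mapDomainAlgHom ℂ ℂ (negAddMonoidHom : (Fin N → ℤ) →+ (Fin N → ℤ))

theorem invVars_zpow {N : ℕ} (i : Fin N) (a : ℤ) : invVars N (zpow i a) = zpow i (-a) := by
  rw [invVars, AddMonoidAlgebra.mapDomainAlgHom_apply, zpow, zMon,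
    AddMonoidAlgebra.mapDomain_single, zpow, zMon, Pi.single_neg]
  rfl

theorem psi_invol (N : ℕ) (f : LamFib) : psi N (invol f) = invVars N (psi N f) := by
  have : (psi N).comp invol = (invVars N).comp (psi N) := by
    refine MvPolynomial.algHom_ext fun a => ?_
    simp only [AlgHom.comp_apply, invol, rename_X, psi_X, map_sum, invVars_zpow]
  exact DFunLike.congr_fun this f

/-- The factor `∏_{l ≠ k} (1 - z_l T)` of the denominator of the generating function of the
complete symmetric polynomials. -/
def cofactorPoly {N : ℕ} (k : Fin N) : Polynomial (LaurentPoly N) :=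
  ∏ l ∈ univ.erase k, (1 - Polynomial.C (zpow l 1) * Polynomial.X)

theorem psi_complete (N n : ℕ) :
    psi N (complete n) = PowerSeries.coeff n (∏ i : Fin N, PowerSeries.mk fun m => zpow i (m : ℤ)) := by
  rw [psi, AlgHom.comp_apply, phi_complete, PowerSeries.coeff_prod]
  refine Finset.sum_bij' (fun v _ => Finsupp.equivFunOnFinite.symm v) (fun l _ => ⇑l) ?_ ?_ ?_ ?_ ?_
  · intro v hv
    simpa using hv
  · intro l hl
    simpa using hl
  · intro v _; rfl
  · intro l _; ext; rfl
  · intro v _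
    simp [zMon_eq_prod]

theorem one_sub_mul_geometric {N : ℕ} (i : Fin N) :
    (1 - PowerSeries.C (zpow i 1) * PowerSeries.X) * (PowerSeries.mk fun m => zpow i (m : ℤ)) = 1 := by
  ext1 n
  rw [sub_mul, one_mul, map_sub, mul_assoc, PowerSeries.coeff_C_mul]
  cases n with
  | zero => simp [zpow_zero]
  | succ n =>
    rw [PowerSeries.coeff_succ_X_mul, PowerSeries.coeff_mk, PowerSeries.coeff_mk, zpow_mul,
      PowerSeries.coeff_one, if_neg (Nat.succ_ne_zero n)]
    push_cast
    rw [add_comm, sub_self]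

theorem cofactorPoly_mul {N : ℕ} (k : Fin N) :
    (cofactorPoly k : PowerSeries (LaurentPoly N)) *
      (∏ i : Fin N, PowerSeries.mk fun m => zpow i (m : ℤ)) = PowerSeries.mk fun m => zpow k (m : ℤ) := by
  rw [cofactorPoly, ← Finset.prod_erase_mul univ _ (mem_univ k), ← mul_assoc,
    ← Polynomial.coeToPowerSeries.ringHom_apply, map_prod, ← Finset.prod_mul_distrib]
  rw [Finset.prod_eq_one, one_mul]
  intro i _
  rw [Polynomial.coeToPowerSeries.ringHom_apply]
  simp only [Polynomial.coe_sub, Polynomial.coe_one, Polynomial.coe_mul, Polynomial.coe_C,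
    Polynomial.coe_X]
  exact one_sub_mul_geometric i

theorem natDegree_prod_one_sub_le {ι R : Type*} [CommRing R] (s : Finset ι) (z : ι → R) :
    (∏ l ∈ s, (1 - Polynomial.C (z l) * Polynomial.X)).natDegree ≤ #s := by
  refine (Polynomial.natDegree_prod_le _ _).trans ?_
  rw [Finset.card_eq_sum_ones]
  refine Finset.sum_le_sum fun i _ => ?_
  compute_degree

theorem coeff_one_sub_mul_succ {R : Type*} [CommRing R] (z : R) (P : Polynomial R) (n : ℕ) :
    ((1 - Polynomial.C z * Polynomial.X) * P).coeff (n + 1) = P.coeff (n + 1) - z * P.coeff n := by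
  rw [sub_mul, one_mul, Polynomial.coeff_sub, mul_assoc, Polynomial.coeff_C_mul,
    Polynomial.coeff_X_mul]

theorem coeff_one_sub_mul_zero {R : Type*} [CommRing R] (z : R) (P : Polynomial R) :
    ((1 - Polynomial.C z * Polynomial.X) * P).coeff 0 = P.coeff 0 := by
  rw [sub_mul, one_mul, Polynomial.coeff_sub, mul_assoc, Polynomial.coeff_C_mul,
    Polynomial.coeff_X_mul_zero, mul_zero, sub_zero]

/-- The coefficients of `∏ (1 - z_l T)` in reverse order are those of `∏ (1 - z_l⁻¹ T)`, up to a
common factor. -/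
theorem coeff_prod_one_sub_reverse {ι R : Type*} [CommRing R] (s : Finset ι) (z w : ι → R)
    (hzw : ∀ l, z l * w l = 1) (a b : ℕ) (hab : a + b = #s) :
    (∏ l ∈ s, (1 - Polynomial.C (z l) * Polynomial.X)).coeff a
      = (-1) ^ #s * (∏ l ∈ s, z l) * (∏ l ∈ s, (1 - Polynomial.C (w l) * Polynomial.X)).coeff b := by
  classical
  induction s using Finset.induction_on generalizing a b with
  | empty =>
    rw [card_empty] at hab
    obtain ⟨rfl, rfl⟩ : a = 0 ∧ b = 0 := by omega
    simp
  | insert i s hi ih =>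
    rw [card_insert_of_notMem hi] at hab ⊢
    rw [prod_insert hi, prod_insert hi, prod_insert hi]
    have hz : ∀ z : ι → R, (∏ l ∈ s, (1 - Polynomial.C (z l) * Polynomial.X)).coeff (#s + 1) = 0 :=
      fun z => Polynomial.coeff_eq_zero_of_natDegree_lt
        (Nat.lt_succ_of_le (natDegree_prod_one_sub_le s z))
    have hi1 := hzw i
    rcases a with _ | a
    · obtain rfl : b = #s + 1 := by omega
      rw [coeff_one_sub_mul_zero, coeff_one_sub_mul_succ, hz, ih 0 #s (by omega), pow_succ]
      linear_combination (-(-1) ^ #s * (∏ l ∈ s, z l) *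
        (∏ l ∈ s, (1 - Polynomial.C (w l) * Polynomial.X)).coeff #s) * hi1
    · rcases b with _ | b
      · obtain rfl : a = #s := by omega
        rw [coeff_one_sub_mul_zero, coeff_one_sub_mul_succ, hz, ih #s 0 (by omega), pow_succ]
        ring
      · rw [coeff_one_sub_mul_succ, coeff_one_sub_mul_succ, ih (a + 1) b (by omega),
          ih a (b + 1) (by omega), pow_succ]
        linear_combination (-(-1) ^ #s * (∏ l ∈ s, z l) *
          (∏ l ∈ s, (1 - Polynomial.C (w l) * Polynomial.X)).coeff b) * hi1

theorem hInt_natCast (n : ℕ) : hInt (n : ℤ) = complete n := by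
  rw [hInt, if_neg (by omega), Int.toNat_natCast]

theorem hInt_neg {n : ℤ} (h : n < 0) : hInt n = 0 := if_pos h

theorem sum_hInt_mul_coeff {N : ℕ} (k : Fin N) (m : ℕ) :
    ∑ j ∈ range N, psi N (hInt ((m : ℤ) - j)) * (cofactorPoly k).coeff j = zpow k (m : ℤ) := by
  have h := congrArg (PowerSeries.coeff m) (cofactorPoly_mul k)
  rw [PowerSeries.coeff_mul, PowerSeries.coeff_mk] at h
  simp only [← psi_complete, Polynomial.coeff_coe] at h
  rw [Finset.Nat.sum_antidiagonal_eq_sum_range_succ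
    (fun a b => (cofactorPoly k).coeff a * psi N (complete b))] at h
  have e1 : ∑ j ∈ range N, psi N (hInt ((m : ℤ) - j)) * (cofactorPoly k).coeff j
      = ∑ j ∈ range (max N (m + 1)), psi N (hInt ((m : ℤ) - j)) * (cofactorPoly k).coeff j := by
    refine Finset.sum_subset (range_subset_range.mpr (le_max_left _ _)) fun j _ hj => ?_
    have hdeg : (cofactorPoly k).natDegree ≤ N - 1 := by
      refine (natDegree_prod_one_sub_le _ _).trans ?_
      rw [card_erase_of_mem (mem_univ k), card_univ, Fintype.card_fin]
    have hk := k.2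
    rw [Polynomial.coeff_eq_zero_of_natDegree_lt, mul_zero]
    simp only [mem_range, not_lt] at hj
    omega
  have e2 : ∑ j ∈ range (m + 1), psi N (hInt ((m : ℤ) - j)) * (cofactorPoly k).coeff j
      = ∑ j ∈ range (max N (m + 1)), psi N (hInt ((m : ℤ) - j)) * (cofactorPoly k).coeff j := by
    refine Finset.sum_subset (range_subset_range.mpr (le_max_right _ _)) fun j _ hj => ?_
    simp only [mem_range, not_lt] at hj
    rw [hInt_neg (by omega), map_zero, zero_mul]
  rw [e1, ← e2, ← h]
  refine Finset.sum_congr rfl fun j hj => ?_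
  have : (m : ℤ) - j = ((m - j : ℕ) : ℤ) := by
    simp only [mem_range] at hj
    omega
  rw [this, hInt_natCast, mul_comm]

/-- The matrix of the elementary symmetric polynomials in all variables but one, with signs. -/
def cofactorMatrix (N : ℕ) : Matrix (Fin N) (Fin N) (LaurentPoly N) :=
  Matrix.of fun j k => (cofactorPoly k).coeff (N - 1 - j)

theorem sum_hInt_mul_cofactor {N : ℕ} (k : Fin N) (u : ℤ) (hu : 0 ≤ u + N - 1) :
    ∑ j : Fin N, psi N (hInt (u + j)) * cofactorMatrix N j k = zpow k (u + N - 1) := by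
  obtain ⟨m, hm⟩ := Int.eq_ofNat_of_zero_le hu
  have h := sum_hInt_mul_coeff k m
  rw [← Finset.sum_range_reflect, ← Fin.sum_univ_eq_sum_range
    (fun j => psi N (hInt ((m : ℤ) - (N - 1 - j : ℕ))) * (cofactorPoly k).coeff (N - 1 - j))] at h
  rw [hm, ← h]
  refine Finset.sum_congr rfl fun j _ => ?_
  have hj := j.2
  have : u + j = (m : ℤ) - (N - 1 - j : ℕ) := by omega
  rw [this]
  rfl

theorem sum_hIntStar_mul_cofactor {N : ℕ} (k : Fin N) (m : ℕ) :
    ∑ j : Fin N, psi N (hIntStar ((m : ℤ) - j)) * cofactorMatrix N j k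
      = (-1) ^ (N - 1) * (∏ l, zpow l 1) * zpow k (-(m : ℤ) - 1) := by
  have h := congrArg (invVars N) (sum_hInt_mul_coeff k m)
  rw [map_sum, invVars_zpow] at h
  have hz : (∏ l : Fin N, zpow l 1) * zpow k (-1) = ∏ l ∈ univ.erase k, zpow l 1 := by
    rw [← Finset.prod_erase_mul univ _ (mem_univ k), mul_assoc, zpow_mul, add_neg_cancel, zpow_zero,
      mul_one]
  have hz' : zpow k (-(m : ℤ) - 1) = zpow k (-1) * zpow k (-(m : ℤ)) := by
    rw [zpow_mul]; congr 1; ring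
  rw [hz', mul_assoc, ← mul_assoc _ (zpow k (-1)), hz, ← h, Finset.mul_sum, Finset.mul_sum,
    ← Fin.sum_univ_eq_sum_range (fun j => (-1) ^ (N - 1) * ((∏ l ∈ univ.erase k, zpow l 1)
      * invVars N (psi N (hInt ((m : ℤ) - j)) * (cofactorPoly k).coeff j)))]
  refine Finset.sum_congr rfl fun j _ => ?_
  have hcard : #(univ.erase k) = N - 1 := by
    rw [card_erase_of_mem (mem_univ k), card_univ, Fintype.card_fin]
  have hconj : invVars N ((cofactorPoly k).coeff j)
      = (∏ l ∈ univ.erase k, (1 - Polynomial.C (zpow l (-1)) * Polynomial.X)).coeff j := by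
    have : invVars N ((cofactorPoly k).coeff j)
        = ((cofactorPoly k).map (invVars N : LaurentPoly N →+* LaurentPoly N)).coeff j := by
      rw [Polynomial.coeff_map]; rfl
    rw [this, cofactorPoly, Polynomial.map_prod]
    simp [invVars_zpow]
  rw [cofactorMatrix, Matrix.of_apply, map_mul, hconj, hIntStar, psi_invol, cofactorPoly,
    coeff_prod_one_sub_reverse (univ.erase k) (fun l => zpow l 1) (fun l => zpow l (-1))
      (fun l => by rw [zpow_mul]; exact zpow_zero l) (N - 1 - j) j (by
        rw [hcard]
        have := j.2
        omega), hcard]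
  ring

/-- The Jacobi-Trudy matrix of a pair of partitions, with `λ` padded by zeros so that the matrix has
size `N`. -/
def paddedMatrix (lam mu : YoungDiagram) (N : ℕ) : Matrix (Fin N) (Fin N) LamFib :=
  Matrix.of fun i j => if (i : ℕ) < len mu then hIntStar ((mu.rowLen (len mu - 1 - i) : ℤ) + i - j)
    else hInt ((lam.rowLen (i - len mu) : ℤ) - i + j)

theorem det_paddedMatrix (lam mu : YoungDiagram) (N : ℕ) (hN : len mu + len lam ≤ N) :
    (paddedMatrix lam mu N).det = jacobiTrudy lam mu := by
  induction N, hN using Nat.le_induction with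
  | base =>
    rw [jacobiTrudy]
    congr 1
    ext1 i j
    refine Fin.addCases (fun i => ?_) (fun i => ?_) i
    · simp [paddedMatrix, jtMatrix]
    · simp only [paddedMatrix, jtMatrix, Matrix.of_apply, Fin.val_natAdd, Fin.append_right]
      rw [if_neg (by omega)]
      congr 1
      rw [Nat.add_sub_cancel_left]
      push_cast
      ring
  | succ N hN ih =>
    -- The last row of the padded matrix is `(0, …, 0, 1)`.
    rw [Matrix.det_succ_row _ (Fin.last N), Finset.sum_eq_single (Fin.last N)]
    · have h1 : paddedMatrix lam mu (N + 1) (Fin.last N) (Fin.last N) = 1 := by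
        rw [paddedMatrix, Matrix.of_apply, Fin.val_last, if_neg (by omega),
          rowLen_eq_zero (by omega)]
        simp [hInt, complete]
      rw [h1, ← ih, Fin.succAbove_last]
      have h2 : (paddedMatrix lam mu (N + 1)).submatrix Fin.castSucc Fin.castSucc
          = paddedMatrix lam mu N := rfl
      rw [h2, Fin.val_last, ← two_mul, pow_mul]
      simp
    · intro j _ hj
      have hlt : (j : ℕ) < N := by
        have := j.2
        have : (j : ℕ) ≠ N := fun h => hj (Fin.ext h)
        omega
      have h1 : paddedMatrix lam mu (N + 1) (Fin.last N) j = 0 := by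
        rw [paddedMatrix, Matrix.of_apply, Fin.val_last, if_neg (by omega),
          rowLen_eq_zero (by omega)]
        exact hInt_neg (by push_cast; omega)
      rw [h1, mul_zero, zero_mul]
    · simp

/-- The decreasing sequence `δ = (N - 1, N - 2, …, 0)`. -/
def staircase (N : ℕ) : Fin N → ℤ := fun i => (N : ℤ) - 1 - i

/-- The alternant `det (z_k^{ν_i})`. -/
def alternant {N : ℕ} (ν : Fin N → ℤ) : LaurentPoly N :=
  (Matrix.of fun i k : Fin N => zpow k (ν i)).det

theorem val_finRotate_pow {N : ℕ} (s : ℕ) (i : Fin N) : (((finRotate N) ^ s) i : ℕ) = (i + s) % N := by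
  induction s with
  | zero => simp [Nat.mod_eq_of_lt i.2]
  | succ s ih =>
    cases N with
    | zero => exact i.elim0
    | succ n =>
      rw [pow_succ', Equiv.Perm.mul_apply, finRotate_apply, Fin.val_add, ih, Fin.val_one',
        ← Nat.add_mod, add_assoc]

theorem paddedMatrix_mul_cofactor_submatrix (lam mu : YoungDiagram) {N : ℕ}
    (hN : len lam + len mu ≤ N) :
    (((paddedMatrix lam mu N).map (psi N)) * cofactorMatrix N).submatrix
        ((finRotate N) ^ (len mu) : Equiv.Perm (Fin N)) id
      = Matrix.of fun (i k : Fin N) => (if (i : ℕ) < N - len mu then 1 else (-1) ^ (N - 1) * ∏ l, zpow l 1)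
        * (Matrix.of (fun i k => zpow k (-(len mu : ℤ)) *
          Matrix.of (fun i k => zpow k ((chi lam mu N + staircase N) i)) i k) i k) := by
  ext1 i k
  have hi := i.2
  have hv := val_finRotate_pow (len mu) i
  rw [Matrix.submatrix_apply, Matrix.mul_apply, Matrix.of_apply, Matrix.of_apply, Matrix.of_apply,
    zpow_mul]
  simp only [Matrix.map_apply, paddedMatrix, Matrix.of_apply, hv, id]
  by_cases h : (i : ℕ) < N - len mu
  · rw [Nat.mod_eq_of_lt (by omega), if_pos h, one_mul]
    simp only [if_neg (show ¬ (i + len mu < len mu) by omega)]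
    rw [sum_hInt_mul_cofactor]
    · congr 1
      rw [Pi.add_apply, chi_of_lt h, staircase, Nat.add_sub_cancel]
      push_cast
      ring
    · rw [Nat.add_sub_cancel]
      push_cast
      omega
  · have hm : (i + len mu) % N = i + len mu - N := by
      rw [Nat.mod_eq_sub_mod (by omega), Nat.mod_eq_of_lt (by omega)]
    rw [hm, if_neg h]
    simp only [if_pos (show i + len mu - N < len mu by omega)]
    have := sum_hIntStar_mul_cofactor k
      (mu.rowLen (len mu - 1 - (i + len mu - N)) + (i + len mu - N))
    push_cast at this
    rw [this]
    congr 2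
    rw [Pi.add_apply, chi_of_ge (by omega), staircase]
    have e1 : len mu - 1 - (i + len mu - N) = N - 1 - i := by omega
    have e2 : ((i + len mu - N : ℕ) : ℤ) = (i : ℤ) + len mu - N := by omega
    rw [e1, e2]
    ring

theorem psi_jacobiTrudy_mul_det (lam mu : YoungDiagram) {N : ℕ} (hN : len lam + len mu ≤ N) :
    psi N (jacobiTrudy lam mu) * (cofactorMatrix N).det
      = alternant (chi lam mu N + staircase N) := by
  have h := congrArg Matrix.det (paddedMatrix_mul_cofactor_submatrix lam mu hN)
  rw [Matrix.det_permute, Matrix.det_mul_column, Matrix.det_mul_row, Matrix.det_mul] at h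
  have hdet : ((paddedMatrix lam mu N).map (psi N)).det = psi N (jacobiTrudy lam mu) := by
    rw [← det_paddedMatrix lam mu N (by omega), AlgHom.map_det]
    rfl
  rw [hdet] at h
  have hsign : (((Equiv.Perm.sign ((finRotate N) ^ (len mu)) : ℤˣ) : ℤ) : LaurentPoly N)
      = ((-1) ^ (N - 1)) ^ (len mu) := by
    rw [map_pow, sign_finRotate]
    push_cast
    rfl
  have hprod : (∏ i : Fin N, if (i : ℕ) < N - len mu then (1 : LaurentPoly N)
      else (-1) ^ (N - 1) * ∏ l, zpow l 1) = ((-1) ^ (N - 1) * ∏ l, zpow l 1) ^ (len mu) := by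
    rw [Fin.prod_univ_eq_prod_range (fun i => if i < N - len mu then (1 : LaurentPoly N)
      else (-1) ^ (N - 1) * ∏ l, zpow l 1) N, Finset.prod_ite, prod_const_one, one_mul, prod_const]
    congr 1
    have : (range N).filter (fun i => ¬ i < N - len mu) = Ico (N - len mu) N := by
      ext i; simp; omega
    rw [this, Nat.card_Ico]
    omega
  have hcancel : (∏ l : Fin N, zpow l 1) ^ (len mu) * ∏ k : Fin N, zpow k (-(len mu : ℤ)) = 1 := by
    rw [← Finset.prod_pow, ← Finset.prod_mul_distrib]
    refine Finset.prod_eq_one fun k _ => ?_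
    rw [← zpow_natCast, zpow_mul, add_neg_cancel, zpow_zero]
  rw [hsign, hprod, mul_pow] at h
  have hone : ((-1 : LaurentPoly N) ^ (N - 1)) ^ (len mu) * ((-1) ^ (N - 1)) ^ (len mu) = 1 := by
    rw [← mul_pow, ← mul_pow]; simp
  change _ = _ * (_ * alternant (chi lam mu N + staircase N)) at h
  calc _ = (((-1 : LaurentPoly N) ^ (N - 1)) ^ (len mu) * ((-1) ^ (N - 1)) ^ (len mu)) *
        (psi N (jacobiTrudy lam mu) * (cofactorMatrix N).det) := by rw [hone, one_mul]
    _ = (((-1 : LaurentPoly N) ^ (N - 1)) ^ (len mu) * ((-1) ^ (N - 1)) ^ (len mu)) *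
        (((∏ l : Fin N, zpow l 1) ^ (len mu) * ∏ k : Fin N, zpow k (-(len mu : ℤ))) *
          alternant (chi lam mu N + staircase N)) := by
      rw [mul_assoc, h]; ring
    _ = _ := by rw [hone, hcancel, one_mul, one_mul]

theorem len_bot : len ⊥ = 0 := by
  rw [len, YoungDiagram.colLen_eq_card]
  simp [YoungDiagram.col]

theorem rowLen_bot (i : ℕ) : (⊥ : YoungDiagram).rowLen i = 0 :=
  rowLen_eq_zero (by rw [len_bot]; exact Nat.zero_le i)

theorem jacobiTrudy_bot : jacobiTrudy ⊥ ⊥ = 1 := by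
  have : IsEmpty (Fin (len ⊥ + len ⊥)) := by
    rw [len_bot]
    exact Fin.isEmpty'
  exact Matrix.det_isEmpty

/-- The bialternant formula: in `N` variables the Jacobi-Trudy determinant is the rational Schur
function, a quotient of alternants. -/
theorem psi_jacobiTrudy_mul_alternant (lam mu : YoungDiagram) {N : ℕ}
    (hN : len lam + len mu ≤ N) :
    psi N (jacobiTrudy lam mu) * alternant (staircase N)
      = alternant (chi lam mu N + staircase N) := by
  have h0 := psi_jacobiTrudy_mul_det ⊥ ⊥ (N := N) (by simp [len_bot])
  have hchi : chi ⊥ ⊥ N = 0 := by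
    ext i
    simp [chi, rowLen_bot]
  rw [jacobiTrudy_bot, map_one, one_mul, hchi, zero_add] at h0
  rw [← psi_jacobiTrudy_mul_det lam mu hN, h0]

/-! ### The rational Schur function: leading term and eigenvalue -/

theorem alternant_eq_sum {N : ℕ} (ν : Fin N → ℤ) :
    alternant ν = ∑ σ : Equiv.Perm (Fin N), (Equiv.Perm.sign σ : ℤ) • zMon (ν ∘ σ) := by
  rw [alternant, Matrix.det_apply]
  refine Finset.sum_congr rfl fun σ _ => ?_
  rw [zMon_eq_prod, Units.smul_def]
  rfl

theorem coeff_alternant_mul {N : ℕ} (ν a : Fin N → ℤ) (f : LaurentPoly N) :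
    (alternant ν * f).coeff a
      = ∑ σ : Equiv.Perm (Fin N), (Equiv.Perm.sign σ : ℤ) • f.coeff (a - ν ∘ σ) := by
  rw [alternant_eq_sum, Finset.sum_mul, AddMonoidAlgebra.coeff_sum, Finsupp.finsetSum_apply]
  refine Finset.sum_congr rfl fun σ _ => ?_
  rw [smul_mul_assoc, AddMonoidAlgebra.coeff_smul, Finsupp.smul_apply, coeff_zMon_mul]

theorem coeff_alternant {N : ℕ} (ν a : Fin N → ℤ) :
    (alternant ν).coeff a
      = ∑ σ : Equiv.Perm (Fin N), (Equiv.Perm.sign σ : ℤ) • (if ν ∘ σ = a then (1 : ℂ) else 0) := by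
  rw [alternant_eq_sum, AddMonoidAlgebra.coeff_sum, Finsupp.finsetSum_apply]
  refine Finset.sum_congr rfl fun σ _ => ?_
  rw [AddMonoidAlgebra.coeff_smul, Finsupp.smul_apply, coeff_zMon]

theorem staircase_strictAnti (N : ℕ) : StrictAnti (staircase N) := by
  intro i j hij
  have : (i : ℕ) < j := hij
  simp only [staircase]
  omega

theorem sum_ite_lt_add {N : ℕ} (u v : Fin N → ℤ) (n : ℕ) :
    ∑ i : Fin N, (if (i : ℕ) < n then (u + v) i else 0)
      = ∑ i : Fin N, (if (i : ℕ) < n then u i else 0)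
        + ∑ i : Fin N, if (i : ℕ) < n then v i else 0 := by
  rw [← sum_add_distrib]
  refine Finset.sum_congr rfl fun i _ => ?_
  split_ifs <;> simp

theorem Dom.add {N : ℕ} {a b a' b' : Fin N → ℤ} (h : Dom a b) (h' : Dom a' b') :
    Dom (a + a') (b + b') := by
  refine ⟨?_, fun n => ?_⟩
  · simp only [Pi.add_apply, sum_add_distrib, h.1, h'.1]
  · rw [sum_ite_lt_add, sum_ite_lt_add]
    exact add_le_add (h.2 n) (h'.2 n)

theorem Dom.of_add_right {N : ℕ} {a b c : Fin N → ℤ} (h : Dom (a + c) (b + c)) : Dom a b := by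
  refine ⟨?_, fun n => ?_⟩
  · have := h.1
    simp only [Pi.add_apply, sum_add_distrib] at this
    omega
  · have := h.2 n
    rw [sum_ite_lt_add, sum_ite_lt_add] at this
    omega

/-- Under a permutation of the strictly decreasing sequence `δ` the pairing with `δ` decreases. -/
theorem sum_staircase_mul_lt {N : ℕ} {σ : Equiv.Perm (Fin N)} (hσ : σ ≠ 1) :
    ∑ i, staircase N i * staircase N (σ i) < ∑ i, staircase N i * staircase N i := by
  obtain ⟨i, hi⟩ : ∃ i, σ i ≠ i := by
    by_contra h
    push Not at h
    exact hσ (Equiv.ext h)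
  have h1 : 0 < ∑ i, (staircase N i - staircase N (σ i)) ^ 2 := by
    refine Finset.sum_pos' (fun i _ => sq_nonneg _) ⟨i, mem_univ i, ?_⟩
    have : staircase N i - staircase N (σ i) ≠ 0 :=
      sub_ne_zero.mpr fun h => hi ((staircase_strictAnti N).injective h).symm
    positivity
  have h2 : ∑ i, (staircase N i - staircase N (σ i)) ^ 2
      = ∑ i, staircase N i * staircase N i + ∑ i, staircase N (σ i) * staircase N (σ i)
        - 2 * ∑ i, staircase N i * staircase N (σ i) := by
    rw [Finset.mul_sum, ← sum_add_distrib, ← sum_sub_distrib]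
    refine Finset.sum_congr rfl fun i _ => ?_
    ring
  rw [Equiv.sum_comp σ (fun i => staircase N i * staircase N i)] at h2
  omega

/-- A quotient of alternants `a_{χ+δ} / a_δ` contains only exponents dominated by `χ`. If there
were another one, then one with the largest pairing with `δ` would survive in the product with
`a_δ`. -/
theorem dom_of_coeff_ne_zero {N : ℕ} {χ : Fin N → ℤ} (hχ : Antitone χ) {f : LaurentPoly N}
    (hf : alternant (staircase N) * f = alternant (χ + staircase N)) {a : Fin N → ℤ}
    (ha : f.coeff a ≠ 0) : Dom a χ := by
  classical
  set B := f.coeff.support.filter (fun a => ¬ Dom a χ) with hB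
  by_contra hd
  have hBne : B.Nonempty := ⟨a, by simp [hB, ha, hd]⟩
  obtain ⟨b, hb, hmax⟩ := B.exists_max_image (fun a => ∑ i, staircase N i * a i) hBne
  simp only [hB, mem_filter, Finsupp.mem_support_iff, ne_eq] at hb hmax
  have hcoeff := coeff_alternant_mul (staircase N) (b + staircase N) f
  rw [Finset.sum_eq_single (1 : Equiv.Perm (Fin N))] at hcoeff
  · simp only [Equiv.Perm.sign_one, Units.val_one, one_smul, Equiv.Perm.coe_one,
      Function.comp_id, add_sub_cancel_right] at hcoeff
    rw [hf, coeff_alternant] at hcoeff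
    have hne : ∑ σ : Equiv.Perm (Fin N), (Equiv.Perm.sign σ : ℤ) •
        (if (χ + staircase N) ∘ σ = b + staircase N then (1 : ℂ) else 0) ≠ 0 := by
      rw [hcoeff]; exact hb.1
    obtain ⟨σ, -, hσ⟩ := Finset.exists_ne_zero_of_sum_ne_zero hne
    have hσ' : (χ + staircase N) ∘ σ = b + staircase N := by
      by_contra h
      exact hσ (by rw [if_neg h, smul_zero])
    have hdom : Dom (b + staircase N) (χ + staircase N) := by
      rw [← hσ']
      exact dom_comp_perm (hχ.add (staircase_strictAnti N).antitone) σ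
    exact hb.2 hdom.of_add_right
  · intro σ _ hσ
    by_contra hne
    have hfb : ¬ f.coeff (b + staircase N - staircase N ∘ σ) = 0 := fun h => hne (by rw [h, smul_zero])
    have hle := hmax _ ⟨hfb, fun hdom => hb.2 ?_⟩
    · have hlt := sum_staircase_mul_lt hσ
      simp only [Pi.sub_apply, Pi.add_apply, Function.comp_apply, mul_sub, mul_add, sum_sub_distrib,
        sum_add_distrib] at hle
      omega
    · have h1 := (dom_comp_perm (staircase_strictAnti N).antitone σ)
      have h2 := hdom.add h1
      rw [sub_add_cancel] at h2
      exact h2.of_add_right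
  · simp

theorem Dom.antisymm {N : ℕ} {a b : Fin N → ℤ} (h : Dom a b) (h' : Dom b a) : a = b := by
  have hn : ∀ n, ∑ i : Fin N, (if (i : ℕ) < n then a i else 0)
      = ∑ i : Fin N, if (i : ℕ) < n then b i else 0 := fun n => le_antisymm (h.2 n) (h'.2 n)
  have hs : ∀ (u : Fin N → ℤ) (j : Fin N), ∑ i : Fin N, (if (i : ℕ) < j + 1 then u i else 0)
      = ∑ i : Fin N, (if (i : ℕ) < j then u i else 0) + u j := by
    intro u j
    have : u j = ∑ i : Fin N, if i = j then u i else 0 := by simp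
    rw [this, ← sum_add_distrib]
    refine Finset.sum_congr rfl fun i _ => ?_
    by_cases hij : i = j
    · subst hij; simp
    · have : (i : ℕ) ≠ j := fun h => hij (Fin.ext h)
      by_cases hlt : (i : ℕ) < j
      · simp [hlt, hij, show (i : ℕ) < j + 1 by omega]
      · simp [hlt, hij, show ¬ (i : ℕ) < j + 1 by omega]
  ext j
  have h1 := hn (j + 1)
  rw [hs, hs, hn j] at h1
  omega

theorem coeff_self_eq_one {N : ℕ} {χ : Fin N → ℤ} (hχ : Antitone χ) {f : LaurentPoly N}
    (hf : alternant (staircase N) * f = alternant (χ + staircase N)) : f.coeff χ = 1 := by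
  have hcoeff := coeff_alternant_mul (staircase N) (χ + staircase N) f
  rw [hf, coeff_alternant, Finset.sum_eq_single (1 : Equiv.Perm (Fin N)),
    Finset.sum_eq_single (1 : Equiv.Perm (Fin N))] at hcoeff
  · simpa using hcoeff.symm
  · intro σ _ hσ
    by_contra hne
    have hfb : f.coeff (χ + staircase N - staircase N ∘ σ) ≠ 0 := fun h => hne (by rw [h, smul_zero])
    have h1 := dom_of_coeff_ne_zero hχ hf hfb
    have h2 := h1.add (Dom.refl (staircase N ∘ σ))
    rw [sub_add_cancel, add_comm χ, add_comm χ] at h2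
    have h3 := h2.of_add_right.antisymm (dom_comp_perm (staircase_strictAnti N).antitone σ)
    exact hσ (Equiv.ext fun i => ((staircase_strictAnti N).injective (congrFun h3 i)).symm)
  · simp
  · intro σ _ hσ
    rw [if_neg, smul_zero]
    intro h
    have hinj : Function.Injective (χ + staircase N) :=
      (hχ.add_strictAnti (staircase_strictAnti N)).injective
    exact hσ (Equiv.ext fun i => hinj (congrFun h i))
  · simp

theorem alternant_mul_psi_jacobiTrudy {x : YoungDiagram × YoungDiagram} {N : ℕ}
    (hN : len x.1 + len x.2 ≤ N) :
    alternant (staircase N) * psi N (jacobiTrudy x.1 x.2)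
      = alternant (chi x.1 x.2 N + staircase N) := by
  rw [mul_comm, psi_jacobiTrudy_mul_alternant _ _ hN]

/-- The Jacobi-Trudy determinant is `m_{λ,μ}` plus lower terms, for every value of `p₀`. -/
theorem jacobiTrudy_sub_mem (t : ℂ) (x : YoungDiagram × YoungDiagram) :
    jacobiTrudy x.1 x.2 - specialize t (mon x.1 x.2) ∈
      Submodule.span ℂ ((fun y => specialize t (mon y.1 y.2)) '' below x) := by
  classical
  have := specialize_mem_span (rename Subtype.val (jacobiTrudy x.1 x.2) - mon x.1 x.2) (below x) ?_ t
  · rwa [map_sub, specialize_rename] at this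
  intro y hy
  filter_upwards [eventually_ge_atTop (len x.1 + len x.2),
    eventually_ge_atTop (len y.1 + len y.2)] with N hx hyN
  have hpsi : phi N (rename Subtype.val (jacobiTrudy x.1 x.2)) = psi N (jacobiTrudy x.1 x.2) := rfl
  rw [map_sub, AddMonoidAlgebra.coeff_sub, Finsupp.sub_apply, coeff_chi_phi_mon hyN hx, hpsi]
  split_ifs with hxy
  · subst hxy
    rw [coeff_self_eq_one (chi_antitone _ _ _) (alternant_mul_psi_jacobiTrudy hx), sub_self]
  · rw [sub_zero]
    by_contra hne
    exact hy ⟨pairLE_of_dom_chi hyN hx (dom_of_coeff_ne_zero (chi_antitone _ _ _)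
      (alternant_mul_psi_jacobiTrudy hx) hne), fun h => hxy h.symm⟩

theorem euler_alternant_sum {N : ℕ} (ν : Fin N → ℤ) :
    ∑ i, euler i (alternant ν) = ((∑ i, ν i : ℤ) : ℂ) • alternant ν := by
  refine laurent_ext fun a => ?_
  rw [AddMonoidAlgebra.coeff_sum, Finsupp.finsetSum_apply, AddMonoidAlgebra.coeff_smul_apply]
  simp only [coeff_euler, ← Finset.sum_mul, smul_eq_mul]
  rw [coeff_alternant, Finset.mul_sum, Finset.mul_sum]
  refine Finset.sum_congr rfl fun σ _ => ?_
  split_ifs with h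
  · rw [← h, ← Equiv.sum_comp σ ν]
    simp
  · simp

theorem euler_euler_alternant_sum {N : ℕ} (ν : Fin N → ℤ) :
    ∑ i, euler i (euler i (alternant ν)) = ((∑ i, ν i ^ 2 : ℤ) : ℂ) • alternant ν := by
  refine laurent_ext fun a => ?_
  rw [AddMonoidAlgebra.coeff_sum, Finsupp.finsetSum_apply, AddMonoidAlgebra.coeff_smul_apply]
  simp only [coeff_euler, ← mul_assoc, ← Finset.sum_mul, smul_eq_mul]
  rw [coeff_alternant, Finset.mul_sum, Finset.mul_sum]
  refine Finset.sum_congr rfl fun σ _ => ?_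
  split_ifs with h
  · rw [← h, ← Equiv.sum_comp σ (fun i => ν i ^ 2)]
    simp [sq]
  · simp

/-- The cross term of `∑ D_m²` on the product of `f` with a product of differences of variables. -/
theorem two_mul_sum_euler_prod_mul_euler {N : ℕ} (f : LaurentPoly N)
    (Q : Fin N → Fin N → LaurentPoly N)
    (hQ : ∀ i j, (zpow i 1 - zpow j 1) * Q i j
      = (zpow i 1 + zpow j 1) * (euler i f - euler j f)) (S : Finset (Fin N × Fin N)) :
    2 * ∑ m, euler m (∏ p ∈ S, (zpow p.2 1 - zpow p.1 1)) * euler m f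
      = (∏ p ∈ S, (zpow p.2 1 - zpow p.1 1)) *
        ∑ p ∈ S, (Q p.1 p.2 + euler p.1 f + euler p.2 f) := by
  classical
  induction S using Finset.induction_on with
  | empty => simp
  | insert p S hp ih =>
    have h1 : ∑ m, euler m (zpow p.2 1 - zpow p.1 1) * euler m f
        = zpow p.2 1 * euler p.2 f - zpow p.1 1 * euler p.1 f := by
      simp [euler_zpow, sub_mul, sum_sub_distrib, ite_mul]
    rw [prod_insert hp, sum_insert hp]
    simp only [Derivation.leibniz, smul_eq_mul, add_mul, sum_add_distrib]
    have h2 : ∑ m, (zpow p.2 1 - zpow p.1 1) * euler m (∏ p ∈ S, (zpow p.2 1 - zpow p.1 1)) * euler m f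
        = (zpow p.2 1 - zpow p.1 1) *
          ∑ m, euler m (∏ p ∈ S, (zpow p.2 1 - zpow p.1 1)) * euler m f := by
      rw [Finset.mul_sum]
      exact Finset.sum_congr rfl fun m _ => mul_assoc _ _ _
    have h3 : ∑ m, (∏ p ∈ S, (zpow p.2 1 - zpow p.1 1)) * euler m (zpow p.2 1 - zpow p.1 1) * euler m f
        = (∏ p ∈ S, (zpow p.2 1 - zpow p.1 1)) *
          (zpow p.2 1 * euler p.2 f - zpow p.1 1 * euler p.1 f) := by
      rw [← h1, Finset.mul_sum]
      exact Finset.sum_congr rfl fun m _ => mul_assoc _ _ _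
    rw [h2, h3]
    have hq := hQ p.1 p.2
    simp only [sum_add_distrib] at ih ⊢
    linear_combination (zpow p.2 1 - zpow p.1 1) * ih
      + (∏ p ∈ S, (zpow p.2 1 - zpow p.1 1)) * hq

/-- The Vandermonde determinant as a product of differences. -/
theorem exists_alternant_staircase_eq (N : ℕ) : ∃ ε : ℤ, ε • alternant (staircase N)
    = ∏ p ∈ (univ : Finset (Fin N × Fin N)).filter (fun p => p.1 < p.2), (zpow p.2 1 - zpow p.1 1) := by
  refine ⟨Equiv.Perm.sign (Fin.revPerm : Equiv.Perm (Fin N)), ?_⟩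
  have h1 : (Matrix.of fun i k : Fin N => zpow k (staircase N i)).submatrix Fin.revPerm id
      = (Matrix.vandermonde fun k : Fin N => zpow k 1).transpose := by
    ext1 i k
    rw [Matrix.submatrix_apply, Matrix.of_apply, Matrix.transpose_apply, Matrix.vandermonde_apply,
      ← zpow_natCast]
    congr 1
    simp only [staircase, Fin.revPerm_apply, Fin.val_rev]
    omega
  have h2 := congrArg Matrix.det h1
  rw [Matrix.det_permute, Matrix.det_transpose, Matrix.det_vandermonde] at h2
  rw [alternant, zsmul_eq_mul, h2, Finset.prod_sigma']
  refine Finset.prod_bij' (fun s _ => (s.1, s.2)) (fun p _ => ⟨p.1, p.2⟩) ?_ ?_ ?_ ?_ ?_ <;> simp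

theorem sum_pairs_euler {N : ℕ} (f : LaurentPoly N) :
    ∑ i, ∑ j ∈ Ioi i, (euler i f + euler j f) = ((N : ℂ) - 1) • ∑ i, euler i f := by
  have h := sum_sum_Ioi_add_eq_sum_sum_off_diag (fun i _ : Fin N => euler i f)
  have h1 : ∀ i : Fin N, ∑ j ∈ ({i}ᶜ : Finset (Fin N)), euler j f = ∑ j, euler j f - euler i f := by
    intro i
    rw [← Finset.sum_add_sum_compl {i} (fun j => euler j f), sum_singleton, add_sub_cancel_left]
  simp only [h1, sum_sub_distrib, sum_const, card_univ, Fintype.card_fin] at h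
  rw [sub_smul, one_smul, Nat.cast_smul_eq_nsmul, ← h]
  refine Finset.sum_congr rfl fun i _ => Finset.sum_congr rfl fun j _ => add_comm _ _

/-- Conjugation by the Vandermonde determinant turns the operator at `k = -1` into `∑ D_m²`. -/
theorem alternant_mul_cms {N : ℕ} (f : LaurentPoly N) (Q : Fin N → Fin N → LaurentPoly N)
    (hQ : ∀ i j, (zpow i 1 - zpow j 1) * Q i j
      = (zpow i 1 + zpow j 1) * (euler i f - euler j f)) :
    ∑ m, euler m (euler m (alternant (staircase N) * f))
      = alternant (staircase N) * (∑ m, euler m (euler m f) + ∑ i, ∑ j ∈ Ioi i, Q i j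
          + ((N : ℂ) - 1) • ∑ m, euler m f)
        + ((∑ i, staircase N i ^ 2 : ℤ) : ℂ) • (alternant (staircase N) * f) := by
  obtain ⟨ε, hε⟩ := exists_alternant_staircase_eq N
  have hε0 : (ε : LaurentPoly N) ≠ 0 := by
    intro h0
    rw [zsmul_eq_mul, h0, zero_mul] at hε
    have := (Finset.prod_eq_zero_iff.mp hε.symm)
    obtain ⟨p, hp, hp0⟩ := this
    simp only [mem_filter, mem_univ, true_and] at hp
    have h1 := congrArg (fun f : LaurentPoly N => f.coeff (Pi.single p.2 1)) hp0
    have h2 : (Pi.single p.1 1 : Fin N → ℤ) ≠ Pi.single p.2 1 := by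
      intro h3
      have := congrFun h3 p.1
      simp [hp.ne] at this
    simp [zpow, coeff_zMon, h2] at h1
  have cross := two_mul_sum_euler_prod_mul_euler f Q hQ
    ((univ : Finset (Fin N × Fin N)).filter (fun p => p.1 < p.2))
  rw [← hε] at cross
  have hpairs : ∑ p ∈ (univ : Finset (Fin N × Fin N)).filter (fun p => p.1 < p.2),
      (Q p.1 p.2 + euler p.1 f + euler p.2 f)
      = ∑ i, ∑ j ∈ Ioi i, Q i j + ((N : ℂ) - 1) • ∑ m, euler m f := by
    rw [← sum_pairs_euler, ← sum_add_distrib]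
    simp only [← sum_add_distrib]
    rw [Finset.sum_sigma']
    refine Finset.sum_bij' (fun p _ => ⟨p.1, p.2⟩) (fun s _ => (s.1, s.2)) ?_ ?_ ?_ ?_ ?_ <;>
      simp [add_assoc]
  have cross' : 2 * ∑ m, euler m (alternant (staircase N)) * euler m f
      = alternant (staircase N) *
        (∑ i, ∑ j ∈ Ioi i, Q i j + ((N : ℂ) - 1) • ∑ m, euler m f) := by
    refine mul_left_cancel₀ hε0 ?_
    rw [← hpairs]
    simp only [zsmul_eq_mul, Derivation.leibniz, Derivation.map_intCast, mul_zero, add_zero,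
      smul_eq_mul, mul_assoc] at cross
    rw [← cross, ← Finset.mul_sum]
    ring
  have h2 := euler_euler_alternant_sum (staircase N)
  have expand : ∀ m, euler m (euler m (alternant (staircase N) * f))
      = alternant (staircase N) * euler m (euler m f)
        + 2 * (euler m (alternant (staircase N)) * euler m f)
        + f * euler m (euler m (alternant (staircase N))) := by
    intro m
    simp only [Derivation.leibniz, smul_eq_mul, map_add]
    ring
  simp only [expand, sum_add_distrib, ← Finset.mul_sum]
  rw [cross', h2, mul_smul_comm, mul_comm f]
  ring

theorem alternant_staircase_ne_zero (N : ℕ) : alternant (staircase N) ≠ 0 := by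
  intro h
  have := coeff_self_eq_one (N := N) (χ := 0) (f := 0) (fun _ _ _ => le_rfl) (by
    rw [zero_add, h, zero_mul])
  simp at this

theorem psi_cms_jacobiTrudy {x : YoungDiagram × YoungDiagram} {N : ℕ}
    (hN : len x.1 + len x.2 ≤ N) :
    psi N (cms (-1) N (jacobiTrudy x.1 x.2))
      = energy (-1) N x • psi N (jacobiTrudy x.1 x.2) := by
  obtain ⟨Q, hQ, hcms⟩ := psi_cms N (-1) (jacobiTrudy x.1 x.2)
  set f := psi N (jacobiTrudy x.1 x.2) with hf
  set χ := chi x.1 x.2 N with hχ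
  have hΔ : alternant (staircase N) * f = alternant (χ + staircase N) :=
    alternant_mul_psi_jacobiTrudy hN
  have hΔ0 := alternant_staircase_ne_zero N
  have hdeg : ∑ m, euler m f = ((∑ i, χ i : ℤ) : ℂ) • f := by
    refine mul_left_cancel₀ hΔ0 ?_
    have h1 := euler_alternant_sum (χ + staircase N)
    have h2 := euler_alternant_sum (staircase N)
    rw [← hΔ] at h1
    simp only [Derivation.leibniz, smul_eq_mul, sum_add_distrib, ← Finset.mul_sum] at h1
    rw [h2] at h1
    simp only [Pi.add_apply, sum_add_distrib, Int.cast_add, add_smul] at h1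
    rw [mul_smul_comm, mul_comm f] at h1
    rw [mul_smul_comm]
    exact add_right_cancel h1
  have h1 := alternant_mul_cms f Q hQ
  rw [hdeg, hΔ, euler_euler_alternant_sum, ← hΔ] at h1
  rw [hcms, neg_one_smul, sub_neg_eq_add]
  refine mul_left_cancel₀ hΔ0 ?_
  have hE : energy (-1) N x = ((∑ i, (χ + staircase N) i ^ 2 : ℤ) : ℂ)
      - ((∑ i, staircase N i ^ 2 : ℤ) : ℂ) - ((N : ℂ) - 1) * ((∑ i, χ i : ℤ) : ℂ) := by
    rw [← energy_natCast (-1) hN]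
    have hs := sum_Ioi_sub χ
    have hs' : ∑ i, ∑ j ∈ Ioi i, ((χ i : ℂ) - χ j) = ((∑ i : Fin N, ((N : ℤ) - 1 - 2 * i) * χ i : ℤ) : ℂ) := by
      rw [← hs]; push_cast; rfl
    rw [hs']
    push_cast
    simp only [Finset.mul_sum, ← sum_sub_distrib, staircase, Pi.add_apply, hχ]
    refine Finset.sum_congr rfl fun i _ => ?_
    push_cast
    ring
  rw [mul_add, mul_smul_comm, mul_smul_comm, smul_smul] at h1
  rw [mul_smul_comm, hE, sub_smul, sub_smul, h1]
  abel

/-- At `k = -1` the Jacobi-Trudy determinant is an eigenfunction, for every value of `p₀`. -/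
theorem cms_jacobiTrudy (t : ℂ) (x : YoungDiagram × YoungDiagram) :
    cms (-1) t (jacobiTrudy x.1 x.2) = energy (-1) t x • jacobiTrudy x.1 x.2 := by
  obtain ⟨G, hG⟩ := exists_specialize_eq_cms (-1) (rename Subtype.val (jacobiTrudy x.1 x.2))
  have := specialize_eq_zero
    (G - Polynomial.aeval (X 0 : Lam) (energyPoly (-1) x) * rename Subtype.val (jacobiTrudy x.1 x.2)) ?_ t
  · rwa [map_sub, hG, map_mul, specialize_aeval_X_zero, eval_energyPoly, ← smul_eq_C_mul, specialize_rename,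
      sub_eq_zero] at this
  filter_upwards [eventually_ge_atTop (len x.1 + len x.2)] with N hx
  have hpsi : phi N (rename Subtype.val (jacobiTrudy x.1 x.2)) = psi N (jacobiTrudy x.1 x.2) := rfl
  rw [map_sub, map_mul, phi_aeval_X_zero, eval_energyPoly, ← psi_specialize, hG, ← Algebra.smul_def,
    specialize_rename, hpsi, psi_cms_jacobiTrudy hx, sub_self]

/-! ### Existence, uniqueness and continuity of the eigenfunctions -/

/-- The span of the monomial functions of a set of pairs, for a value `t` of `p₀`. -/
def spanMon (t : ℂ) (A : Set (YoungDiagram × YoungDiagram)) : Submodule ℂ LamFib :=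
  Submodule.span ℂ ((fun y => specialize t (mon y.1 y.2)) '' A)

theorem spanMon_mono {t : ℂ} {A B : Set (YoungDiagram × YoungDiagram)} (h : A ⊆ B) :
    spanMon t A ≤ spanMon t B :=
  Submodule.span_mono (Set.image_mono h)

theorem mon_mem_spanMon {t : ℂ} {A : Set (YoungDiagram × YoungDiagram)}
    {y : YoungDiagram × YoungDiagram} (hy : y ∈ A) : specialize t (mon y.1 y.2) ∈ spanMon t A :=
  Submodule.subset_span ⟨y, hy, rfl⟩

theorem below_subset_of_mem {x y : YoungDiagram × YoungDiagram} (h : y ∈ below x) :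
    below y ⊆ below x := by
  intro z hz
  refine ⟨hz.1.trans h.1, ?_⟩
  rintro rfl
  exact h.2 (h.1.antisymm hz.1)

theorem notMem_below_self (x : YoungDiagram × YoungDiagram) : x ∉ below x := fun h => h.2 rfl

theorem ncard_below_lt {x y : YoungDiagram × YoungDiagram} (h : y ∈ below x) :
    (below y).ncard < (below x).ncard := by
  refine Set.ncard_lt_ncard ⟨below_subset_of_mem h, fun hsub => ?_⟩ (finite_below x)
  exact notMem_below_self y (hsub h)

/-- The polynomial whose roots are the eigenvalues that belong to a finite set of pairs. -/
def energyProd (k t : ℂ) (A : Finset (YoungDiagram × YoungDiagram)) : Polynomial ℂ :=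
  ∏ y ∈ A, (Polynomial.X - Polynomial.C (energy k t y))

theorem aeval_X_sub_C_apply (L : Module.End ℂ LamFib) (c : ℂ) (v : LamFib) :
    Polynomial.aeval L (Polynomial.X - Polynomial.C c) v = L v - c • v := by
  simp [Module.algebraMap_end_apply]

/-- A triangular operator is annihilated by the product of the differences with its diagonal
entries. -/
theorem aeval_energyProd_eq_zero (k t : ℂ) (A : Finset (YoungDiagram × YoungDiagram))
    (hA : ∀ y ∈ A, below y ⊆ A) {v : LamFib} (hv : v ∈ spanMon t A) :
    Polynomial.aeval (cms k t) (energyProd k t A) v = 0 := by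
  classical
  induction A using Finset.strongInduction generalizing v with
  | H A ih =>
    rcases A.eq_empty_or_nonempty with rfl | hne
    · have : v = 0 := by simpa [spanMon] using hv
      rw [this, map_zero]
    obtain ⟨y₀, hy₀, hmax⟩ := A.exists_max_image (fun y => (below y).ncard) hne
    have hA' : ∀ y ∈ A.erase y₀, below y ⊆ A.erase y₀ := by
      intro y hy z hz
      refine mem_coe.mpr (mem_erase.mpr ⟨?_, hA y (mem_of_mem_erase hy) hz⟩)
      rintro rfl
      exact absurd (ncard_below_lt hz) (not_lt.mpr (hmax y (mem_of_mem_erase hy)))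
    have hmem : cms k t v - energy k t y₀ • v ∈ spanMon t (A.erase y₀) := by
      refine Submodule.span_induction (p := fun v _ =>
        cms k t v - energy k t y₀ • v ∈ spanMon t (A.erase y₀)) ?_ ?_ ?_ ?_ hv
      · rintro _ ⟨y, hy, rfl⟩
        have htri := cms_specialize_mon k t y
        by_cases h : y = y₀
        · subst h
          refine spanMon_mono ?_ htri
          intro z hz
          refine mem_coe.mpr (mem_erase.mpr ⟨?_, hA y hy hz⟩)
          rintro rfl
          exact notMem_below_self _ hz
        · have hy' : y ∈ A.erase y₀ := mem_erase.mpr ⟨h, hy⟩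
          have h1 := spanMon_mono (hA' y hy') htri
          have h2 := Submodule.smul_mem _ (energy k t y - energy k t y₀)
            (mon_mem_spanMon (t := t) (A := (A.erase y₀ : Set _)) (mem_coe.mpr hy'))
          have h3 := add_mem h1 h2
          convert h3 using 1
          module
      · simp
      · intro u v _ _ hu hv
        have := add_mem hu hv
        convert this using 1
        rw [map_add]
        module
      · intro c v _ hv
        have := Submodule.smul_mem _ c hv
        convert this using 1
        rw [map_smul]
        module
    have hprod : energyProd k t A = energyProd k t (A.erase y₀)
        * (Polynomial.X - Polynomial.C (energy k t y₀)) :=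
      (Finset.prod_erase_mul A _ hy₀).symm
    rw [hprod, map_mul, Module.End.mul_apply, aeval_X_sub_C_apply]
    exact ih _ (erase_ssubset hy₀) hA' hmem

theorem cms_mem_spanMon_below (k t : ℂ) (x : YoungDiagram × YoungDiagram) {v : LamFib}
    (hv : v ∈ spanMon t (below x)) : cms k t v ∈ spanMon t (below x) := by
  refine Submodule.span_induction (p := fun v _ => cms k t v ∈ spanMon t (below x)) ?_ ?_ ?_ ?_ hv
  · rintro _ ⟨y, hy, rfl⟩
    have h1 := spanMon_mono (below_subset_of_mem hy) (cms_specialize_mon k t y)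
    have h2 := Submodule.smul_mem _ (energy k t y) (mon_mem_spanMon (t := t) hy)
    simpa using add_mem h1 h2
  · simp
  · intro u v _ _ hu hv
    rw [map_add]; exact add_mem hu hv
  · intro c v _ hv
    rw [map_smul]; exact Submodule.smul_mem _ c hv

theorem aeval_mem_spanMon_below (k t : ℂ) (x : YoungDiagram × YoungDiagram) (q : Polynomial ℂ)
    {v : LamFib} (hv : v ∈ spanMon t (below x)) :
    Polynomial.aeval (cms k t) q v ∈ spanMon t (below x) := by
  induction q using Polynomial.induction_on generalizing v with
  | C a =>
    rw [Polynomial.aeval_C, Module.algebraMap_end_apply]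
    exact Submodule.smul_mem _ _ hv
  | add p q hp hq => rw [map_add, LinearMap.add_apply]; exact add_mem (hp hv) (hq hv)
  | monomial n a h =>
    rw [pow_succ, ← mul_assoc, map_mul, Polynomial.aeval_X, Module.End.mul_apply]
    exact h (cms_mem_spanMon_below k t x hv)

/-- A polynomial in the CMS operator multiplies the leading term by its value at the eigenvalue. -/
theorem aeval_sub_mem (k t : ℂ) (x : YoungDiagram × YoungDiagram) (q : Polynomial ℂ) :
    Polynomial.aeval (cms k t) q (specialize t (mon x.1 x.2))
      - q.eval (energy k t x) • specialize t (mon x.1 x.2) ∈ spanMon t (below x) := by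
  obtain ⟨r, hr⟩ := Polynomial.X_sub_C_dvd_sub_C_eval (p := q) (a := energy k t x)
  have h1 := aeval_mem_spanMon_below k t x r (cms_specialize_mon k t x)
  rw [← aeval_X_sub_C_apply, ← Module.End.mul_apply, ← map_mul, mul_comm, ← hr, map_sub,
    LinearMap.sub_apply, Polynomial.aeval_C, Module.algebraMap_end_apply] at h1
  exact h1

theorem isJackLaurent_iff {k t : ℂ} {x : YoungDiagram × YoungDiagram} {P : LamFib} :
    IsJackLaurent k t x.1 x.2 P ↔ P - specialize t (mon x.1 x.2) ∈ spanMon t (below x) ∧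
      cms k t P = energy k t x • P := by
  have hset : {m : LamFib | ∃ y : YoungDiagram × YoungDiagram,
        PairLE y (x.1, x.2) ∧ y ≠ (x.1, x.2) ∧ m = specialize t (mon y.1 y.2)}
      = (fun y => specialize t (mon y.1 y.2)) '' below x := by
    ext m
    constructor
    · rintro ⟨y, h1, h2, rfl⟩
      exact ⟨y, ⟨h1, h2⟩, rfl⟩
    · rintro ⟨y, ⟨h1, h2⟩, rfl⟩
      exact ⟨y, h1, h2, rfl⟩
  have hnot := specialize_mon_notMem_span t x (below x) (notMem_below_self x)
  rw [IsJackLaurent, hset]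
  refine and_congr_right fun hP => ⟨?_, ?_⟩
  · rintro ⟨E, hE⟩
    rw [hE.apply_eq_smul]
    have hPE := hE.apply_eq_smul
    -- The leading coefficient determines the eigenvalue.
    have h1 := cms_mem_spanMon_below k t x hP
    have h2 := cms_specialize_mon k t x
    rw [map_sub, hPE] at h1
    by_contra hne
    have hE' : energy k t x - E ≠ 0 := by
      intro h0
      rw [sub_eq_zero] at h0
      exact hne (by rw [h0])
    refine hnot ((Submodule.smul_mem_iff _ hE').mp ?_)
    have h3 := sub_mem (sub_mem (Submodule.smul_mem _ E hP) h1) h2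
    convert h3 using 1
    module
  · intro hPE
    refine ⟨energy k t x, Module.End.mem_eigenspace_iff.mpr hPE, ?_⟩
    rintro rfl
    rw [zero_sub, Submodule.neg_mem_iff] at hP
    exact hnot hP

theorem coe_toFinset_below (x : YoungDiagram × YoungDiagram) :
    ((finite_below x).toFinset : Set (YoungDiagram × YoungDiagram)) = below x :=
  (finite_below x).coe_toFinset

theorem eval_energyProd_ne_zero {k t : ℂ} {x : YoungDiagram × YoungDiagram}
    (h : ∀ y ∈ below x, energy k t y ≠ energy k t x) :
    (energyProd k t (finite_below x).toFinset).eval (energy k t x) ≠ 0 := by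
  rw [energyProd, Polynomial.eval_prod, Finset.prod_ne_zero_iff]
  intro y hy
  rw [Polynomial.eval_sub, Polynomial.eval_X, Polynomial.eval_C, sub_ne_zero]
  exact (h y ((finite_below x).mem_toFinset.mp hy)).symm

theorem isJackLaurent_unique {k t : ℂ} {x : YoungDiagram × YoungDiagram}
    (h : ∀ y ∈ below x, energy k t y ≠ energy k t x) {P P' : LamFib}
    (hP : IsJackLaurent k t x.1 x.2 P) (hP' : IsJackLaurent k t x.1 x.2 P') : P = P' := by
  rw [isJackLaurent_iff] at hP hP'
  have hmem : P - P' ∈ spanMon t (below x) := by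
    have := sub_mem hP.1 hP'.1
    rwa [sub_sub_sub_cancel_right] at this
  have heig : cms k t (P - P') = energy k t x • (P - P') := by
    rw [map_sub, hP.2, hP'.2, smul_sub]
  by_contra hne
  have hev : (cms k t).HasEigenvector (energy k t x) (P - P') :=
    ⟨Module.End.mem_eigenspace_iff.mpr heig, sub_ne_zero.mpr hne⟩
  have h0 := aeval_energyProd_eq_zero k t (finite_below x).toFinset (v := P - P') (by
    intro y hy
    rw [coe_toFinset_below]
    exact below_subset_of_mem ((finite_below x).mem_toFinset.mp hy)) (by
    rwa [coe_toFinset_below])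
  rw [Module.End.aeval_apply_of_hasEigenvector hev] at h0
  exact (smul_ne_zero (eval_energyProd_ne_zero h) (sub_ne_zero.mpr hne)) h0

/-- The explicit eigenfunction `∏_{y < x} (L - E_y) / (E_x - E_y) m_x`. -/
def eigenfunction (k t : ℂ) (x : YoungDiagram × YoungDiagram) : LamFib :=
  ((energyProd k t (finite_below x).toFinset).eval (energy k t x))⁻¹ •
    Polynomial.aeval (cms k t) (energyProd k t (finite_below x).toFinset)
      (specialize t (mon x.1 x.2))

theorem isJackLaurent_eigenfunction {k t : ℂ} {x : YoungDiagram × YoungDiagram}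
    (h : ∀ y ∈ below x, energy k t y ≠ energy k t x) :
    IsJackLaurent k t x.1 x.2 (eigenfunction k t x) := by
  classical
  have hne := eval_energyProd_ne_zero h
  rw [isJackLaurent_iff]
  constructor
  · have h1 := Submodule.smul_mem _
      ((energyProd k t (finite_below x).toFinset).eval (energy k t x))⁻¹
      (aeval_sub_mem k t x (energyProd k t (finite_below x).toFinset))
    rwa [smul_sub, smul_smul, inv_mul_cancel₀ hne, one_smul] at h1
  · have hx : x ∉ (finite_below x).toFinset := by
      rw [Set.Finite.mem_toFinset]
      exact notMem_below_self x
    have h0 := aeval_energyProd_eq_zero k t (insert x (finite_below x).toFinset)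
      (v := specialize t (mon x.1 x.2)) (by
        intro y hy
        rw [coe_insert, coe_toFinset_below]
        rcases mem_insert.mp hy with rfl | hy
        · exact Set.subset_insert _ _
        · exact (below_subset_of_mem ((finite_below x).mem_toFinset.mp hy)).trans
            (Set.subset_insert _ _)) (mon_mem_spanMon (by simp))
    rw [energyProd, Finset.prod_insert hx, map_mul, Module.End.mul_apply, aeval_X_sub_C_apply,
      sub_eq_zero] at h0
    rw [eigenfunction, map_smul, smul_comm]
    exact congrArg _ h0

theorem cms_affine (k t : ℂ) (f : LamFib) :
    cms k t f = cms 0 t f + k • (cms 1 t f - cms 0 t f) := by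
  simp only [cms, LinearMap.add_apply, LinearMap.sub_apply, LinearMap.smul_apply]
  module

theorem continuous_energy (t : ℂ) (y : YoungDiagram × YoungDiagram) :
    Continuous fun k => energy k t y := by
  unfold energy
  fun_prop

theorem continuous_aeval_energyProd (t : ℂ) (A : Finset (YoungDiagram × YoungDiagram)) (v : LamFib)
    (φ : LamFib →ₗ[ℂ] ℂ) :
    Continuous fun k => φ (Polynomial.aeval (cms k t) (energyProd k t A) v) := by
  classical
  induction A using Finset.induction_on generalizing φ with
  | empty => simpa [energyProd] using continuous_const
  | insert y A hy ih =>
    have : ∀ k, φ (Polynomial.aeval (cms k t) (energyProd k t (insert y A)) v)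
        = (φ.comp (cms 0 t)) (Polynomial.aeval (cms k t) (energyProd k t A) v)
          + k * (φ.comp (cms 1 t - cms 0 t)) (Polynomial.aeval (cms k t) (energyProd k t A) v)
          - energy k t y * φ (Polynomial.aeval (cms k t) (energyProd k t A) v) := by
      intro k
      rw [energyProd, Finset.prod_insert hy, map_mul, Module.End.mul_apply, aeval_X_sub_C_apply,
        cms_affine, map_sub, map_add, map_smul, map_smul]
      rfl
    simp only [this]
    exact ((ih _).add (continuous_id.mul (ih _))).sub ((continuous_energy t y).mul (ih _))

theorem continuousAt_coeff_eigenfunction {k t : ℂ} {x : YoungDiagram × YoungDiagram}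
    (h : ∀ y ∈ below x, energy k t y ≠ energy k t x) (d : {a : ℤ // a ≠ 0} →₀ ℕ) :
    ContinuousAt (fun k => MvPolynomial.coeff d (eigenfunction k t x)) k := by
  simp only [eigenfunction, MvPolynomial.coeff_smul, smul_eq_mul]
  refine ContinuousAt.mul (ContinuousAt.inv₀ ?_ (eval_energyProd_ne_zero h)) ?_
  · simp only [energyProd, Polynomial.eval_prod, Polynomial.eval_sub, Polynomial.eval_X,
      Polynomial.eval_C]
    exact (continuous_finsetProd _ fun y _ =>
      (continuous_energy t x).sub (continuous_energy t y)).continuousAt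
  · exact (continuous_aeval_energyProd t _ _ (MvPolynomial.lcoeff ℂ d)).continuousAt

theorem eventually_energy_ne {t : ℂ} {x : YoungDiagram × YoungDiagram} {k : ℂ}
    (h : ∀ y ∈ below x, energy k t y ≠ energy k t x) :
    ∀ᶠ k' in nhds k, ∀ y ∈ below x, energy k' t y ≠ energy k' t x :=
  (eventually_all_finite (finite_below x)).mpr fun y hy =>
    ((((continuous_energy t y).sub (continuous_energy t x)).tendsto k).eventually_ne
      (sub_ne_zero.mpr (h y hy))).mono fun _ hk => sub_ne_zero.mp hk

theorem jackLaurent_eq_eigenfunction {k t : ℂ} {x : YoungDiagram × YoungDiagram}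
    (h : ∀ y ∈ below x, energy k t y ≠ energy k t x) :
    jackLaurent k t x.1 x.2 = eigenfunction k t x :=
  isJackLaurent_unique h (Classical.epsilon_spec ⟨_, isJackLaurent_eigenfunction h⟩)
    (isJackLaurent_eigenfunction h)

theorem isJackLaurent_jacobiTrudy (t : ℂ) (x : YoungDiagram × YoungDiagram) :
    IsJackLaurent (-1) t x.1 x.2 (jacobiTrudy x.1 x.2) :=
  isJackLaurent_iff.mpr ⟨jacobiTrudy_sub_mem t x, cms_jacobiTrudy t x⟩

end JackLaurent

end

open Filter Topology JackLaurent in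
/-- For each `(λ, μ)` there is a finite set `S` such that for every `p0 ∉ S` the function
`P_{λ,μ}(k, p0)` is well defined for all `k ≠ -1` near `-1`, and, as `k → -1`, each of its
coefficients converges to that of the Jacobi-Trudy determinant, which is independent of `p0`. -/
theorem theorem7p1 (lam mu : YoungDiagram) :
    ∃ S : Set ℂ, S.Finite ∧ ∀ p0 : ℂ, p0 ∉ S →
      (∀ᶠ k in 𝓝[≠] (-1 : ℂ), ∃! P : LamFib, IsJackLaurent k p0 lam mu P) ∧
      ∀ d : {a : ℤ // a ≠ 0} →₀ ℕ,
        Tendsto (fun k : ℂ => MvPolynomial.coeff d (jackLaurent k p0 lam mu))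
          (𝓝[≠] (-1 : ℂ)) (𝓝 (MvPolynomial.coeff d (jacobiTrudy lam mu))) := by
  refine ⟨⋃ y ∈ below (lam, mu), {t | energy (-1) t y = energy (-1) t (lam, mu)},
    (finite_below _).biUnion fun y hy => finite_energy_eq hy, fun p0 hp0 => ?_⟩
  have hne : ∀ y ∈ below (lam, mu), energy (-1) p0 y ≠ energy (-1) p0 (lam, mu) :=
    fun y hy h => hp0 (Set.mem_biUnion hy h)
  have hev := (eventually_energy_ne hne).filter_mono (nhdsWithin_le_nhds (s := {-1}ᶜ))
  refine ⟨?_, fun d => ?_⟩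
  · filter_upwards [hev] with k hk
    exact ⟨_, isJackLaurent_eigenfunction (x := (lam, mu)) hk,
      fun P hP => isJackLaurent_unique (x := (lam, mu)) hk hP (isJackLaurent_eigenfunction hk)⟩
  · have hlim : eigenfunction (-1) p0 (lam, mu) = jacobiTrudy lam mu :=
      isJackLaurent_unique hne (isJackLaurent_eigenfunction hne)
        (isJackLaurent_jacobiTrudy p0 (lam, mu))
    rw [← hlim]
    refine Tendsto.congr' ?_
      ((continuousAt_coeff_eigenfunction hne d).tendsto.mono_left nhdsWithin_le_nhds)
    filter_upwards [hev] with k hk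
    rw [← jackLaurent_eq_eigenfunction hk]
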